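/- **Machine models.** An *oracle* is a function $O:\{0,1\}^*\to\{0,1\}$; $\log$ is rounded up to an integer ($\lceil\log_2 n\rceil$). A *transducer* is a deterministic Turing machine with a two-way read-only input tape (with end markers), a one-way infinite binary work tape with a left end marker, and a write-only output tape. A family $\{f_n:\{0,1\}^n\to\{0,1\}^{m(n)}\}_n$ is in $\mathsf{FSPACE}[s]$ if some transducer halts on every input $x$ of every length $n$ with output $f_n(x)$, using at most $s(n)$ cells of its work tape. A language $L$ is in $\mathsf{SPACE}[s]$ if its indicator function is in $\mathsf{FSPACE}[s]$. $\mathsf{FSPACE}[n/\omega(1)]$ and $\mathsf{SPACE}[n/\omega(1)]$ are the unions over all functions $s:\mathbb N\to\mathbb N$ with $s(n)=o(n)$, and $\mathsf{FL}=\bigcup_k\mathsf{FSPACE}[k\log n]$. The family is in $\mathsf{inplaceFSPACE}[s]$ if there is a deterministic Turing machine with a single bounded binary read-write tape (with end markers) that, for every $n$ and every $x\in\{0,1\}^n$, started with tape contents $x\circ 0^{\max\{0,m(n)-n\}}\circ 0^{s(n)}$, halts with tape contents $f_n(x)\circ 1^{\max\{0,n-m(n)\}}\circ 1^{s(n)}$.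 Put $\mathsf{inplaceFL}=\bigcup_k\mathsf{inplaceFSPACE}[k\log n]$. **Oracle versions.** In $\mathsf{FSPACE}^O[s]$ the transducer also has a write-only oracle tape and a read-only oracle output bit, initially $0$. In a query state, $O(y)$ is put on the oracle output bit, where $y$ is the contents of the oracle tape, and the oracle tape is erased. The oracle tape is subject to the space bound: it never holds more than $s(n)$ bits. $\mathsf{SPACE}^O[s]$, $\mathsf{FSPACE}^O[n/\omega(1)]$, $\mathsf{SPACE}^O[n/\omega(1)]$ and $\mathsf{FL}^O$ are defined from it as above. In $\mathsf{inplaceFL}^O$ the in-place machine has a read-only oracle output bit, initially $0$, but no oracle tape: in a query state the bit becomes $O(y)$, where $y$ is the current contents of the interval of the tape (of total length $N$) whose two end points are specified by the last $2\lceil\log N\rceil$ bits of the tape. **Theorem.** There are a unary language $L\subseteq\{0\}^*$ with $L\in\mathsf{SPACE}[n]\setminus\mathsf{SPACE}[n/\omega(1)]$ and a family $f$ of permutations of $\{0,1\}^n$, $n\in\mathbb N$, such that $$f(x)=\begin{cases}x & \text{if } x \text{ is not of the form } 0^{n-1}b,\ b\in\{0,1\},\\ 0^{n-1}b & \text{if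 } x=0^{n-1}b \text{ and } 0^n\notin L,\\ 0^{n-1}\overline b & \text{if } x=0^{n-1}b \text{ and } 0^n\in L,\end{cases}$$ and $f\in\mathsf{inplaceFL}$, $f\notin\mathsf{FSPACE}[n/\omega(1)]$; in particular $f\notin\mathsf{FL}$, so $\mathsf{inplaceFL}\not\subseteq\mathsf{FL}$. Moreover this relativizes: for every oracle $O$ there are such $L$ and $f$ with all of $\mathsf{SPACE}$, $\mathsf{FSPACE}$, $\mathsf{FL}$, $\mathsf{inplaceFL}$ replaced by $\mathsf{SPACE}^O$, $\mathsf{FSPACE}^O$, $\mathsf{FL}^O$, $\mathsf{inplaceFL}^O$, and $\mathsf{inplaceFL}^O\not\subseteq\mathsf{FL}^O$. -/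

import Mathlib

open Filter Asymptotics

namespace InPlace

/-- An oracle, i.e. a function `{0,1}* → {0,1}`. -/
abbrev Oracle := List Bool → Bool

/-- A family of functions `f_n : {0,1}^n → {0,1}^{m(n)}`, `n ∈ ℕ`. -/
structure FunFamily where
  m : ℕ → ℕ
  toFun : List Bool → List Bool
  length_toFun : ∀ x, (toFun x).length = m x.length

/-- The family consists of permutations of `{0,1}^n`. -/
def FunFamily.IsPermutation (f : FunFamily) : Prop :=
  (∀ n, f.m n = n) ∧ Function.Bijective f.toFun

/-- What a head sees: an end marker, or a bit. -/
inductive Cell where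
  | leftEnd
  | bit (b : Bool)
  | rightEnd

inductive Move where
  | left
  | stay
  | right

/-- The cells of a bounded tape with contents `t` are numbered `1, …, t.length`; positions `0` and
`t.length + 1` are the end markers. -/
def readTape (t : List Bool) : ℕ → Cell
  | 0 => .leftEnd
  | i + 1 => match t[i]? with
    | some b => .bit b
    | none => .rightEnd

/-- Write a bit; end markers cannot be overwritten. -/
def writeTape (t : List Bool) (b : Bool) : ℕ → List Bool
  | 0 => t
  | i + 1 => t.set i b

/-- Move a head on a bounded tape with `N` cells; a head does not go beyond the end markers. -/
def moveBounded (N : ℕ) : Move → ℕ → ℕ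
  | .left, h => h - 1
  | .stay, h => h
  | .right, h => min (h + 1) (N + 1)

/-- A one-way infinite binary work tape: position `0` is the left end marker, position `i + 1`
holds the bit `w i`. -/
def readWork (w : ℕ → Bool) : ℕ → Cell
  | 0 => .leftEnd
  | i + 1 => .bit (w i)

def writeWork (w : ℕ → Bool) (b : Bool) : ℕ → (ℕ → Bool)
  | 0 => w
  | i + 1 => Function.update w i b

def moveUnbounded : Move → ℕ → ℕ
  | .left, h => h - 1
  | .stay, h => h
  | .right, h => h + 1

/-! ### Transducers: read-only input, work tape, write-only output -/

/-- What a transducer does in one step. -/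
structure TransducerAction (Q : Type) where
  next : Q
  /-- the bit written on the work tape -/
  write : Bool
  inMove : Move
  workMove : Move
  /-- bit (if any) appended to the write-only oracle tape -/
  toOracle : Option Bool
  /-- bit (if any) appended to the write-only output tape -/
  toOutput : Option Bool

/-- A deterministic Turing machine with a two-way read-only input tape, a binary work tape, a
write-only output tape, a write-only oracle tape and a read-only oracle output bit. The action
depends on the state, the scanned input cell, the scanned work cell and the oracle output bit;
`none` means that the machine halts. In a state with `isQuery` the oracle is consulted. -/
structure Transducer where
  Q : Type
  finite : Finite Q
  start : Q
  isQuery : Q → Bool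
  δ : Q → Cell → Cell → Bool → Option (TransducerAction Q)

namespace Transducer

/-- A machine without oracle access. -/
def QueryFree (M : Transducer) : Prop := ∀ q, M.isQuery q = false

structure Cfg (M : Transducer) where
  state : M.Q
  inHead : ℕ
  work : ℕ → Bool
  workHead : ℕ
  oracleTape : List Bool
  answer : Bool
  output : List Bool

def init (M : Transducer) : M.Cfg where
  state := M.start
  inHead := 0
  work := fun _ => false
  workHead := 0
  oracleTape := []
  answer := false
  output := []

/-- In a query state, put `O(y)` on the oracle output bit, where `y` is the contents of the oracle
tape, and erase the oracle tape. -/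
def consult (M : Transducer) (O : Oracle) (c : M.Cfg) : M.Cfg :=
  if M.isQuery c.state then { c with answer := O c.oracleTape, oracleTape := [] } else c

/-- One step on input `x`. -/
def step (M : Transducer) (O : Oracle) (x : List Bool) (c₀ : M.Cfg) : Option M.Cfg :=
  let c := M.consult O c₀
  (M.δ c.state (readTape x c.inHead) (readWork c.work c.workHead) c.answer).map fun a =>
    { state := a.next
      inHead := moveBounded x.length a.inMove c.inHead
      work := writeWork c.work a.write c.workHead
      workHead := moveUnbounded a.workMove c.workHead
      oracleTape := c.oracleTape ++ a.toOracle.toList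
      answer := c.answer
      output := c.output ++ a.toOutput.toList }

/-- With oracle `O`, the machine halts on every input `x` with output `f x`, and along the way it
uses at most `s |x|` cells of the work tape and at most `s |x|` cells of the oracle tape. -/
def Computes (M : Transducer) (O : Oracle) (s : ℕ → ℕ) (f : List Bool → List Bool) : Prop :=
  ∀ x : List Bool,
    (∀ c, StateTransition.Reaches (M.step O x) M.init c →
      c.workHead ≤ s x.length ∧ c.oracleTape.length ≤ s x.length) ∧
    ∃ c, StateTransition.Reaches (M.step O x) M.init c ∧ M.step O x c = none ∧ c.output = f x

end Transducer

/-- `FSPACE^O[s]`. -/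
def FSPACERel (O : Oracle) (s : ℕ → ℕ) : Set FunFamily :=
  {f | ∃ M : Transducer, M.Computes O s f.toFun}

/-- `FSPACE[s]`: machines that never query an oracle (so the oracle supplied is irrelevant). -/
def FSPACE (s : ℕ → ℕ) : Set FunFamily :=
  {f | ∃ M : Transducer, M.QueryFree ∧ M.Computes (fun _ => false) s f.toFun}

open Classical in
/-- The indicator function of a language, as a family of functions `{0,1}^n → {0,1}`. -/
noncomputable def indicator (L : Set (List Bool)) : FunFamily where
  m := fun _ => 1
  toFun := fun x => [decide (x ∈ L)]
  length_toFun := fun _ => rfl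

/-- `SPACE^O[s]`. -/
def SPACERel (O : Oracle) (s : ℕ → ℕ) : Set (Set (List Bool)) :=
  {L | indicator L ∈ FSPACERel O s}

/-- `SPACE[s]`. -/
def SPACE (s : ℕ → ℕ) : Set (Set (List Bool)) :=
  {L | indicator L ∈ FSPACE s}

/-- The space bounds of the form `n / ω(1)`, that is `o(n)`. -/
def Sublinear (s : ℕ → ℕ) : Prop :=
  (fun n => (s n : ℝ)) =o[atTop] (fun n => (n : ℝ))

/-- `FSPACE^O[n/ω(1)]`. -/
def FSPACESublinearRel (O : Oracle) : Set FunFamily := {f | ∃ s, Sublinear s ∧ f ∈ FSPACERel O s}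

/-- `FSPACE[n/ω(1)]`. -/
def FSPACESublinear : Set FunFamily := {f | ∃ s, Sublinear s ∧ f ∈ FSPACE s}

/-- `SPACE^O[n/ω(1)]`. -/
def SPACESublinearRel (O : Oracle) : Set (Set (List Bool)) :=
  {L | ∃ s, Sublinear s ∧ L ∈ SPACERel O s}

/-- `SPACE[n/ω(1)]`. -/
def SPACESublinear : Set (Set (List Bool)) := {L | ∃ s, Sublinear s ∧ L ∈ SPACE s}

/-- `FL^O`, the union over `k` of `FSPACE^O[k log n]`. -/
def FLRel (O : Oracle) : Set FunFamily := {f | ∃ k : ℕ, f ∈ FSPACERel O fun n => k * Nat.clog 2 n}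

/-- `FL`, the union over `k` of `FSPACE[k log n]`. -/
def FL : Set FunFamily := {f | ∃ k : ℕ, f ∈ FSPACE fun n => k * Nat.clog 2 n}

/-! ### In-place machines -/

/-- A deterministic Turing machine with a single bounded binary read-write tape and a read-only
oracle output bit. The transition function maps the state, the scanned cell and the oracle output
bit to the next state, the bit written and the head move; `none` means that the machine halts.
In a state with `isQuery` the oracle is consulted. -/
structure InPlaceTM where
  Q : Type
  finite : Finite Q
  start : Q
  isQuery : Q → Bool
  δ : Q → Cell → Bool → Option (Q × Bool × Move)

/-- The number with binary expansion `l`, least significant bit first. -/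
def binValue (l : List Bool) : ℕ := Nat.ofDigits 2 (l.map Bool.toNat)

/-- The query on a tape of length `N`: the last `2⌈log N⌉` bits of the tape are two numbers `a`,
`b`, and the query is the contents of the tape from the `a`-th to the `b`-th cell (inclusive,
cells being counted from `0`; the empty word if `b < a`). -/
def queryWord (t : List Bool) : List Bool :=
  let l := Nat.clog 2 t.length
  let spec := t.drop (t.length - 2 * l)
  (t.take (binValue (spec.drop l) + 1)).drop (binValue (spec.take l))

namespace InPlaceTM

/-- A machine without oracle access. -/
def QueryFree (M : InPlaceTM) : Prop := ∀ q, M.isQuery q = false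

structure Cfg (M : InPlaceTM) where
  state : M.Q
  tape : List Bool
  head : ℕ
  answer : Bool

def init (M : InPlaceTM) (t : List Bool) : M.Cfg where
  state := M.start
  tape := t
  head := 0
  answer := false

/-- In a query state, put the oracle's answer to the current query on the oracle output bit. -/
def consult (M : InPlaceTM) (O : Oracle) (c : M.Cfg) : M.Cfg :=
  if M.isQuery c.state then { c with answer := O (queryWord c.tape) } else c

def step (M : InPlaceTM) (O : Oracle) (c₀ : M.Cfg) : Option M.Cfg :=
  let c := M.consult O c₀
  (M.δ c.state (readTape c.tape c.head) c.answer).map fun a =>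
    { state := a.1
      tape := writeTape c.tape a.2.1 c.head
      head := moveBounded c.tape.length a.2.2 c.head
      answer := c.answer }

/-- With oracle `O`, the machine started on the tape `x ∘ 0^{max(0, m(n)-n)} ∘ 0^{s(n)}`, `n = |x|`,
halts with the tape `f(x) ∘ 1^{max(0, n-m(n))} ∘ 1^{s(n)}`. -/
def Computes (M : InPlaceTM) (O : Oracle) (s : ℕ → ℕ) (f : FunFamily) : Prop :=
  ∀ x : List Bool, ∃ c,
    StateTransition.Reaches (M.step O)
      (M.init (x ++ List.replicate (f.m x.length - x.length) false
        ++ List.replicate (s x.length) false)) c ∧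
    M.step O c = none ∧
    c.tape = f.toFun x ++ List.replicate (x.length - f.m x.length) true
      ++ List.replicate (s x.length) true

end InPlaceTM

/-- `inplaceFSPACE^O[s]`. -/
def inplaceFSPACERel (O : Oracle) (s : ℕ → ℕ) : Set FunFamily :=
  {f | ∃ M : InPlaceTM, M.Computes O s f}

/-- `inplaceFSPACE[s]`: machines that never query an oracle (so the oracle supplied is
irrelevant). -/
def inplaceFSPACE (s : ℕ → ℕ) : Set FunFamily :=
  {f | ∃ M : InPlaceTM, M.QueryFree ∧ M.Computes (fun _ => false) s f}

/-- `inplaceFL^O`, the union over `k` of `inplaceFSPACE^O[k log n]`. -/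
def inplaceFLRel (O : Oracle) : Set FunFamily :=
  {f | ∃ k : ℕ, f ∈ inplaceFSPACERel O fun n => k * Nat.clog 2 n}

/-- `inplaceFL`, the union over `k` of `inplaceFSPACE[k log n]`. -/
def inplaceFL : Set FunFamily := {f | ∃ k : ℕ, f ∈ inplaceFSPACE fun n => k * Nat.clog 2 n}

/-! ### The permutation -/

/-- `0^n`. -/
def zeros (n : ℕ) : List Bool := List.replicate n false

/-- `L ⊆ {0}*`. -/
def IsUnary (L : Set (List Bool)) : Prop := ∀ x ∈ L, ∃ n, x = zeros n

/-- `f` is the function that flips the last bit of `0^{n-1} b` exactly if `0^n ∈ L` (here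
`n = m + 1`), and fixes all words that are not of the form `0^{n-1} b`. -/
def FlipsLastBitBy (f : List Bool → List Bool) (L : Set (List Bool)) : Prop :=
  (∀ x, (¬ ∃ m b, x = zeros m ++ [b]) → f x = x) ∧
  (∀ m b, zeros (m + 1) ∉ L → f (zeros m ++ [b]) = zeros m ++ [b]) ∧
  (∀ m b, zeros (m + 1) ∈ L → f (zeros m ++ [b]) = zeros m ++ [!b])

end InPlace

/-!
The permutation exchanges `0^{n-1} 0` and `0^{n-1} 1` if `n` belongs to a set of numbers, and the
language consists of the `0^n` for these `n`. A machine for the permutation may save the last bit in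
its state and then use all `n` cells, so it suffices that membership of `n` can be decided on a tape
that consists of `n` zero cells, but not by a transducer in space `o(n)`. Such a set is obtained by
diagonalization; as the last bit of `f (0^n)` is that of the indicator function of the language, the
same argument takes care of the permutation and of the language.

The decision procedure is written once, in a small structured language (`Prog`, with the semantics
`Exec`), and translated both into an in-place machine (`Exec.inPlace_halts`) and into a transducer
with `n` work cells (`Exec.transducer_computes`). A query is possible only if the tape specifies it
in the sense of in-place machines, so both translations ask the same queries.

The tape of `n` cells is divided into `V = ⌊(n - 1) / 64⌋` blocks of 18 cells, which carry five
virtual tapes with `V` cells and a binary clock with `V` digits, `4 V` cells to the left of the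
blocks for the pending query, and the rest for its specification (`exec_format`, `exec_micro`,
`exec_clocked`). The choice of 64 has the effect that `⌈log₂ n⌉` is 6 plus the number of binary
digits of `V` (`clog_eq_of_blocks`), which the machine finds out by counting (`run_count`). It reads
the number `V` itself as the program of a transducer `M`, simulates `M` on the input `0^{64 V + 1}`
until the clock, after `2 ^ V` ticks, overflows, and rejects if it has not found out by then that
`M` halts with a last output bit other than 1 (`diagOp`, `accepts_of_trajectory`).

If `M` works in space `o(n)`, then for large `V` its running time on `0^{64 V + 1}` is at most its
number of configurations, which is small compared with `2 ^ V` (`card_trajectory_le`,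
`exists_clock_bound`), even after multiplication by the time `8 V + 80` that the simulation of a
step takes. As every program is an initial segment of the binary expansions of arbitrarily large
numbers (`exists_number`), `M` is wrong on some `0^{64 V + 1}` (`not_computes_of_sublinear`). All
this works relative to any oracle. The version without oracle is the one for the oracle that is
constantly `false`, whose answers a machine need not ask for (`FSPACERel_false_subset`,
`inplaceFLRel_false_subset`).
-/

namespace InPlace

/-! ### A structured language for a bounded binary tape -/

section

/-- The memory on which structured programs act: the cells of the tape (cell `i` lies under head
position `i + 1`; the values of `tp` beyond the end of the tape are never read), the position of the
head, and the word collected for the next oracle query. -/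
structure Env where
  tp : ℕ → Bool
  hd : ℕ
  y : List Bool

/-- What the head at position `h` of a tape with `N` cells sees. -/
def look (N : ℕ) (tp : ℕ → Bool) : ℕ → Cell
  | 0 => .leftEnd
  | i + 1 => if i < N then .bit (tp i) else .rightEnd

/-- Write a bit, or nothing, at head position `h`; end markers are not overwritten. -/
def put (N : ℕ) (tp : ℕ → Bool) : Option Bool → ℕ → (ℕ → Bool)
  | some b, i + 1 => if i < N then Function.update tp i b else tp
  | _, _ => tp

/-- The contents of a tape with `N` cells. -/
def word (N : ℕ) (tp : ℕ → Bool) : List Bool := (List.range N).map tp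

/-- Structured programs with a store of type `S`. Only `act` touches the tape; the other
constructors depend on the store alone. -/
inductive Prog (S : Type) where
  /-- one step of the head: new store, bit written (if any), move -/
  | act (f : S → Cell → S × Option Bool × Move)
  /-- append a bit to the pending query -/
  | app (f : S → Bool)
  /-- ask the pending query, and start a new one -/
  | ask (f : S → Bool → S)
  | seq (p q : Prog S)
  | ite (c : S → Bool) (p q : Prog S)
  | loop (c : S → Bool) (p : Prog S)

variable {S : Type}

/-- Big-step semantics on a tape with `N` cells and oracle `O`. A query is only allowed if the
tape, read as an in-place machine would read it, specifies the pending query; so a run of a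
program can be carried out both by an in-place machine and by a transducer. -/
inductive Exec (N : ℕ) (O : Oracle) : Prog S → S → Env → S → Env → Prop where
  | act (f s e) : Exec N O (.act f) s e (f s (look N e.tp e.hd)).1
      ⟨put N e.tp (f s (look N e.tp e.hd)).2.1 e.hd,
        moveBounded N (f s (look N e.tp e.hd)).2.2 e.hd, e.y⟩
  | app (f s e) (h : e.y.length < N) : Exec N O (.app f) s e s ⟨e.tp, e.hd, e.y ++ [f s]⟩
  | ask (f s e) (h : queryWord (word N e.tp) = e.y) :
      Exec N O (.ask f) s e (f s (O e.y)) ⟨e.tp, e.hd, []⟩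
  | seq {p q s e s₁ e₁ s₂ e₂} (h₁ : Exec N O p s e s₁ e₁) (h₂ : Exec N O q s₁ e₁ s₂ e₂) :
      Exec N O (.seq p q) s e s₂ e₂
  | iteT {c p q s e s₁ e₁} (hc : c s = true) (h : Exec N O p s e s₁ e₁) :
      Exec N O (.ite c p q) s e s₁ e₁
  | iteF {c p q s e s₁ e₁} (hc : c s = false) (h : Exec N O q s e s₁ e₁) :
      Exec N O (.ite c p q) s e s₁ e₁
  | loopT {c p s e s₁ e₁ s₂ e₂} (hc : c s = true) (h₁ : Exec N O p s e s₁ e₁)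
      (h₂ : Exec N O (.loop c p) s₁ e₁ s₂ e₂) : Exec N O (.loop c p) s e s₂ e₂
  | loopF {c p s e} (hc : c s = false) : Exec N O (.loop c p) s e s e

namespace Prog

/-- All stacks of pending programs that occur while `p` runs with the stack `k` below it. There are
finitely many of them, so they can serve as control states. -/
def conts : Prog S → List (Prog S) → List (List (Prog S))
  | act f, k => [act f :: k]
  | app f, k => [app f :: k]
  | ask f, k => [ask f :: k]
  | seq p q, k => (seq p q :: k) :: (conts p (q :: k) ++ conts q k)
  | ite c p q, k => (ite c p q :: k) :: (conts p k ++ conts q k)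
  | loop c p, k => (loop c p :: k) :: conts p (loop c p :: k)

theorem cons_mem_conts (p : Prog S) (k : List (Prog S)) : p :: k ∈ p.conts k := by
  cases p <;> simp [conts]

/-- The stack after one step. -/
def nextStack : List (Prog S) → S → List (Prog S)
  | [], _ => []
  | act _ :: k, _ => k
  | app _ :: k, _ => k
  | ask _ :: k, _ => k
  | seq p q :: k, _ => p :: q :: k
  | ite c p q :: k, s => if c s then p :: k else q :: k
  | loop c p :: k, s => if c s then p :: loop c p :: k else k

/-- The stacks that occur while the program `p` runs. -/
def Stack (p : Prog S) : Type := {x : List (Prog S) // x ∈ [] :: p.conts []}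

instance (p : Prog S) : Finite (Stack p) := (List.finite_toSet ([] :: p.conts [])).to_subtype

open Classical in
/-- View a list of programs as a stack of `p`; lists that never occur become the empty stack. -/
noncomputable def toStack (p : Prog S) (x : List (Prog S)) : Stack p :=
  if h : x ∈ [] :: p.conts [] then ⟨x, h⟩ else ⟨[], List.mem_cons_self⟩

theorem toStack_val (p : Prog S) {x : List (Prog S)} (h : x ∈ [] :: p.conts []) :
    (toStack p x).1 = x := by simp [toStack, h]

/-- The effect of one step on the store, the bit written, and the move. All steps other than `act`
and `ask` leave the store and the tape alone. -/
def effect : List (Prog S) → S → Cell → Bool → S × Option Bool × Move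
  | act f :: _, s, c, _ => f s c
  | ask f :: _, s, _, a => (f s a, none, .stay)
  | _, s, _, _ => (s, none, .stay)

/-- Does the stack start with a query? -/
def asks : List (Prog S) → Bool
  | ask _ :: _ => true
  | _ => false

/-- The bit appended to the pending query. -/
def appended : List (Prog S) → S → Option Bool
  | app f :: _, s => some (f s)
  | _, _ => none

end Prog

/-- The bit in a cell; an arbitrary bit for an end marker. -/
def Cell.val : Cell → Bool
  | .bit b => b
  | _ => false

open Prog

/-! ### Programs as in-place machines -/

section InPlace

variable {N : ℕ} {O : Oracle}

/-- The in-place machine that runs a program. Unfolding steps rewrite the scanned bit. -/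
noncomputable def Prog.toInPlace [Finite S] (p : Prog S) (s₀ : S) : InPlaceTM where
  Q := Stack p × S
  finite := inferInstance
  start := (toStack p [p], s₀)
  isQuery q := asks q.1.1
  δ q c a := if q.1.1 = [] then none else
    some ((toStack p (nextStack q.1.1 q.2), (effect q.1.1 q.2 c a).1),
      (effect q.1.1 q.2 c a).2.1.getD c.val, (effect q.1.1 q.2 c a).2.2)

theorem length_word (N : ℕ) (tp : ℕ → Bool) : (word N tp).length = N := by simp [word]

theorem readTape_word (N : ℕ) (tp : ℕ → Bool) (h : ℕ) : readTape (word N tp) h = look N tp h := by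
  cases h with
  | zero => rfl
  | succ i =>
    by_cases hi : i < N
    · simp [readTape, look, word, hi]
    · simp [readTape, look, word, hi]

theorem writeTape_word (N : ℕ) (tp : ℕ → Bool) (w : Option Bool) (h : ℕ) :
    writeTape (word N tp) (w.getD (look N tp h).val) h = word N (put N tp w h) := by
  cases h with
  | zero => cases w <;> rfl
  | succ i =>
    cases w with
    | none =>
      by_cases hi : i < N
      · refine List.ext_getElem (by simp [writeTape, put, word]) fun j hj hj' => ?_
        simp only [writeTape, put, word, look, hi, if_true, Option.getD, Cell.val,
          List.getElem_set, List.getElem_map, List.getElem_range]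
        split
        · subst_vars; rfl
        · rfl
      · simp [writeTape, put, look, hi, List.set_eq_of_length_le, length_word, Nat.le_of_not_lt hi]
    | some b =>
      by_cases hi : i < N
      · refine List.ext_getElem (by simp [writeTape, put, word]) fun j hj hj' => ?_
        simp only [writeTape, put, word, hi, if_true, Option.getD,
          List.getElem_set, List.getElem_map, List.getElem_range, Function.update_apply]
        simp only [eq_comm]
      · simp [writeTape, put, hi, List.set_eq_of_length_le, length_word, Nat.le_of_not_lt hi]

variable [Finite S]

/-- The configuration of the in-place machine of `p₀` with pending programs `k`. -/
noncomputable def inPlaceCfg (N : ℕ) (p₀ : Prog S) (s₀ : S) (k : List (Prog S)) (s : S) (e : Env)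
    (a : Bool) : (p₀.toInPlace s₀).Cfg :=
  ⟨(toStack p₀ k, s), word N e.tp, e.hd, a⟩

theorem inPlace_step (p₀ : Prog S) (s₀ : S) {x : List (Prog S)} (hx : x ∈ [] :: p₀.conts [])
    (hne : x ≠ []) (s : S) (e : Env) (a : Bool) :
    (p₀.toInPlace s₀).step O (inPlaceCfg N p₀ s₀ x s e a) =
      some (let a' := if asks x then O (queryWord (word N e.tp)) else a
        let r := effect x s (look N e.tp e.hd) a'
        inPlaceCfg N p₀ s₀ (nextStack x s) r.1
          ⟨put N e.tp r.2.1 e.hd, moveBounded N r.2.2 e.hd, e.y⟩ a') := by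
  have hv := toStack_val p₀ hx
  have hc : (p₀.toInPlace s₀).consult O (inPlaceCfg N p₀ s₀ x s e a) =
      inPlaceCfg N p₀ s₀ x s e (if asks x then O (queryWord (word N e.tp)) else a) := by
    simp only [InPlaceTM.consult, inPlaceCfg, toInPlace, hv]
    split <;> rfl
  simp only [InPlaceTM.step, hc]
  simp only [inPlaceCfg, readTape_word, toInPlace, hv, hne, if_false, Option.map_some,
    writeTape_word, length_word]

/-- The big-step semantics agrees with the in-place machine: the pending programs `k` below `p` are
left on the stack. -/
theorem Exec.reaches_inPlace (p₀ : Prog S) (s₀ : S) {p : Prog S} {s s' : S} {e e' : Env}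
    (h : Exec N O p s e s' e') (k : List (Prog S))
    (hp : ∀ x ∈ p.conts k, x ∈ [] :: p₀.conts []) (a : Bool) :
    ∃ a', StateTransition.Reaches ((p₀.toInPlace s₀).step O)
      (inPlaceCfg N p₀ s₀ (p :: k) s e a) (inPlaceCfg N p₀ s₀ k s' e' a') := by
  induction h generalizing k a with
  | act f s e =>
    refine ⟨a, .single ?_⟩
    rw [inPlace_step p₀ s₀ (hp _ (cons_mem_conts _ _)) (by simp)]; rfl
  | app f s e h =>
    refine ⟨a, .single ?_⟩
    rw [inPlace_step p₀ s₀ (hp _ (cons_mem_conts _ _)) (by simp)]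
    cases hd : e.hd <;> simp [effect, inPlaceCfg, nextStack, put, moveBounded, asks]
  | ask f s e h =>
    refine ⟨O e.y, .single ?_⟩
    rw [inPlace_step p₀ s₀ (hp _ (cons_mem_conts _ _)) (by simp)]
    simp [effect, inPlaceCfg, nextStack, put, moveBounded, asks, h]
  | @seq p q s e s₁ e₁ s₂ e₂ h₁ h₂ ih₁ ih₂ =>
    obtain ⟨a₁, r₁⟩ := ih₁ (q :: k) (fun x hx => hp x (by simp [conts, hx])) a
    obtain ⟨a₂, r₂⟩ := ih₂ k (fun x hx => hp x (by simp [conts, hx])) a₁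
    refine ⟨a₂, .head ?_ (r₁.trans r₂)⟩
    rw [inPlace_step p₀ s₀ (hp _ (cons_mem_conts _ _)) (by simp)]
    simp [effect, inPlaceCfg, nextStack, put, moveBounded, asks]
  | @iteT c p q s e s₁ e₁ hc h ih =>
    obtain ⟨a₁, r₁⟩ := ih k (fun x hx => hp x (by simp [conts, hx])) a
    refine ⟨a₁, .head ?_ r₁⟩
    rw [inPlace_step p₀ s₀ (hp _ (cons_mem_conts _ _)) (by simp)]
    simp [effect, inPlaceCfg, nextStack, put, moveBounded, asks, hc]
  | @iteF c p q s e s₁ e₁ hc h ih =>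
    obtain ⟨a₁, r₁⟩ := ih k (fun x hx => hp x (by simp [conts, hx])) a
    refine ⟨a₁, .head ?_ r₁⟩
    rw [inPlace_step p₀ s₀ (hp _ (cons_mem_conts _ _)) (by simp)]
    simp [effect, inPlaceCfg, nextStack, put, moveBounded, asks, hc]
  | @loopT c p s e s₁ e₁ s₂ e₂ hc h₁ h₂ ih₁ ih₂ =>
    obtain ⟨a₁, r₁⟩ := ih₁ (.loop c p :: k) (fun x hx => hp x (by simp [conts, hx])) a
    obtain ⟨a₂, r₂⟩ := ih₂ k hp a₁
    refine ⟨a₂, .head ?_ (r₁.trans r₂)⟩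
    rw [inPlace_step p₀ s₀ (hp _ (cons_mem_conts _ _)) (by simp)]
    simp [effect, inPlaceCfg, nextStack, put, moveBounded, asks, hc]
  | @loopF c p s e hc =>
    refine ⟨a, .single ?_⟩
    rw [inPlace_step p₀ s₀ (hp _ (cons_mem_conts _ _)) (by simp)]
    simp [effect, inPlaceCfg, nextStack, put, moveBounded, asks, hc]

/-- A program run from start to end gives a halting computation of its in-place machine. -/
theorem Exec.inPlace_halts (p : Prog S) {s s' : S} {tp : ℕ → Bool} {e' : Env}
    (h : Exec N O p s ⟨tp, 0, []⟩ s' e') :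
    ∃ c, StateTransition.Reaches ((p.toInPlace s).step O) ((p.toInPlace s).init (word N tp)) c ∧
      (p.toInPlace s).step O c = none ∧ c.tape = word N e'.tp := by
  obtain ⟨a, r⟩ := h.reaches_inPlace p s [] (fun x hx => List.mem_cons_of_mem _ hx) false
  refine ⟨_, r, ?_, rfl⟩
  have hv : (toStack p []).1 = [] := toStack_val p List.mem_cons_self
  have : ∀ c : (p.toInPlace s).Cfg, c.state.1.1 = [] → (p.toInPlace s).step O c = none := by
    intro c hc
    simp only [InPlaceTM.step, InPlaceTM.consult, toInPlace, hc, asks]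
    simp [hc]
  exact this _ hv

end InPlace

end

/-! ### Programs as transducers -/

section

open Prog

/-- `a` reaches `b` along configurations that satisfy `I` (the last one excepted). -/
def ReachesVia {σ : Type} (f : σ → Option σ) (I : σ → Prop) : σ → σ → Prop :=
  Relation.ReflTransGen fun a b => b ∈ f a ∧ I a

theorem ReachesVia.reaches {σ : Type} {f : σ → Option σ} {I : σ → Prop} {a b : σ}
    (h : ReachesVia f I a b) : StateTransition.Reaches f a b :=
  Relation.ReflTransGen.mono (fun _ _ h => h.1) _ _ h

/-- An invariant that holds along a halting run holds for everything that is reachable. -/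
theorem ReachesVia.forall_reaches {σ : Type} {f : σ → Option σ} {I : σ → Prop} {a b : σ}
    (h : ReachesVia f I a b) (hb : I b) (hh : f b = none) :
    ∀ c, StateTransition.Reaches f a c → I c := by
  induction h using Relation.ReflTransGen.head_induction_on with
  | refl =>
    intro c hc
    rcases Relation.ReflTransGen.cases_head hc with rfl | ⟨d, hd, -⟩
    · exact hb
    · simp [hh] at hd
  | head h _ ih =>
    intro c hc
    rcases Relation.ReflTransGen.cases_head hc with rfl | ⟨d, hd, hdc⟩
    · exact h.2
    · exact ih c (Option.mem_unique hd h.1 ▸ hdc)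

/-- The control states of the transducer of a program: checking that the input is `0^n`, going
back, running the program (with a flag for a pending move of the work head), and the end. -/
inductive TState (X : Type) where
  | check
  | rewind
  | run (x : X) (pending : Bool)
  | done

instance {X : Type} [Finite X] : Finite (TState X) :=
  Finite.of_surjective
    (fun z : Fin 3 ⊕ X × Bool => match z with
      | .inl 0 => .check
      | .inl 1 => .rewind
      | .inl 2 => .done
      | .inr (x, b) => .run x b)
    (by
      intro z
      cases z with
      | check => exact ⟨.inl 0, rfl⟩
      | rewind => exact ⟨.inl 1, rfl⟩
      | run x b => exact ⟨.inr (x, b), rfl⟩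
      | done => exact ⟨.inl 2, rfl⟩)

variable {S : Type} [Finite S] {N : ℕ} {O : Oracle}

/-- The virtual cell: the end markers are those of the input tape, the bits those of the work
tape. -/
def joinCell : Cell → Cell → Cell
  | .bit _, w => w
  | c, _ => c

/-- What is written on the work tape to carry out the write `w` of a program. -/
def joinWrite : Cell → Cell → Option Bool → Bool
  | .bit _, c, w => w.getD c.val
  | _, c, _ => c.val

/-- The immediate move of the work head. At the right end of the input the work head is already on
cell `n`, where it belongs after a move of the program to the left, so it stays; a move to the right
is left pending. -/
def joinMove : Cell → Move → Move
  | .rightEnd, _ => .stay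
  | _, .left => .left
  | _, _ => .stay

/-- The delayed move of the work head to the right, which is omitted if the input head has reached
the right end marker. -/
def pendingMove : Cell → Move
  | .rightEnd => .stay
  | _ => .right

def Move.isRight : Move → Bool
  | .right => true
  | _ => false

/-- The transducer that rejects inputs other than `0^n`, and on `0^n` runs a program on the first
`n` cells of the work tape and outputs `out` of the final store. The input head follows the head
of the program, to detect the right end of the tape; to keep the work head within `n` cells, its
moves to the right are delayed by a step, until the input head has seen whether there is
another cell. -/
noncomputable def Prog.toTransducer (p : Prog S) (s₀ : S) (out : S → Bool) : Transducer where
  Q := TState (Stack p × S)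
  finite := inferInstance
  start := .check
  isQuery q := match q with
    | .run x false => asks x.1.1
    | _ => false
  δ q c w a := match q with
    | .check => match c with
      | .bit true => some ⟨.done, w.val, .stay, .stay, none, some false⟩
      | .rightEnd => some ⟨.rewind, w.val, .left, .stay, none, none⟩
      | _ => some ⟨.check, w.val, .right, .stay, none, none⟩
    | .rewind => match c with
      | .leftEnd => some ⟨.run (toStack p [p], s₀) false, w.val, .stay, .stay, none, none⟩
      | _ => some ⟨.rewind, w.val, .left, .stay, none, none⟩
    | .run x true => some ⟨.run x false, w.val, .stay, pendingMove c, none, none⟩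
    | .run x false =>
      if x.1.1 = [] then some ⟨.done, w.val, .stay, .stay, none, some (out x.2)⟩ else
        let r := effect x.1.1 x.2 (joinCell c w) a
        some ⟨.run (toStack p (nextStack x.1.1 x.2), r.1) r.2.2.isRight,
          joinWrite c w r.2.1, r.2.2, joinMove c r.2.2, appended x.1.1 x.2, none⟩
    | .done => none

/-- The space bound of a configuration. -/
def Within (N : ℕ) {M : Transducer} (c : M.Cfg) : Prop :=
  c.workHead ≤ N ∧ c.oracleTape.length ≤ N

variable (p₀ : Prog S) (s₀ : S) (out : S → Bool)

/-- The configuration of the transducer of `p₀` with pending programs `k`. The work head follows the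
head of the program, but stops at the last cell when that head is on the right end marker. -/
noncomputable def transCfg (N : ℕ) (k : List (Prog S)) (s : S) (e : Env) (a : Bool) :
    (p₀.toTransducer s₀ out).Cfg :=
  ⟨.run (toStack p₀ k, s) false, e.hd, e.tp, min e.hd N, e.y, a, []⟩

theorem readTape_zeros (N h : ℕ) : readTape (zeros N) h = look N (fun _ => false) h := by
  cases h with
  | zero => rfl
  | succ i =>
    by_cases hi : i < N
    · simp [readTape, look, zeros, hi]
    · simp [readTape, look, zeros, hi]

theorem writeWork_val (w : ℕ → Bool) (h : ℕ) : writeWork w (readWork w h).val h = w := by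
  cases h <;> simp [writeWork, readWork, Cell.val]

theorem joinCell_look (tp : ℕ → Bool) (h : ℕ) :
    joinCell (look N (fun _ => false) h) (readWork tp (min h N)) = look N tp h := by
  cases h with
  | zero => rfl
  | succ i =>
    by_cases hi : i < N
    · simp [look, hi, joinCell, readWork]
    · simp [look, hi, joinCell]

theorem joinWrite_look (tp : ℕ → Bool) (w : Option Bool) (h : ℕ) :
    writeWork tp (joinWrite (look N (fun _ => false) h) (readWork tp (min h N)) w) (min h N) =
      put N tp w h := by
  cases h with
  | zero => cases w <;> simp [put, writeWork]
  | succ i =>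
    by_cases hi : i < N
    · cases w <;> simp [look, hi, joinWrite, readWork, writeWork, put, Cell.val]
    · have : joinWrite (look N (fun _ => false) (i + 1)) (readWork tp (min (i + 1) N)) w =
          (readWork tp (min (i + 1) N)).val := by simp [look, hi, joinWrite]
      rw [this, writeWork_val]
      cases w <;> simp [put, hi]

/-- The transducer carries out one step of a program; a move to the right takes it two steps. -/
theorem trans_step {x : List (Prog S)} (hx : x ∈ [] :: p₀.conts []) (hne : x ≠ []) (s : S)
    (e : Env) (a : Bool) (he : e.hd ≤ N + 1) (hy : e.y.length ≤ N) {a' : Bool}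
    (ha' : a' = if asks x then O e.y else a) {r : S × Option Bool × Move}
    (hr : r = effect x s (look N e.tp e.hd) a') {y' : List Bool}
    (hy' : y' = (if asks x then [] else e.y) ++ (appended x s).toList) (hy'' : y'.length ≤ N) :
    ReachesVia ((p₀.toTransducer s₀ out).step O (zeros N)) (Within N)
      (transCfg p₀ s₀ out N x s e a)
      (transCfg p₀ s₀ out N (nextStack x s) r.1
        ⟨put N e.tp r.2.1 e.hd, moveBounded N r.2.2 e.hd, y'⟩ a') := by
  have hv := toStack_val p₀ hx
  have hc : (p₀.toTransducer s₀ out).consult O (transCfg p₀ s₀ out N x s e a) =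
      transCfg p₀ s₀ out N x s ⟨e.tp, e.hd, if asks x then [] else e.y⟩ a' := by
    simp only [Transducer.consult, transCfg, toTransducer, hv, ha']
    split <;> rfl
  have h1 : (p₀.toTransducer s₀ out).step O (zeros N) (transCfg p₀ s₀ out N x s e a) =
      some ⟨.run (toStack p₀ (nextStack x s), r.1) r.2.2.isRight, moveBounded N r.2.2 e.hd,
        put N e.tp r.2.1 e.hd,
        moveUnbounded (joinMove (look N (fun _ => false) e.hd) r.2.2) (min e.hd N),
        y', a', []⟩ := by
    simp only [Transducer.step, hc]
    simp only [transCfg, toTransducer, hv, hne, if_false, Option.map_some, readTape_zeros,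
      joinCell_look]
    rw [joinWrite_look]
    simp [hr, hy', zeros]
  have hW : Within N (transCfg p₀ s₀ out N x s e a) := ⟨by simp [transCfg], hy⟩
  refine .head ⟨h1, hW⟩ ?_
  generalize hm : r.2.2 = m
  cases m with
  | right =>
    have hj : joinMove (look N (fun _ => false) e.hd) .right = .stay := by
      unfold joinMove; split <;> simp_all
    refine .single ⟨Option.mem_def.2 ?_, by simp [hj, moveUnbounded], hy''⟩
    have hp : moveUnbounded (pendingMove (look N (fun _ => false) (min (e.hd + 1) (N + 1))))
        (min e.hd N) = min (min (e.hd + 1) (N + 1)) N := by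
      by_cases hN : e.hd < N
      · have h1 : min (e.hd + 1) (N + 1) = e.hd + 1 := by omega
        simp only [h1, look, hN, if_true, pendingMove, moveUnbounded]
        omega
      · have h1 : min (e.hd + 1) (N + 1) = N + 1 := by omega
        simp only [h1, look, lt_irrefl, if_false, pendingMove, moveUnbounded]
        omega
    simp only [transCfg, moveBounded]
    rw [← hp]
    simp only [hj, Move.isRight, Transducer.step, Transducer.consult, toTransducer,
      moveBounded, readTape_zeros]
    simp only [Bool.false_eq_true, if_false, Option.map_some, writeWork_val, Option.toList,
      List.append_nil, zeros, List.length_replicate]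
    rfl
  | stay =>
    have hj : joinMove (look N (fun _ => false) e.hd) .stay = .stay := by
      unfold joinMove; split <;> simp_all
    simp only [hj, Move.isRight, transCfg, moveUnbounded, moveBounded]
    exact .refl
  | left =>
    have hj : moveUnbounded (joinMove (look N (fun _ => false) e.hd) .left) (min e.hd N) =
        min (e.hd - 1) N := by
      rcases h : e.hd with _ | i
      · simp [look, joinMove, moveUnbounded]
      · by_cases hi : i < N
        · simp only [look, hi, if_true, joinMove, moveUnbounded]; omega
        · simp only [look, hi, if_false, joinMove, moveUnbounded]; omega
    simp only [hj, Move.isRight, transCfg, moveBounded]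
    exact .refl

/-- The steps that only change the stack of pending programs. -/
theorem trans_unfold {q : Prog S} {k k' : List (Prog S)} (s : S) (e : Env) (a : Bool)
    (hq : q :: k ∈ [] :: p₀.conts []) (he : e.hd ≤ N + 1) (hy : e.y.length ≤ N)
    (h₁ : asks (q :: k) = false) (h₂ : appended (q :: k) s = none)
    (h₃ : ∀ c a, effect (q :: k) s c a = (s, none, .stay)) (hk : nextStack (q :: k) s = k') :
    ReachesVia ((p₀.toTransducer s₀ out).step O (zeros N)) (Within N)
      (transCfg p₀ s₀ out N (q :: k) s e a) (transCfg p₀ s₀ out N k' s e a) := by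
  have := trans_step (O := O) p₀ s₀ out hq (by simp) s e a he hy (a' := a) (by simp [h₁])
    (r := (s, none, .stay)) (by rw [h₃]) (y' := e.y) (by simp [h₁, h₂]) hy
  rw [hk] at this
  exact this

omit [Finite S] in
/-- Runs keep the head between the end markers and the pending query within the length of the
tape. -/
theorem Exec.bounds {p : Prog S} {s s' : S} {e e' : Env} (h : Exec N O p s e s' e')
    (he : e.hd ≤ N + 1) (hy : e.y.length ≤ N) : e'.hd ≤ N + 1 ∧ e'.y.length ≤ N := by
  induction h with
  | act f s e =>
    refine ⟨?_, hy⟩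
    dsimp only
    generalize (f s (look N e.tp e.hd)).2.2 = m
    cases m <;> simp only [moveBounded] <;> omega
  | app f s e h => exact ⟨he, by simpa using h⟩
  | ask f s e h => exact ⟨he, by simp⟩
  | seq _ _ ih₁ ih₂ => exact ih₂ (ih₁ he hy).1 (ih₁ he hy).2
  | iteT _ _ ih => exact ih he hy
  | iteF _ _ ih => exact ih he hy
  | loopT _ _ _ ih₁ ih₂ => exact ih₂ (ih₁ he hy).1 (ih₁ he hy).2
  | loopF _ => exact ⟨he, hy⟩

/-- The big-step semantics agrees with the transducer, within the space bound. -/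
theorem Exec.reachesVia {p : Prog S} {s s' : S} {e e' : Env}
    (h : Exec N O p s e s' e') (k : List (Prog S))
    (hp : ∀ x ∈ p.conts k, x ∈ [] :: p₀.conts []) (a : Bool)
    (he : e.hd ≤ N + 1) (hy : e.y.length ≤ N) :
    ∃ a', ReachesVia ((p₀.toTransducer s₀ out).step O (zeros N)) (Within N)
      (transCfg p₀ s₀ out N (p :: k) s e a) (transCfg p₀ s₀ out N k s' e' a') := by
  induction h generalizing k a with
  | act f s e =>
    exact ⟨a, trans_step p₀ s₀ out (hp _ (cons_mem_conts _ _)) (by simp) s e a he hy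
      (by simp [asks])
      (by simp [effect]) (by simp [asks, appended]) hy⟩
  | app f s e h =>
    exact ⟨a, trans_step p₀ s₀ out (hp _ (cons_mem_conts _ k)) (by simp) s e a he hy
      (a' := a) (by simp [asks]) (r := (s, none, .stay)) (by simp [effect]) (y' := e.y ++ [f s])
      (by simp [asks, appended]) (by simpa using h)⟩
  | ask f s e h =>
    exact ⟨O e.y, trans_step p₀ s₀ out (hp _ (cons_mem_conts _ k)) (by simp) s e a he hy
      (by simp [asks]) (r := (f s (O e.y), none, .stay)) (by simp [effect]) (y' := [])
      (by simp [asks, appended]) (by simp)⟩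
  | @seq p q s e s₁ e₁ s₂ e₂ h₁ h₂ ih₁ ih₂ =>
    obtain ⟨a₁, r₁⟩ := ih₁ (q :: k) (fun x hx => hp x (by simp [conts, hx])) a he hy
    obtain ⟨a₂, r₂⟩ := ih₂ k (fun x hx => hp x (by simp [conts, hx])) a₁ (h₁.bounds he hy).1
      (h₁.bounds he hy).2
    exact ⟨a₂, (trans_unfold p₀ s₀ out s e a (hp _ (cons_mem_conts _ _)) he hy rfl rfl
      (fun _ _ => rfl) rfl).trans (r₁.trans r₂)⟩
  | @iteT c p q s e s₁ e₁ hc h ih =>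
    obtain ⟨a₁, r₁⟩ := ih k (fun x hx => hp x (by simp [conts, hx])) a he hy
    exact ⟨a₁, (trans_unfold p₀ s₀ out s e a (hp _ (cons_mem_conts _ _)) he hy rfl rfl
      (fun _ _ => rfl) (by simp [nextStack, hc])).trans r₁⟩
  | @iteF c p q s e s₁ e₁ hc h ih =>
    obtain ⟨a₁, r₁⟩ := ih k (fun x hx => hp x (by simp [conts, hx])) a he hy
    exact ⟨a₁, (trans_unfold p₀ s₀ out s e a (hp _ (cons_mem_conts _ _)) he hy rfl rfl
      (fun _ _ => rfl) (by simp [nextStack, hc])).trans r₁⟩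
  | @loopT c p s e s₁ e₁ s₂ e₂ hc h₁ h₂ ih₁ ih₂ =>
    obtain ⟨a₁, r₁⟩ := ih₁ (.loop c p :: k) (fun x hx => hp x (by simp [conts, hx])) a he hy
    obtain ⟨a₂, r₂⟩ := ih₂ k hp a₁ (h₁.bounds he hy).1 (h₁.bounds he hy).2
    exact ⟨a₂, (trans_unfold p₀ s₀ out s e a (hp _ (cons_mem_conts _ _)) he hy rfl rfl
      (fun _ _ => rfl) (by simp [nextStack, hc])).trans (r₁.trans r₂)⟩
  | @loopF c p s e hc =>
    exact ⟨a, trans_unfold p₀ s₀ out s e a (hp _ (cons_mem_conts _ _)) he hy rfl rfl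
      (fun _ _ => rfl) (by simp [nextStack, hc])⟩

/-- The configurations of the transducer before the program runs, and at the end. -/
def phaseCfg (q : TState (Stack p₀ × S)) (h : ℕ) (z : List Bool) :
    (p₀.toTransducer s₀ out).Cfg :=
  ⟨q, h, fun _ => false, 0, [], false, z⟩

/-- The transducer reads zeros up to the first other symbol of the input. -/
theorem reaches_check {x : List Bool} {i : ℕ} (hi : i ≤ x.length)
    (hx : ∀ j < i, x[j]? = some false) :
    ReachesVia ((p₀.toTransducer s₀ out).step O x) (Within x.length)
      (p₀.toTransducer s₀ out).init (phaseCfg p₀ s₀ out .check (i + 1) []) := by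
  induction i with
  | zero =>
    refine .single ⟨Option.mem_def.2 ?_, Nat.zero_le _, Nat.zero_le _⟩
    simp [Transducer.step, Transducer.consult, toTransducer, readTape, Transducer.init,
      phaseCfg, moveBounded, writeWork, moveUnbounded]
  | succ i ih =>
    refine (ih (by omega) fun j hj => hx j (by omega)).tail
      ⟨Option.mem_def.2 ?_, Nat.zero_le _, Nat.zero_le _⟩
    simp [Transducer.step, Transducer.consult, toTransducer, readTape,
      phaseCfg, moveBounded, writeWork, moveUnbounded, hx i (by omega)]
    omega

/-- The input head returns to the left end marker, and the program is started. -/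
theorem reaches_rewind {h : ℕ} (hh : h ≤ N) :
    ReachesVia ((p₀.toTransducer s₀ out).step O (zeros N)) (Within N)
      (phaseCfg p₀ s₀ out .rewind h []) (transCfg p₀ s₀ out N [p₀] s₀
        ⟨fun _ => false, 0, []⟩ false) := by
  induction h with
  | zero =>
    refine .single ⟨Option.mem_def.2 ?_, Nat.zero_le _, Nat.zero_le _⟩
    simp [Transducer.step, Transducer.consult, toTransducer, readTape, transCfg,
      phaseCfg, moveBounded, writeWork, moveUnbounded]
  | succ h ih =>
    refine .head ⟨Option.mem_def.2 ?_, Nat.zero_le _, Nat.zero_le _⟩ (ih (by omega))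
    have : (zeros N)[h]? = some false := by
      simp [zeros, show h < N by omega]
    simp [Transducer.step, Transducer.consult, toTransducer, readTape,
      phaseCfg, moveBounded, writeWork, moveUnbounded, this]

/-- If a program run on `N` zero cells computes `acc N`, then its transducer decides in space `n`
the unary language given by `acc`. -/
theorem Exec.transducer_computes (p : Prog S) (s₀ : S) (out : S → Bool) (acc : ℕ → Bool)
    (hrun : ∀ N, ∃ s e, Exec N O p s₀ ⟨fun _ => false, 0, []⟩ s e ∧ out s = acc N)
    {f : List Bool → List Bool} (hf₁ : ∀ n, f (zeros n) = [acc n])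
    (hf₀ : ∀ x, (∀ n, x ≠ zeros n) → f x = [false]) :
    (p.toTransducer s₀ out).Computes O (fun n => n) f := by
  intro x
  suffices ∃ c, ReachesVia ((p.toTransducer s₀ out).step O x) (Within x.length)
      (p.toTransducer s₀ out).init c ∧ Within x.length c ∧
      (p.toTransducer s₀ out).step O x c = none ∧ c.output = f x by
    obtain ⟨c, h, hw, hc, ho⟩ := this
    exact ⟨h.forall_reaches hw hc, c, h.reaches, hc, ho⟩
  by_cases hx : ∃ n, x = zeros n
  · obtain ⟨n, rfl⟩ := hx
    have hl : (zeros n).length = n := by simp [zeros]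
    rw [hl]
    obtain ⟨s, e, hE, hs⟩ := hrun n
    obtain ⟨a, r⟩ := hE.reachesVia p s₀ out [] (fun x hx => List.mem_cons_of_mem _ hx) false
      (Nat.zero_le _) (Nat.zero_le _)
    have hb := hE.bounds (Nat.zero_le _) (Nat.zero_le _)
    have h1 := reaches_check (O := O) p s₀ out (x := zeros n) (i := n) hl.ge (fun j hj => by
      simp [zeros, hj])
    rw [hl] at h1
    have h2 := reaches_rewind (O := O) p s₀ out (le_refl n)
    have hv : (toStack p []).1 = [] := toStack_val p List.mem_cons_self
    refine ⟨⟨.done, e.hd, e.tp, min e.hd n, e.y, a, [acc n]⟩,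
      h1.trans (.head ⟨Option.mem_def.2 ?_, Nat.zero_le _, Nat.zero_le _⟩
        (h2.trans (r.tail ⟨Option.mem_def.2 ?_, ?_⟩))), ?_, ?_, ?_⟩
    · have : (zeros n)[n]? = none := by simp [zeros]
      simp [Transducer.step, Transducer.consult, toTransducer, readTape,
        phaseCfg, moveBounded, writeWork, moveUnbounded, this]
    · simp [Transducer.step, Transducer.consult, toTransducer, transCfg, hv, asks,
        moveBounded, writeWork_val, moveUnbounded, hs]
    · exact ⟨by simp [transCfg], hb.2⟩
    · exact ⟨by simp, hb.2⟩
    · simp [Transducer.step, Transducer.consult, toTransducer]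
    · rw [hf₁]
  · push Not at hx
    have hex : ∃ i : ℕ, x[i]? = some true := by
      by_contra! hc
      refine hx x.length (List.ext_getElem? (l₁ := x) fun i => ?_)
      by_cases hi : i < x.length
      · have := hc i
        simp [zeros, hi] at this ⊢
        exact this
      · simp [zeros, hi]
    classical
    have hi := Nat.find_spec hex
    have hmin : ∀ j < Nat.find hex, x[j]? = some false := by
      intro j hj
      have h1 := Nat.find_min hex hj
      have h2 : Nat.find hex < x.length := by
        by_contra h
        rw [List.getElem?_eq_none (Nat.le_of_not_lt h)] at hi
        cases hi
      have h3 : j < x.length := by omega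
      rw [List.getElem?_eq_getElem h3] at h1 ⊢
      simpa using h1
    have hl : Nat.find hex ≤ x.length := by
      by_contra h
      rw [List.getElem?_eq_none (Nat.le_of_not_ge h)] at hi
      cases hi
    refine ⟨phaseCfg p s₀ out .done (Nat.find hex + 1) [false],
      (reaches_check (O := O) p s₀ out hl hmin).tail
        ⟨Option.mem_def.2 ?_, Nat.zero_le _, Nat.zero_le _⟩,
      ⟨Nat.zero_le _, Nat.zero_le _⟩, ?_, ?_⟩
    · simp [Transducer.step, Transducer.consult, toTransducer, readTape,
        phaseCfg, moveBounded, writeWork, moveUnbounded, hi]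
    · simp [Transducer.step, Transducer.consult, toTransducer, phaseCfg]
    · rw [hf₀ x hx]; rfl

end

/-! ### Blocks of cells -/

section

open Prog

/-- The fields of a block of 18 cells: flags for the first and the last block, a bit of the clock,
and for each of five virtual tapes a two-bit symbol and a flag for the head. -/
inductive Fld where
  | first
  | last
  | clock
  | fst (j : Fin 5)
  | snd (j : Fin 5)
  | head (j : Fin 5)
  deriving DecidableEq

/-- The offset of a field in its block. -/
def Fld.idx : Fld → ℕ
  | first => 0
  | clock => 1
  | fst j => 2 + j
  | snd j => 7 + j
  | head j => 12 + j
  | last => 17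

/-- The field at an offset. -/
def fldAt (k : ℕ) : Fld :=
  if k = 0 then .first else if k = 1 then .clock else if k < 7 then .fst (Fin.ofNat 5 (k - 2))
  else if k < 12 then .snd (Fin.ofNat 5 (k - 7)) else if k < 17 then .head (Fin.ofNat 5 (k - 12))
  else .last

theorem fldAt_idx (F : Fld) : fldAt F.idx = F := by
  cases F <;> first | rfl | (rename_i j; revert j; decide)

theorem idx_fldAt : ∀ k < 18, (fldAt k).idx = k := by decide

theorem Fld.idx_lt (F : Fld) : F.idx < 18 := by
  cases F <;> simp only [idx] <;> omega

instance : Finite Fld := Finite.of_injective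
  (fun F => (⟨F.idx, F.idx_lt⟩ : Fin 18)) fun F F' h => by
  rw [← fldAt_idx F, ← fldAt_idx F', Fin.mk.inj_iff.1 h]

instance : Finite Move := Finite.of_injective
  (fun m => match m with | .left => (0 : Fin 3) | .stay => 1 | .right => 2) fun m m' h => by
    cases m <;> cases m' <;> simp_all

/-- The store of the low-level programs: a state `a` of the high-level machine that is being
simulated, a bit `saved` that survives the simulation, and auxiliary fields: a buffer for a block, a
flag, a direction, the number of a virtual tape. -/
structure Store (A : Type) where
  a : A
  saved : Bool
  buf : Fld → Bool
  fl : Bool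
  dir : Move
  cur : Fin 5

instance {A : Type} [Finite A] : Finite (Store A) :=
  Finite.of_injective (fun s => (s.a, s.saved, s.buf, s.fl, s.dir, s.cur)) fun s s' h => by
    cases s; cases s'; simp_all

/-- The store with cleared auxiliary fields. -/
def Store.mk' {A : Type} (a : A) (b : Bool) : Store A := ⟨a, b, fun _ => false, false, .stay, 0⟩

variable {A : Type} {N : ℕ} {O : Oracle}

/-- Change the store only. -/
def upd (g : Store A → Store A) : Prog (Store A) := .act fun s _ => (g s, none, .stay)

/-- Do nothing (in one step). -/
def skip : Prog (Store A) := upd id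

/-- Clear the auxiliary fields of the store. -/
def clear : Prog (Store A) := upd fun s => .mk' s.a s.saved

/-- Make a step. -/
def go (m : Move) : Prog (Store A) := .act fun s _ => (s, none, m)

/-- Make `k` steps. -/
def moves (m : Move) : ℕ → Prog (Store A)
  | 0 => skip
  | k + 1 => .seq (go m) (moves m k)

/-- Write a bit that depends on the store. -/
def write (g : Store A → Bool) : Prog (Store A) := .act fun s _ => (s, some (g s), .stay)

/-- Put the result of a test of the scanned cell into the flag. -/
def test (t : Cell → Bool) : Prog (Store A) := .act fun s c => ({ s with fl := t c }, none, .stay)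

/-- Move, writing `w` on the way, until a cell satisfies `tgt`; the head stays on that cell, which
is not overwritten. -/
def scan (tgt : Cell → Bool) (w : Option Bool) (m : Move) : Prog (Store A) :=
  .seq (upd fun s => { s with fl := false })
    (.loop (fun s => !s.fl) (.act fun s c =>
      if tgt c then ({ s with fl := true }, none, .stay) else ({ s with fl := false }, w, m)))

theorem exec_upd (g : Store A → Store A) (s : Store A) (e : Env) : Exec N O (upd g) s e (g s) e :=
  Exec.act _ s e

theorem exec_skip (s : Store A) (e : Env) : Exec N O skip s e s e := exec_upd _ s e

theorem exec_clear (s : Store A) (e : Env) : Exec N O clear s e (.mk' s.a s.saved) e :=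
  exec_upd _ s e

theorem exec_test (t : Cell → Bool) (s : Store A) (e : Env) :
    Exec N O (test t) s e { s with fl := t (look N e.tp e.hd) } e :=
  Exec.act _ s e

theorem exec_go (m : Move) (s : Store A) (e : Env) :
    Exec N O (go m) s e s ⟨e.tp, moveBounded N m e.hd, e.y⟩ :=
  Exec.act _ s e

theorem exec_write (g : Store A → Bool) (s : Store A) (tp : ℕ → Bool) {i : ℕ} (y : List Bool)
    (hi : i < N) :
    Exec N O (write g) s ⟨tp, i + 1, y⟩ s ⟨Function.update tp i (g s), i + 1, y⟩ := by
  have := Exec.act (N := N) (O := O) (fun (s : Store A) _ => (s, some (g s), .stay)) s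
    ⟨tp, i + 1, y⟩
  simp only [put, hi, if_true, moveBounded] at this
  exact this

theorem exec_moves_right (k : ℕ) (s : Store A) (tp : ℕ → Bool) (h : ℕ) (y : List Bool)
    (hh : h ≤ N + 1) :
    Exec N O (moves .right k) s ⟨tp, h, y⟩ s ⟨tp, min (h + k) (N + 1), y⟩ := by
  induction k generalizing h with
  | zero => rw [Nat.add_zero, Nat.min_eq_left hh]; exact exec_skip s ⟨tp, h, y⟩
  | succ k ih =>
    have := ih (min (h + 1) (N + 1)) (by omega)
    rw [show min (min (h + 1) (N + 1) + k) (N + 1) = min (h + (k + 1)) (N + 1) by omega] at this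
    exact .seq (exec_go .right s _) this

theorem exec_right {k : ℕ} (s : Store A) (tp : ℕ → Bool) {h h' : ℕ} (y : List Bool)
    (hk : h + k = h') (hh : h' ≤ N + 1) :
    Exec N O (moves .right k) s ⟨tp, h, y⟩ s ⟨tp, h', y⟩ := by
  have := exec_moves_right (N := N) (O := O) k s tp h y (by omega)
  rwa [show min (h + k) (N + 1) = h' by omega] at this

theorem exec_left {k : ℕ} (s : Store A) (tp : ℕ → Bool) {h h' : ℕ} (y : List Bool)
    (hk : h' = h - k) :
    Exec N O (moves .left k) s ⟨tp, h, y⟩ s ⟨tp, h', y⟩ := by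
  subst hk
  induction k generalizing h with
  | zero => exact exec_skip s _
  | succ k ih =>
    have := ih (h := h - 1)
    rw [show h - 1 - k = h - (k + 1) by omega] at this
    exact .seq (exec_go .left s _) this

/-- The tape after writing `w` on the cells under the head positions `a ≤ h < b`. -/
def fill (w : Option Bool) (tp : ℕ → Bool) (a b : ℕ) : ℕ → Bool :=
  fun x => if a ≤ x + 1 ∧ x + 1 < b then w.getD (tp x) else tp x

theorem fill_none (tp : ℕ → Bool) (a b : ℕ) : fill none tp a b = tp := by
  funext x; simp [fill]

theorem put_eq_fill (w : Option Bool) (tp : ℕ → Bool) {h : ℕ} (hh : h ≤ N) :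
    put N tp w h = fill w tp h (h + 1) := by
  funext x
  cases w with
  | none => simp [put, fill]
  | some b =>
    cases h with
    | zero => simp [put, fill]
    | succ i =>
      simp only [put, show i < N by omega, if_true, Function.update_apply, fill]
      by_cases hx : x = i
      · simp [hx]
      · rw [if_neg hx, if_neg (by omega)]

theorem fill_congr_look {tp tp' : ℕ → Bool} {h : ℕ} (H : ∀ x, x + 1 = h → tp x = tp' x) :
    look N tp h = look N tp' h := by
  cases h with
  | zero => rfl
  | succ i => simp [look, H i rfl]

theorem exec_scan_right {tgt : Cell → Bool} (w : Option Bool) (s : Store A) {tp tp' : ℕ → Bool}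
    {h h' : ℕ} (y : List Bool) (hh : h ≤ h') (hN : h' ≤ N + 1)
    (hgo : ∀ i, h ≤ i → i < h' → tgt (look N tp i) = false) (htgt : tgt (look N tp h') = true)
    (htp : tp' = fill w tp h h') :
    Exec N O (scan tgt w .right) s ⟨tp, h, y⟩ { s with fl := true } ⟨tp', h', y⟩ := by
  subst htp
  refine .seq (exec_upd _ _ _) ?_
  generalize hs : ({ s with fl := false } : Store A) = s₁
  have hfl : s₁.fl = false := by rw [← hs]
  have hs' : ({ s with fl := true } : Store A) = { s₁ with fl := true } := by rw [← hs]
  rw [hs']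
  clear hs hs'
  obtain ⟨d, rfl⟩ := Nat.exists_eq_add_of_le hh
  induction d generalizing h tp with
  | zero =>
    refine .loopT (by simp [hfl]) (Exec.act _ _ _) ?_
    rw [if_pos (by simpa using htgt)]
    have : fill w tp h (h + 0) = tp := by
      funext x; simp only [fill]; rw [if_neg (by omega)]
    rw [this]
    exact .loopF rfl
  | succ d ih =>
    refine .loopT (by simp [hfl]) (Exec.act _ _ _) ?_
    rw [if_neg (by simp [hgo h le_rfl (by omega)])]
    have hm : moveBounded N .right h = h + 1 := by simp [moveBounded]; omega
    have hs : ({ s₁ with fl := false } : Store A) = s₁ := by rw [← hfl]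
    dsimp only
    rw [hs, hm, put_eq_fill w tp (by omega : h ≤ N)]
    have h2 : fill w tp h (h + (d + 1)) = fill w (fill w tp h (h + 1)) (h + 1) (h + 1 + d) := by
      funext x
      simp only [fill]
      split_ifs <;> first | rfl | omega
    have hl : ∀ i, h < i → look N (fill w tp h (h + 1)) i = look N tp i := by
      intro i hi
      refine fill_congr_look fun x hx => ?_
      simp only [fill]; rw [if_neg (by omega)]
    have := ih (tp := fill w tp h (h + 1)) (h := h + 1) (by omega) (by omega)
      (fun i hi hi' => by rw [hl i (by omega)]; exact hgo i (by omega) (by omega))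
      (by rw [hl _ (by omega), show h + 1 + d = h + (d + 1) by omega]; exact htgt)
    rw [h2, show h + (d + 1) = h + 1 + d by omega]
    exact this

theorem exec_scan_left {tgt : Cell → Bool} (w : Option Bool) (s : Store A) {tp tp' : ℕ → Bool}
    {h h' : ℕ} (y : List Bool) (hh : h' ≤ h) (hN : h ≤ N)
    (hgo : ∀ i, h' < i → i ≤ h → tgt (look N tp i) = false) (htgt : tgt (look N tp h') = true)
    (htp : tp' = fill w tp (h' + 1) (h + 1)) :
    Exec N O (scan tgt w .left) s ⟨tp, h, y⟩ { s with fl := true } ⟨tp', h', y⟩ := by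
  subst htp
  refine .seq (exec_upd _ _ _) ?_
  generalize hs : ({ s with fl := false } : Store A) = s₁
  have hfl : s₁.fl = false := by rw [← hs]
  have hs' : ({ s with fl := true } : Store A) = { s₁ with fl := true } := by rw [← hs]
  rw [hs']
  clear hs hs'
  obtain ⟨d, rfl⟩ := Nat.exists_eq_add_of_le hh
  induction d generalizing tp with
  | zero =>
    refine .loopT (by simp [hfl]) (Exec.act _ _ _) ?_
    rw [if_pos (by simpa using htgt)]
    have : fill w tp (h' + 1) (h' + 0 + 1) = tp := by
      funext x; simp only [fill]; rw [if_neg (by omega)]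
    rw [this]
    exact .loopF rfl
  | succ d ih =>
    refine .loopT (by simp [hfl]) (Exec.act _ _ _) ?_
    rw [if_neg (by simp [hgo (h' + (d + 1)) (by omega) (by omega)])]
    have hs : ({ s₁ with fl := false } : Store A) = s₁ := by rw [← hfl]
    dsimp only
    rw [hs, put_eq_fill w tp hN]
    have h2 : fill w tp (h' + 1) (h' + (d + 1) + 1) =
        fill w (fill w tp (h' + (d + 1)) (h' + (d + 1) + 1)) (h' + 1) (h' + d + 1) := by
      funext x
      simp only [fill]
      split_ifs <;> first | rfl | omega
    have hl : ∀ i, i ≤ h' + d →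
        look N (fill w tp (h' + (d + 1)) (h' + (d + 1) + 1)) i = look N tp i := by
      intro i hi
      refine fill_congr_look fun x hx => ?_
      simp only [fill]; rw [if_neg (by omega)]
    have := ih (tp := fill w tp (h' + (d + 1)) (h' + (d + 1) + 1))
      (by rw [hl _ (by omega)]; exact htgt)
      (by omega) (by omega)
      (fun i hi hi' => by rw [hl i (by omega)]; exact hgo i (by omega) (by omega))
    rw [h2]
    exact this

/-- Load `k` cells into the buffer, from left to right. -/
def load : ℕ → Prog (Store A)
  | 0 => skip
  | k + 1 => .seq (load k) (.act fun s c =>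
      ({ s with buf := Function.update s.buf (fldAt k) c.val }, none, .right))

/-- Store `k` cells from the buffer, from right to left. -/
def unload : ℕ → Prog (Store A)
  | 0 => skip
  | k + 1 => .seq (moves .left 1) (.seq (write fun s => s.buf (fldAt k)) (unload k))

/-- Read the scanned block, change the store and the block, and move on by at most a block. -/
def visit (f : Store A → Store A) : Prog (Store A) :=
  .seq (load 18) (.seq (upd f) (.seq (unload 18)
    (.ite (fun s => s.dir.isRight) (moves .right 18)
      (.ite (fun s => match s.dir with | .left => true | _ => false) (moves .left 18) skip))))

theorem exec_load {k : ℕ} (s : Store A) (tp : ℕ → Bool) (p : ℕ) (y : List Bool) (hk : k ≤ 18)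
    (hp : p + k ≤ N) :
    Exec N O (load k) s ⟨tp, p + 1, y⟩
      { s with buf := fun F => if F.idx < k then tp (p + F.idx) else s.buf F }
      ⟨tp, p + 1 + k, y⟩ := by
  induction k with
  | zero => simp only [Nat.not_lt_zero, if_false]; exact exec_skip s _
  | succ k ih =>
    have h1 := Exec.act (N := N) (O := O) (fun (s : Store A) c =>
      ({ s with buf := Function.update s.buf (fldAt k) c.val }, none, .right))
      { s with buf := fun F => if F.idx < k then tp (p + F.idx) else s.buf F } ⟨tp, p + 1 + k, y⟩
    have hl : look N tp (p + 1 + k) = .bit (tp (p + k)) := by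
      rw [show p + 1 + k = p + k + 1 by omega]; simp [look]; omega
    have hm : moveBounded N .right (p + 1 + k) = p + 1 + (k + 1) := by
      simp only [moveBounded]; omega
    refine .seq (ih (by omega) (by omega)) ?_
    dsimp only at h1
    rw [hl, hm] at h1
    have hp : put N tp none (p + 1 + k) = tp := rfl
    rw [hp] at h1
    convert h1 using 2
    funext F
    rw [Function.update_apply]
    by_cases hF : F = fldAt k
    · subst hF
      simp [idx_fldAt k (by omega), Cell.val]
    · have : F.idx ≠ k := fun h => hF (by rw [← h, fldAt_idx])
      rw [if_neg hF]
      by_cases hlt : F.idx < k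
      · rw [if_pos hlt, if_pos (by omega)]
      · rw [if_neg hlt, if_neg (by omega)]

theorem exec_unload {k : ℕ} (s : Store A) (tp : ℕ → Bool) (p : ℕ) (y : List Bool) (hk : k ≤ 18)
    (hp : p + k ≤ N) :
    Exec N O (unload k) s ⟨tp, p + 1 + k, y⟩ s
      ⟨fun x => if p ≤ x ∧ x < p + k then s.buf (fldAt (x - p)) else tp x, p + 1, y⟩ := by
  induction k generalizing tp with
  | zero =>
    have : (fun x => if p ≤ x ∧ x < p + 0 then s.buf (fldAt (x - p)) else tp x) = tp := by
      funext x; rw [if_neg (by omega)]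
    rw [this]
    exact exec_skip s _
  | succ k ih =>
    refine .seq (exec_left s tp (h' := p + k + 1) y (by omega))
      (.seq (exec_write _ s tp y (by omega)) ?_)
    have := ih (Function.update tp (p + k) (s.buf (fldAt k))) (by omega) (by omega)
    rw [show p + 1 + k = p + k + 1 by omega] at this
    convert this using 2
    funext x
    rw [Function.update_apply]
    by_cases hx : x = p + k
    · subst hx
      rw [if_pos (by omega), if_neg (by omega), if_pos rfl]
      congr 2; omega
    · rw [if_neg hx]
      by_cases h1 : p ≤ x ∧ x < p + k
      · rw [if_pos h1, if_pos (by omega)]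
      · rw [if_neg h1, if_neg (by omega)]

/-- A tape that consists of `V` blocks `G 0, …, G (V - 1)` of 18 cells, starting at cell `pre`, on
the background `bg`. -/
def lay (pre V : ℕ) (G : ℕ → Fld → Bool) (bg : ℕ → Bool) : ℕ → Bool := fun x =>
  if pre ≤ x ∧ x < pre + 18 * V then G ((x - pre) / 18) (fldAt ((x - pre) % 18)) else bg x

theorem lay_cell {pre V : ℕ} {G : ℕ → Fld → Bool} {bg : ℕ → Bool} {i k : ℕ} (hi : i < V)
    (hk : k < 18) : lay pre V G bg (pre + 18 * i + k) = G i (fldAt k) := by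
  have h1 : (pre + 18 * i + k - pre) / 18 = i := by omega
  have h2 : (pre + 18 * i + k - pre) % 18 = k := by omega
  rw [lay, if_pos (by omega), h1, h2]

/-- A visit changes block `i` only, to the contents of the buffer, and leads to a neighbouring block
or to block `i` again. -/
theorem exec_visit {pre V : ℕ} {G : ℕ → Fld → Bool} {bg : ℕ → Bool} {i : ℕ} (f : Store A → Store A)
    (s : Store A) (y : List Bool) (hi : i < V) (hN : pre + 18 * V ≤ N) {s' : Store A}
    (hs' : s' = f { s with buf := G i }) (hl : s'.dir = .left → 0 < i) {i' : ℕ}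
    (hi' : i' = moveUnbounded s'.dir i) :
    Exec N O (visit f) s ⟨lay pre V G bg, pre + 18 * i + 1, y⟩ s'
      ⟨lay pre V (Function.update G i s'.buf) bg, pre + 18 * i' + 1, y⟩ := by
  have h1 := exec_load (N := N) (O := O) (k := 18) s (lay pre V G bg) (pre + 18 * i) y le_rfl
    (by omega)
  have hb : (fun F : Fld => if F.idx < 18 then lay pre V G bg (pre + 18 * i + F.idx) else s.buf F) =
      G i := by
    funext F
    rw [if_pos F.idx_lt, lay_cell hi F.idx_lt, fldAt_idx]
  rw [hb] at h1
  have h2 := exec_unload (N := N) (O := O) (k := 18) s' (lay pre V G bg) (pre + 18 * i) y le_rfl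
    (by omega)
  have ht : (fun x => if pre + 18 * i ≤ x ∧ x < pre + 18 * i + 18 then
      s'.buf (fldAt (x - (pre + 18 * i))) else lay pre V G bg x) =
      lay pre V (Function.update G i s'.buf) bg := by
    funext x
    by_cases hx : pre + 18 * i ≤ x ∧ x < pre + 18 * i + 18
    · have e1 : (x - pre) / 18 = i := by omega
      have e2 : (x - pre) % 18 = x - (pre + 18 * i) := by omega
      rw [if_pos hx, lay, if_pos (by omega), e1, e2, Function.update_self]
    · rw [if_neg hx]
      simp only [lay]
      by_cases hx' : pre ≤ x ∧ x < pre + 18 * V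
      · have e1 : (x - pre) / 18 ≠ i := by omega
        rw [if_pos hx', if_pos hx', Function.update_of_ne e1]
      · rw [if_neg hx', if_neg hx']
  rw [ht] at h2
  refine .seq h1 (.seq (exec_upd _ _ _) ?_)
  rw [← hs']
  refine .seq h2 ?_
  clear hs'
  · subst hi'
    cases hd : s'.dir with
    | right =>
      refine .iteT (by simp [hd, Move.isRight]) (exec_right _ _ _ ?_ ?_)
      · simp [moveUnbounded]; ring
      · simp [moveUnbounded]; omega
    | left =>
      have := hl hd
      refine .iteF (by simp [hd, Move.isRight]) (.iteT (by simp [hd]) (exec_left _ _ _ ?_))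
      simp [moveUnbounded]; omega
    | stay =>
      refine .iteF (by simp [hd, Move.isRight]) (.iteF (by simp [hd]) ?_)
      exact exec_skip _ _

end

/-! ### Background cells: the pending query and its specification -/

section

open Prog

variable {A : Type} {N : ℕ} {O : Oracle}

theorem update_lay {pre V : ℕ} {G : ℕ → Fld → Bool} {bg : ℕ → Bool} {x : ℕ} (b : Bool)
    (hx : x < pre ∨ pre + 18 * V ≤ x) :
    Function.update (lay pre V G bg) x b = lay pre V G (Function.update bg x b) := by
  funext z
  simp only [Function.update_apply, lay]
  by_cases hz : z = x
  · rw [if_pos hz, if_neg (by omega), if_pos hz]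
  · rw [if_neg hz, if_neg hz]

theorem fill_lay {pre V : ℕ} {G : ℕ → Fld → Bool} {bg : ℕ → Bool} {a b : ℕ} (w : Option Bool)
    (hx : b ≤ pre + 1 ∨ pre + 18 * V + 1 ≤ a) :
    fill w (lay pre V G bg) a b = lay pre V G (fill w bg a b) := by
  funext z
  simp only [fill, lay]
  by_cases hz : a ≤ z + 1 ∧ z + 1 < b
  · rw [if_pos hz, if_neg (by omega), if_neg (by omega), if_pos hz]
  · rw [if_neg hz, if_neg hz]

theorem lay_bg {pre V : ℕ} {G : ℕ → Fld → Bool} {bg : ℕ → Bool} {x : ℕ}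
    (hx : x < pre ∨ pre + 18 * V ≤ x) : lay pre V G bg x = bg x := by
  rw [lay, if_neg (by omega)]

/-- Does the cell contain the bit 1? -/
def isOne : Cell → Bool
  | .bit b => b
  | _ => false

theorem isOne_look (tp : ℕ → Bool) {x : ℕ} (hx : x < N) : isOne (look N tp (x + 1)) = tp x := by
  simp [look, hx, isOne]

theorem exec_find_right (s : Store A) (tp : ℕ → Bool) {x x' : ℕ} (y : List Bool) (hx : x ≤ x')
    (hN : x' < N) (h₀ : ∀ i, x ≤ i → i < x' → tp i = false) (h₁ : tp x' = true) :
    Exec N O (scan isOne none .right) s ⟨tp, x + 1, y⟩ { s with fl := true } ⟨tp, x' + 1, y⟩ := by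
  refine exec_scan_right none s y (by omega) (by omega) (fun i hi hi' => ?_) ?_
    (fill_none _ _ _).symm
  · obtain ⟨i, rfl⟩ := Nat.exists_eq_add_of_le' (by omega : 1 ≤ i)
    rw [isOne_look _ (by omega)]; exact h₀ i (by omega) (by omega)
  · rw [isOne_look _ hN, h₁]

theorem exec_find_left (s : Store A) (tp : ℕ → Bool) {x x' : ℕ} (y : List Bool) (hx : x' ≤ x)
    (hN : x < N) (h₀ : ∀ i, x' < i → i ≤ x → tp i = false) (h₁ : tp x' = true) :
    Exec N O (scan isOne none .left) s ⟨tp, x + 1, y⟩ { s with fl := true } ⟨tp, x' + 1, y⟩ := by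
  refine exec_scan_left none s y (by omega) (by omega) (fun i hi hi' => ?_) ?_
    (fill_none _ _ _).symm
  · obtain ⟨i, rfl⟩ := Nat.exists_eq_add_of_le' (by omega : 1 ≤ i)
    rw [isOne_look _ (by omega)]; exact h₀ i (by omega) (by omega)
  · rw [isOne_look _ (by omega), h₁]

/-- Go from block to block until a test of the block succeeds. -/
def walk (t : Fin 5 → (Fld → Bool) → Bool) (m : Move) : Prog (Store A) :=
  .seq (upd fun s => { s with fl := false })
    (.loop (fun s => !s.fl) (visit fun s =>
      if t s.cur s.buf then { s with fl := true, dir := .stay }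
      else { s with fl := false, dir := m }))

/-- A walk over `d` blocks that do not satisfy the test, to a block that does. -/
theorem exec_walk {t : Fin 5 → (Fld → Bool) → Bool} {m : Move}
    {pre V : ℕ} {G : ℕ → Fld → Bool} {bg : ℕ → Bool} (d : ℕ) {i i' : ℕ}
    (s : Store A) (y : List Bool) (hN : pre + 18 * V ≤ N) (hi : i < V) (hi' : i' < V)
    (hd : i' = (moveUnbounded m)^[d] i)
    (h₀ : ∀ k < d, t s.cur (G ((moveUnbounded m)^[k] i)) = false) (h₁ : t s.cur (G i') = true)
    (hrange : ∀ k < d, (m = .left → 0 < (moveUnbounded m)^[k] i) ∧ (moveUnbounded m)^[k] i < V) :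
    Exec N O (walk t m) s ⟨lay pre V G bg, pre + 18 * i + 1, y⟩
      { s with fl := true, dir := .stay, buf := G i' }
      ⟨lay pre V G bg, pre + 18 * i' + 1, y⟩ := by
  refine .seq (exec_upd _ _ _) ?_
  generalize hs : ({ s with fl := false } : Store A) = s₁
  have hfl : s₁.fl = false := by rw [← hs]
  have hc : s.cur = s₁.cur := by rw [← hs]
  have hs' : ({ s with fl := true, dir := .stay, buf := G i' } : Store A) =
    { s₁ with fl := true, dir := .stay, buf := G i' } := by rw [← hs]
  rw [hs']
  rw [hc] at h₀ h₁
  clear hs hs' hc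
  induction d generalizing i s₁ with
  | zero =>
    simp only [Function.iterate_zero, id] at hd
    subst hd
    refine .loopT (by simp [hfl]) (exec_visit _ _ _ hi hN
      (s' := { s₁ with fl := true, dir := .stay, buf := G i' }) ?_ (by simp) rfl) ?_
    · simp [h₁]
    · simp only [Function.update_eq_self]
      exact .loopF rfl
  | succ d ih =>
    have h00 := h₀ 0 (by omega)
    simp only [Function.iterate_zero, id] at h00
    refine .loopT (by simp [hfl]) (exec_visit _ _ _ hi hN
      (s' := { s₁ with fl := false, dir := m, buf := G i }) ?_ ?_ rfl) ?_
    · simp [h00]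
    · intro hl; exact (hrange 0 (by omega)).1 hl
    · simp only [Function.update_eq_self]
      have hstep : moveUnbounded m i < V := by
        rcases d with _ | d
        · rw [hd] at hi'; exact hi'
        · exact (hrange 1 (by omega)).2
      have := ih (i := moveUnbounded m i) hstep (by rw [hd, Function.iterate_succ_apply])
        (fun k hk => by
          have := hrange (k + 1) (by omega); rwa [Function.iterate_succ_apply] at this)
        { s₁ with fl := false, dir := m, buf := G i } h₁
        (fun k hk => by
          have := h₀ (k + 1) (by omega); rwa [Function.iterate_succ_apply] at this) rfl
      exact this

theorem iterate_right (k i : ℕ) : (moveUnbounded .right)^[k] i = i + k := by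
  induction k generalizing i with
  | zero => rfl
  | succ k ih => rw [Function.iterate_succ_apply, ih]; simp only [moveUnbounded]; omega

theorem iterate_left (k i : ℕ) : (moveUnbounded .left)^[k] i = i - k := by
  induction k generalizing i with
  | zero => rfl
  | succ k ih => rw [Function.iterate_succ_apply, ih]; simp only [moveUnbounded]; omega

theorem exec_walk_right {t : Fin 5 → (Fld → Bool) → Bool}
    {pre V : ℕ} {G : ℕ → Fld → Bool} {bg : ℕ → Bool} {i i' : ℕ}
    (s : Store A) (y : List Bool) (hN : pre + 18 * V ≤ N) (hi : i ≤ i') (hi' : i' < V)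
    (h₀ : ∀ k, i ≤ k → k < i' → t s.cur (G k) = false) (h₁ : t s.cur (G i') = true) :
    Exec N O (walk t .right) s ⟨lay pre V G bg, pre + 18 * i + 1, y⟩
      { s with fl := true, dir := .stay, buf := G i' }
      ⟨lay pre V G bg, pre + 18 * i' + 1, y⟩ := by
  refine exec_walk (i' - i) s y hN (by omega) hi' (by rw [iterate_right]; omega)
    (fun k hk => ?_) h₁ (fun k hk => ⟨by simp, by rw [iterate_right]; omega⟩)
  rw [iterate_right]; exact h₀ _ (by omega) (by omega)

theorem exec_walk_left {t : Fin 5 → (Fld → Bool) → Bool}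
    {pre V : ℕ} {G : ℕ → Fld → Bool} {bg : ℕ → Bool} {i i' : ℕ}
    (s : Store A) (y : List Bool) (hN : pre + 18 * V ≤ N) (hi : i' ≤ i) (hi' : i < V)
    (h₀ : ∀ k, i' < k → k ≤ i → t s.cur (G k) = false) (h₁ : t s.cur (G i') = true) :
    Exec N O (walk t .left) s ⟨lay pre V G bg, pre + 18 * i + 1, y⟩
      { s with fl := true, dir := .stay, buf := G i' }
      ⟨lay pre V G bg, pre + 18 * i' + 1, y⟩ := by
  refine exec_walk (i - i') s y hN (by omega) (by omega) (by rw [iterate_left]; omega)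
    (fun k hk => ?_) h₁ (fun k hk => ⟨fun _ => by rw [iterate_left]; omega, by
      rw [iterate_left]; omega⟩)
  rw [iterate_left]; exact h₀ _ (by omega) (by omega)

/-- The blocks carry the correct end flags. -/
def Flags (V : ℕ) (G : ℕ → Fld → Bool) : Prop :=
  ∀ i, G i .first = decide (i = 0) ∧ G i .last = decide (i + 1 = V)

/-- Go back to the first block. -/
def home : Prog (Store A) := .seq (walk (fun _ b => b .first) .left) clear

theorem exec_home {pre V : ℕ} {G : ℕ → Fld → Bool} {bg : ℕ → Bool} {i : ℕ}
    (s : Store A) (y : List Bool) (hG : Flags V G) (hN : pre + 18 * V ≤ N) (hi : i < V) :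
    Exec N O home s ⟨lay pre V G bg, pre + 18 * i + 1, y⟩ (.mk' s.a s.saved)
      ⟨lay pre V G bg, pre + 1, y⟩ :=
  .seq (exec_walk_left (i' := 0) s y hN (by omega) hi
    (fun k hk _ => by simp [(hG k).1]; omega) (by simp [(hG 0).1])) (exec_clear _ _)

/-- From the first block to the second mark to the right of the blocks. -/
def toMark : Prog (Store A) :=
  .seq (walk (fun _ b => b .last) .right) (.seq (moves .right 18) (.seq (scan isOne none .right)
    (.seq (moves .right 1) (.seq (scan isOne none .right) clear))))

/-- From the second mark to the right of the blocks to the first block. -/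
def fromMark : Prog (Store A) :=
  .seq (moves .left 1) (.seq (scan isOne none .left) (.seq (moves .left 1)
    (.seq (scan isOne none .left) (.seq (moves .left 17) home))))

theorem exec_toMark {pre V : ℕ} {G : ℕ → Fld → Bool} {bg : ℕ → Bool} {p q : ℕ}
    (s : Store A) (y : List Bool) (hG : Flags V G) (hV : 0 < V) (hp : pre + 18 * V ≤ p)
    (hpq : p < q) (hq : q < N) (h₀ : ∀ x, pre + 18 * V ≤ x → x < q → bg x = decide (x = p))
    (h₁ : bg q = true) :
    Exec N O toMark s ⟨lay pre V G bg, pre + 1, y⟩ (.mk' s.a s.saved)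
      ⟨lay pre V G bg, q + 1, y⟩ := by
  refine .seq (exec_walk_right (i := 0) (i' := V - 1) s y (by omega) (by omega) (by omega)
    (fun k _ hk => by simp [(hG k).2]; omega) (by simp [(hG _).2]; omega)) ?_
  refine .seq (exec_right (h' := pre + 18 * V + 1) _ _ _ (by omega) (by omega)) ?_
  refine .seq (exec_find_right (x' := p) _ _ _ hp (by omega) (fun i hi hi' => ?_) ?_) ?_
  · rw [lay_bg (.inr hi), h₀ i hi (by omega)]; simp; omega
  · rw [lay_bg (.inr hp), h₀ p hp (by omega)]; simp
  refine .seq (exec_right (h' := p + 1 + 1) _ _ _ (by omega) (by omega)) ?_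
  refine .seq (exec_find_right (x' := q) _ _ _ (by omega) (by omega) (fun i hi hi' => ?_) ?_)
    (exec_clear _ _)
  · rw [lay_bg (.inr (by omega)), h₀ i (by omega) (by omega)]; simp; omega
  · rw [lay_bg (.inr (by omega)), h₁]

theorem exec_fromMark {pre V : ℕ} {G : ℕ → Fld → Bool} {bg : ℕ → Bool} {p q : ℕ}
    (s : Store A) (y : List Bool) (hG : Flags V G) (hV : 0 < V) (hp : pre + 18 * V ≤ p)
    (hpq : p < q) (hq : q < N) (h₀ : ∀ x, pre + 18 * V ≤ x → x < q → bg x = decide (x = p)) :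
    Exec N O fromMark s ⟨lay pre V G bg, q + 1, y⟩ (.mk' s.a s.saved)
      ⟨lay pre V G bg, pre + 1, y⟩ := by
  refine .seq (exec_left (h' := q - 1 + 1) _ _ _ (by omega)) ?_
  refine .seq (exec_find_left (x' := p) _ _ _ (by omega) (by omega) (fun i hi hi' => ?_) ?_) ?_
  · rw [lay_bg (.inr (by omega)), h₀ i (by omega) (by omega)]; simp; omega
  · rw [lay_bg (.inr hp), h₀ p hp (by omega)]; simp
  refine .seq (exec_left (h' := p - 1 + 1) _ _ _ (by omega)) ?_
  refine .seq (exec_find_left (x' := pre + 18 * (V - 1) + 17) _ _ _ (by omega) (by omega)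
    (fun i hi hi' => ?_) ?_) ?_
  · rw [lay_bg (.inr (by omega)), h₀ i (by omega) (by omega)]; simp; omega
  · rw [lay_cell (by omega) (by omega)]
    exact (hG _).2.trans (by simp; omega)
  refine .seq (exec_left (h' := pre + 18 * (V - 1) + 1) _ _ _ (by omega)) ?_
  exact exec_home _ _ hG (by omega) (by omega)

/-- The cells to the left of the blocks: the pending query, starting at cell 1, followed by a 1,
which makes it possible to find the end of the query. -/
def rawBit (y : List Bool) : ℕ → Bool
  | 0 => false
  | x + 1 => (y ++ [true])[x]?.getD false

/-- The last `2 l` cells of the tape, which specify the query from cell 1 to cell `k`, with an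
additional mark in front of the binary expansion of `k`. As the query starts at cell 1, there are
exactly two ones between the blocks and the binary expansion of `k`, namely the lowest digit of the
number 1, and the mark. -/
def specBit (N l k x : ℕ) : Bool :=
  decide (x + 2 * l = N) || decide (x + l + 1 = N) || (decide (N ≤ x + l) && k.testBit (x + l - N))

/-- The cells outside the blocks. -/
def backg (N pre l : ℕ) (y : List Bool) (x : ℕ) : Bool :=
  if x < pre then rawBit y x else specBit N l y.length x

/-- The binary expansion of `k + 1` arises from that of `k` by a carry that stops at the lowest
digit 0. -/
theorem testBit_succ_spec (k : ℕ) : ∃ t, (∀ i < t, k.testBit i = true) ∧ k.testBit t = false ∧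
    ∀ i, (k + 1).testBit i = if i < t then false else if i = t then true else k.testBit i := by
  induction k using Nat.strong_induction_on with
  | _ k ih =>
    rcases Nat.even_or_odd' k with ⟨m, rfl | rfl⟩
    · refine ⟨0, by simp, by simp, fun i => ?_⟩
      cases i with
      | zero => simp
      | succ i => simp [Nat.testBit_succ, show (2 * m + 1) / 2 = m by omega]
    · obtain ⟨t, h1, h2, h3⟩ := ih m (by omega)
      refine ⟨t + 1, fun i hi => ?_, ?_, fun i => ?_⟩
      · cases i with
        | zero => simp
        | succ i => rw [Nat.testBit_succ, show (2 * m + 1) / 2 = m by omega]; exact h1 i (by omega)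
      · rw [Nat.testBit_succ, show (2 * m + 1) / 2 = m by omega]; exact h2
      · cases i with
        | zero => simp [show 2 * m + 1 + 1 = 2 * (m + 1) by ring]
        | succ i =>
          rw [Nat.testBit_succ, Nat.testBit_succ, show (2 * m + 1) / 2 = m by omega,
            show (2 * m + 1 + 1) / 2 = m + 1 by omega, h3 i]
          simp

theorem binValue_bits (l k : ℕ) (hk : k < 2 ^ l) : binValue ((List.range l).map k.testBit) = k := by
  induction l generalizing k with
  | zero => simp [binValue] at hk ⊢; omega
  | succ l ih =>
    have h2 := ih (k / 2) (by rw [pow_succ] at hk; omega)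
    rw [List.range_succ_eq_map]
    simp only [List.map_cons, List.map_map, binValue, Nat.ofDigits_cons] at h2 ⊢
    have : (Bool.toNat ∘ k.testBit ∘ Nat.succ) = Bool.toNat ∘ (k / 2).testBit := by
      funext i; simp [Nat.testBit_succ]
    rw [this, h2, Nat.testBit_zero]
    rcases Nat.mod_two_eq_zero_or_one k with h | h <;> simp [h] <;> omega

/-- The query that an in-place machine makes on a tape on which the word `y` starts at cell 1, if
the last `2 l` cells are the numbers 1 and `|y|`. For the empty word the specified interval is
empty. -/
theorem queryWord_eq {tp : ℕ → Bool} {l : ℕ} {y : List Bool} (hl : l = Nat.clog 2 N) (hl1 : 1 ≤ l)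
    (hN : 2 * l ≤ N) (hy : y.length < 2 ^ l) (hyN : y.length + 1 ≤ N)
    (h₁ : ∀ i < l, tp (N - 2 * l + i) = decide (i = 0))
    (h₂ : ∀ i < l, tp (N - l + i) = y.length.testBit i)
    (h₃ : ∀ i, (hi : i < y.length) → tp (1 + i) = y[i]) : queryWord (word N tp) = y := by
  -- the first half of the specification is the number 1
  have e1 : ((word N tp).drop (N - 2 * l)).take l = (List.range l).map (Nat.testBit 1) := by
    refine List.ext_getElem (by simp [word]; omega) fun i hi hi' => ?_
    simp only [List.length_map, List.length_range] at hi'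
    simp only [word, List.getElem_take, List.getElem_drop, List.getElem_map, List.getElem_range,
      h₁ i hi']
    cases i <;> simp [Nat.testBit_succ]
  -- the second half of the specification is the length of the query
  have e2 : ((word N tp).drop (N - 2 * l)).drop l = (List.range l).map (Nat.testBit y.length) := by
    refine List.ext_getElem (by simp [word]; omega) fun i hi hi' => ?_
    simp only [List.length_map, List.length_range] at hi'
    simp only [word, List.getElem_drop, List.getElem_map, List.getElem_range]
    rw [← h₂ i hi']; congr 1; omega
  simp only [queryWord, length_word, ← hl, e1, e2]
  rw [binValue_bits l 1 (Nat.one_lt_two_pow (by omega)), binValue_bits l _ hy]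
  refine List.ext_getElem (by simp [word]; omega) fun i hi hi' => ?_
  simp only [word, List.getElem_drop, List.getElem_take, List.getElem_map, List.getElem_range]
  exact h₃ i hi'

end

/-! ### Machines with five virtual tapes -/

section

open Prog

/-- What a machine with five virtual tapes does in one step: it accesses one of its tapes (seeing
whether the head is on the first or the last cell, and the two-bit symbol there), or it appends a
bit to the pending query, or it asks the query, or it announces that the specification of the query
has to get one digit longer. The last operation is needed because the number of digits depends on
the length of the physical tape, which the machine has to find out by itself. -/
inductive Op (A : Type) where
  | tape (j : Fin 5) (f : Bool → Bool → Bool × Bool → A × (Bool × Bool) × Move)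
  | app (b : Bool) (a : A)
  | ask (k : Bool → A)
  | grow (a : A)

/-- A configuration: state, contents and head positions of the tapes, the pending query, and the
number of digits in its specification. -/
structure Conf (A : Type) where
  a : A
  cont : Fin 5 → ℕ → Bool × Bool
  pos : Fin 5 → ℕ
  y : List Bool
  l : ℕ

/-- Heads stay on their tapes of `V` cells. -/
def moveClamped (V : ℕ) : Move → ℕ → ℕ
  | .left, h => h - 1
  | .stay, h => h
  | .right, h => if h + 1 < V then h + 1 else h

variable {A : Type} {N : ℕ} {O : Oracle}

/-- One step of a machine whose virtual tapes have `V` cells. -/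
def Conf.step (V : ℕ) (O : Oracle) (op : A → Op A) (c : Conf A) : Conf A :=
  match op c.a with
  | .tape j f =>
    let r := f (decide (c.pos j = 0)) (decide (c.pos j + 1 = V)) (c.cont j (c.pos j))
    ⟨r.1, Function.update c.cont j (Function.update (c.cont j) (c.pos j) r.2.1),
      Function.update c.pos j (moveClamped V r.2.2 (c.pos j)), c.y, c.l⟩
  | .app b a => ⟨a, c.cont, c.pos, c.y ++ [b], c.l⟩
  | .ask k => ⟨k (O c.y), c.cont, c.pos, [], c.l⟩
  | .grow a => ⟨a, c.cont, c.pos, c.y, c.l + 1⟩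

/-- The blocks that represent a configuration, with clock bits `T`. -/
def Conf.blocks (V : ℕ) (c : Conf A) (T : ℕ → Bool) (i : ℕ) : Fld → Bool
  | .first => decide (i = 0)
  | .last => decide (i + 1 = V)
  | .clock => T i
  | .fst j => (c.cont j i).1
  | .snd j => (c.cont j i).2
  | .head j => decide (c.pos j = i)

/-- The memory that represents a configuration. Between steps the head is on the first cell of the
first block. -/
def Conf.env (N pre V : ℕ) (c : Conf A) (T : ℕ → Bool) : Env :=
  ⟨lay pre V (c.blocks V T) (backg N pre c.l c.y), pre + 1, c.y⟩

theorem Conf.flags (V : ℕ) (c : Conf A) (T : ℕ → Bool) : Flags V (c.blocks V T) :=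
  fun _ => ⟨rfl, rfl⟩

/-- The direction that takes the head of a virtual tape to its next position, without leaving the
tape. -/
def clampDir (fi la : Bool) : Move → Move
  | .left => if fi then .stay else .left
  | .stay => .stay
  | .right => if la then .stay else .right

theorem moveUnbounded_clampDir {V h : ℕ} (m : Move) (hh : h < V) :
    moveUnbounded (clampDir (decide (h = 0)) (decide (h + 1 = V)) m) h = moveClamped V m h := by
  cases m with
  | left => by_cases h0 : h = 0 <;> simp [clampDir, moveClamped, h0, moveUnbounded]
  | stay => rfl
  | right =>
    by_cases h0 : h + 1 = V
    · simp [clampDir, moveClamped, h0, moveUnbounded]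
    · have : h + 1 < V := by omega
      simp [clampDir, moveClamped, h0, moveUnbounded, this]

theorem moveClamped_lt {V h : ℕ} (m : Move) (hh : h < V) : moveClamped V m h < V := by
  cases m <;> simp only [moveClamped] <;> (try split_ifs) <;> omega

/-- The part of a tape access that happens at the scanned cell. -/
def access₁ (op : A → Op A) (s : Store A) : Store A :=
  match op s.a with
  | .tape _ f =>
    let r := f (s.buf .first) (s.buf .last) (s.buf (.fst s.cur), s.buf (.snd s.cur))
    { s with
      a := r.1
      buf := Function.update (Function.update (Function.update s.buf (.fst s.cur) r.2.1.1)
        (.snd s.cur) r.2.1.2) (.head s.cur) false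
      dir := clampDir (s.buf .first) (s.buf .last) r.2.2 }
  | _ => s

/-- The part of a tape access that happens at the new position of the head. -/
def access₂ (s : Store A) : Store A :=
  { s with buf := Function.update s.buf (.head s.cur) true, dir := .stay }

/-- Access a virtual tape: find its head mark, change the symbol there and remove the mark, and put
the mark on the block that is reached by the move. -/
def accessProg (op : A → Op A) : Prog (Store A) :=
  .seq (upd fun s => { s with cur := match op s.a with | .tape j _ => j | _ => 0 })
    (.seq (walk (fun j b => b (.head j)) .right) (.seq (visit (access₁ op))
      (.seq (visit access₂) home)))

/-- An access to a virtual tape changes a symbol and a head mark in the blocks. -/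
theorem exec_access {op : A → Op A} {pre V : ℕ} (c : Conf A) (T : ℕ → Bool) (b : Bool)
    (hN : pre + 18 * V ≤ N) (hpos : ∀ j, c.pos j < V) {j f} (hop : op c.a = .tape j f) :
    Exec N O (accessProg op) (.mk' c.a b) (c.env N pre V T)
      (.mk' (c.step V O op).a b) ((c.step V O op).env N pre V T) := by
  have hV : 0 < V := (Nat.zero_le _).trans_lt (hpos 0)
  have hp := hpos j
  refine .seq (exec_upd _ _ _) ?_
  have hcur : (match op (Store.mk' c.a b).a with | .tape j _ => j | _ => 0) = j := by
    rw [show (Store.mk' c.a b).a = c.a from rfl, hop]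
  rw [hcur]
  refine .seq (exec_walk_right (i := 0) (i' := c.pos j) _ _ hN (by omega) (hpos j)
    (fun k _ hk => ?_) ?_) ?_
  · simp [Conf.blocks]; omega
  · simp [Conf.blocks]
  generalize hr : f (decide (c.pos j = 0)) (decide (c.pos j + 1 = V)) (c.cont j (c.pos j)) = r
  refine .seq (exec_visit _ _ _ hp hN (s' := ⟨r.1, b,
    Function.update (Function.update (Function.update (c.blocks V T (c.pos j)) (.fst j) r.2.1.1)
        (.snd j) r.2.1.2) (.head j) false, true,
    clampDir (decide (c.pos j = 0)) (decide (c.pos j + 1 = V)) r.2.2, j⟩) ?_ ?_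
    (i' := moveClamped V r.2.2 (c.pos j)) ?_) ?_
  · simp only [access₁, Store.mk', hop, Conf.blocks, hr]
  · dsimp only
    cases r.2.2 <;> simp only [clampDir]
    · split_ifs with h
      · simp
      · simp at h; omega
    · simp
    · split_ifs <;> simp
  · exact (moveUnbounded_clampDir _ hp).symm
  have hp' := moveClamped_lt r.2.2 hp
  have hstep : c.step V O op = ⟨r.1, Function.update c.cont j
    (Function.update (c.cont j) (c.pos j) r.2.1),
      Function.update c.pos j (moveClamped V r.2.2 (c.pos j)), c.y, c.l⟩ := by
    simp only [Conf.step, hop, hr]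
  refine .seq (exec_visit _ _ _ hp' hN rfl (by simp [access₂]) rfl) ?_
  have hbl : Function.update
      (Function.update (c.blocks V T) (c.pos j)
        (Function.update (Function.update
          (Function.update (c.blocks V T (c.pos j)) (.fst j) r.2.1.1)
          (.snd j) r.2.1.2) (.head j) false))
      (moveClamped V r.2.2 (c.pos j))
      (Function.update (Function.update (c.blocks V T) (c.pos j)
        (Function.update (Function.update
          (Function.update (c.blocks V T (c.pos j)) (.fst j) r.2.1.1)
          (.snd j) r.2.1.2) (.head j) false) (moveClamped V r.2.2 (c.pos j))) (.head j) true) =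
      (c.step V O op).blocks V T := by
    rw [hstep]
    generalize moveClamped V r.2.2 (c.pos j) = p'
    funext i F
    by_cases hi : i = p'
    · subst hi
      rw [Function.update_self]
      by_cases hi' : i = c.pos j
      · subst hi'
        rw [Function.update_self]
        cases F with
        | fst k => by_cases hk : k = j <;> simp [Conf.blocks, hk]
        | snd k => by_cases hk : k = j <;> simp [Conf.blocks, hk]
        | head k => by_cases hk : k = j <;> simp [Conf.blocks, hk]
        | _ => simp [Conf.blocks]
      · rw [Function.update_of_ne hi']
        cases F with
        | fst k => by_cases hk : k = j <;> simp [Conf.blocks, hk, hi']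
        | snd k => by_cases hk : k = j <;> simp [Conf.blocks, hk, hi']
        | head k => by_cases hk : k = j <;> simp [Conf.blocks, hk]
        | _ => simp [Conf.blocks]
    · rw [Function.update_of_ne hi]
      by_cases hi' : i = c.pos j
      · subst hi'
        rw [Function.update_self]
        cases F with
        | fst k => by_cases hk : k = j <;> simp [Conf.blocks, hk]
        | snd k => by_cases hk : k = j <;> simp [Conf.blocks, hk]
        | head k => by_cases hk : k = j <;>
            simp [Conf.blocks, hk, Ne.symm hi]
        | _ => simp [Conf.blocks]
      · rw [Function.update_of_ne hi']
        cases F with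
        | fst k => by_cases hk : k = j <;> simp [Conf.blocks, hk, hi']
        | snd k => by_cases hk : k = j <;> simp [Conf.blocks, hk, hi']
        | head k =>
          by_cases hk : k = j <;> simp [Conf.blocks, hk, Ne.symm hi]
          omega
        | _ => simp [Conf.blocks]
  simp only [access₂, moveUnbounded]
  rw [hbl]
  have := exec_home (N := N) (O := O) (pre := pre) (bg := backg N pre c.l c.y)
    (i := moveClamped V r.2.2 (c.pos j))
    (access₂ ⟨r.1, b, (Function.update (c.blocks V T) (c.pos j)
        (Function.update (Function.update
          (Function.update (c.blocks V T (c.pos j)) (.fst j) r.2.1.1)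
          (.snd j) r.2.1.2) (.head j) false) (moveClamped V r.2.2 (c.pos j))), true,
    clampDir (decide (c.pos j = 0)) (decide (c.pos j + 1 = V)) r.2.2, j⟩) c.y
      ((c.step V O op).flags V T) hN hp'
  have e1 : (c.step V O op).a = r.1 := by rw [hstep]
  have e2 : (c.step V O op).env N pre V T =
    ⟨lay pre V ((c.step V O op).blocks V T) (backg N pre c.l c.y), pre + 1, c.y⟩ := by
    simp only [Conf.env]; rw [hstep]
  rw [e1, e2]
  exact this

/-- Append a bit to the pending query, both to that of the program and to its copy on the tape,
where the bit replaces the final 1 and a new final 1 is written, and increment the length of the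
query in its specification. -/
def appProg (op : A → Op A) : Prog (Store A) :=
  let bit : Store A → Bool := fun s => match op s.a with | .app b _ => b | _ => false
  .seq (.app bit) (.seq (moves .left 1) (.seq (scan isOne none .left) (.seq (write bit)
    (.seq (moves .right 1) (.seq (write fun _ => true) (.seq (moves .right 1)
    (.seq (scan isOne none .right) (.seq toMark (.seq (moves .right 1)
    (.seq (scan (fun c => !isOne c) (some false) .right) (.seq (write fun _ => true)
    (.seq (moves .left 1) (.seq (scan isOne none .left) (.seq fromMark
    (upd fun s => { s with a := match op s.a with | .app _ a => a | _ => s.a })))))))))))))))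

/-- Appending a bit changes two cells. -/
theorem rawBit_append (y : List Bool) (b : Bool) (x : ℕ) :
    rawBit (y ++ [b]) x = if x = y.length + 1 then b else if x = y.length + 2 then true
      else rawBit y x := by
  cases x with
  | zero => simp [rawBit]
  | succ x =>
    rcases lt_trichotomy x y.length with h | h | h
    · rw [if_neg (by omega), if_neg (by omega)]
      simp only [rawBit]
      rw [List.append_assoc, List.getElem?_append_left h, List.getElem?_append_left h]
    · subst h; simp [rawBit]
    · by_cases h' : x = y.length + 1
      · subst h'; simp [rawBit]
      · rw [if_neg (by omega), if_neg (by omega)]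
        simp only [rawBit]
        rw [List.getElem?_eq_none (by simp; omega), List.getElem?_eq_none (by simp; omega)]

theorem rawBit_length (y : List Bool) : rawBit y (y.length + 1) = true := by simp [rawBit]

theorem rawBit_gt (y : List Bool) {x : ℕ} (hx : y.length + 1 < x) : rawBit y x = false := by
  obtain ⟨x, rfl⟩ := Nat.exists_eq_add_of_le' (by omega : 1 ≤ x)
  simp only [rawBit]
  rw [List.getElem?_eq_none (by simp; omega)]; rfl

/-- There is room on the tape for the blocks, for the pending query to their left, and for a
specification with `l` digits to their right. -/
structure Room (N pre V l : ℕ) (y : List Bool) : Prop where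
  pos : 0 < V
  two_le : 2 ≤ l
  right : pre + 18 * V + 2 * l ≤ N
  left : y.length + 2 ≤ pre
  len : y.length < 2 ^ l

theorem Room.backg_eq {pre V l : ℕ} {y : List Bool} (h : Room N pre V l y) {x : ℕ}
    (hx : pre + 18 * V ≤ x) (hx' : x < N - l - 1) :
    backg N pre l y x = decide (x = N - 2 * l) := by
  have := h.right
  rw [backg, if_neg (by omega), specBit]
  rw [decide_eq_false (by omega : ¬ x + l + 1 = N), decide_eq_false (by omega : ¬ N ≤ x + l)]
  simp only [Bool.or_false, Bool.false_and]
  exact decide_eq_decide.2 (by omega)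

theorem Room.backg_mark {pre V l : ℕ} {y : List Bool} (h : Room N pre V l y) :
    backg N pre l y (N - l - 1) = true := by
  have := h.right; have := h.two_le
  rw [backg, if_neg (by omega), specBit, decide_eq_true (by omega : N - l - 1 + l + 1 = N)]
  simp

theorem Room.backg_digit {pre V l : ℕ} {y : List Bool} (h : Room N pre V l y) (i : ℕ) :
    backg N pre l y (N - l + i) = y.length.testBit i := by
  have := h.right; have := h.two_le
  rw [backg, if_neg (by omega), specBit, decide_eq_false (by omega : ¬ N - l + i + l + 1 = N),
    decide_eq_false (by omega : ¬ N - l + i + 2 * l = N),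
    decide_eq_true (by omega : N ≤ N - l + i + l),
    show N - l + i + l - N = i by omega]
  simp

/-- Appending a bit changes the cells to the left of the blocks and the digits of the length of the
query. -/
theorem exec_app {op : A → Op A} {pre V : ℕ} (c : Conf A) (T : ℕ → Bool) (b : Bool)
    (hR : Room N pre V c.l c.y) (hl : c.y.length + 3 ≤ pre) (hl' : c.y.length + 1 < 2 ^ c.l)
    {b' a'} (hop : op c.a = .app b' a') :
    Exec N O (appProg op) (.mk' c.a b) (c.env N pre V T)
      (.mk' (c.step V O op).a b) ((c.step V O op).env N pre V T) := by
  have hN := hR.right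
  have h2 := hR.two_le
  have hV := hR.pos
  set y := c.y with hy
  set l := c.l with hl0
  have hbit : (match op (Store.mk' c.a b).a with | .app b _ => b | _ => false) = b' := by
    rw [show (Store.mk' c.a b).a = c.a from rfl, hop]
  set bg := backg N pre l y with hbg
  refine .seq (Exec.app _ _ _ (by simp only [Conf.env, ← hy]; omega)) ?_
  simp only [Conf.env, hbit, ← hy, ← hl0, ← hbg]
  set G := c.blocks V T with hG
  have hfl : Flags V G := c.flags V T
  -- the bit replaces the final 1 to the left of the blocks
  refine .seq (exec_left (h' := pre - 1 + 1) _ _ _ (by omega)) ?_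
  refine .seq (exec_find_left (x' := y.length + 1) _ _ _ (by omega) (by omega)
    (fun i hi hi' => ?_) ?_) ?_
  · rw [lay_bg (.inl (by omega)), hbg, backg, if_pos (by omega), rawBit_gt y hi]
  · rw [lay_bg (.inl (by omega)), hbg, backg, if_pos (by omega), rawBit_length]
  refine .seq (exec_write _ _ _ _ (by omega)) ?_
  refine .seq (exec_right (h' := y.length + 2 + 1) _ _ _ (by omega) (by omega)) ?_
  refine .seq (exec_write _ _ _ _ (by omega)) ?_
  have hbit' : (match op ({ Store.mk' c.a b with fl := true } : Store A).a with
      | .app b _ => b | _ => false) = b' := by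
    rw [show ({ Store.mk' c.a b with fl := true } : Store A).a = c.a from rfl, hop]
  rw [hbit', update_lay _ (.inl (by omega)), update_lay _ (.inl (by omega))]
  set bg1 := Function.update (Function.update bg (y.length + 1) b') (y.length + 2) true with hbg1
  have hbg1' : ∀ x, pre ≤ x → bg1 x = bg x := by
    intro x hx
    rw [hbg1, Function.update_of_ne (by omega), Function.update_of_ne (by omega)]
  refine .seq (exec_right (h' := y.length + 3 + 1) _ _ _ (by omega) (by omega)) ?_
  refine .seq (exec_find_right (x' := pre) _ _ _ (by omega) (by omega)
    (fun i hi hi' => ?_) ?_) ?_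
  · rw [lay_bg (.inl (by omega)), hbg1, Function.update_of_ne (by omega),
      Function.update_of_ne (by omega), hbg, backg, if_pos (by omega), rawBit_gt y (by omega)]
  · have := lay_cell (pre := pre) (G := G) (bg := bg1) (i := 0) (k := 0) hV (by omega)
    simp only [Nat.mul_zero, Nat.add_zero] at this
    rw [this, show fldAt 0 = .first from rfl, (hfl 0).1]; rfl
  refine .seq (exec_toMark (p := N - 2 * l) (q := N - l - 1) _ _ hfl hV (by omega) (by omega)
    (by omega) (fun x hx hx' => ?_) ?_) ?_
  · rw [hbg1' x (by omega)]; exact hR.backg_eq hx hx'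
  · rw [hbg1' _ (by omega)]; exact hR.backg_mark
  -- increment the length: the carry stops at digit `t`
  obtain ⟨t, ht1, ht2, ht3⟩ := testBit_succ_spec y.length
  have htl : t < l := by
    by_contra h
    have h1 : (y.length + 1).testBit t = true := by rw [ht3]; simp
    have h2 : y.length + 1 < 2 ^ t := hl'.trans_le (Nat.pow_le_pow_right (by omega) (by omega))
    rw [Nat.testBit_lt_two_pow h2] at h1; cases h1
  refine .seq (exec_right (h' := N - l + 1) _ _ _ (by omega) (by omega)) ?_
  refine .seq (exec_scan_right (h' := N - l + t + 1) _ _ _ (by omega) (by omega)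
    (fun i hi hi' => ?_) ?_ rfl) ?_
  · obtain ⟨i, rfl⟩ := Nat.exists_eq_add_of_le hi
    rw [show N - l + 1 + i = N - l + i + 1 by omega, isOne_look _ (by omega),
      lay_bg (.inr (by omega)), hbg1' _ (by omega), hbg, hR.backg_digit, ht1 i (by omega)]; rfl
  · rw [isOne_look _ (by omega), lay_bg (.inr (by omega)), hbg1' _ (by omega), hbg, hR.backg_digit,
      ht2]
    rfl
  rw [fill_lay _ (.inr (by omega))]
  refine .seq (exec_write _ _ _ _ (by omega)) ?_
  rw [update_lay _ (.inr (by omega))]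
  set bg2 := Function.update (fill (some false) bg1 (N - l + 1) (N - l + t + 1)) (N - l + t) true
    with hbg2
  have hfin : bg2 = backg N pre l (y ++ [b']) := by
    funext x
    rw [hbg2, Function.update_apply, fill, backg, rawBit_append, specBit]
    by_cases hx : x < pre
    · rw [if_neg (by omega), if_neg (by omega), if_pos hx, hbg1, Function.update_apply,
        Function.update_apply, hbg, backg, if_pos hx]
      split_ifs <;> first | rfl | omega
    · rw [if_neg hx, hbg1' x (by omega), hbg, backg, if_neg hx, specBit, List.length_append,
        List.length_singleton, ht3]
      by_cases hxN : N ≤ x + l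
      · rw [decide_eq_false (by omega : ¬ x + 2 * l = N),
          decide_eq_false (by omega : ¬ x + l + 1 = N), decide_eq_true hxN]
        simp only [Bool.false_or, Bool.true_and, Option.getD_some]
        split_ifs <;> first | rfl | omega
      · rw [decide_eq_false hxN, if_neg (by omega), if_neg (by omega)]
        simp
  have hR' : Room N pre V l (y ++ [b']) := ⟨hV, h2, hN, by simp; omega, by simpa using hl'⟩
  rw [hfin]
  refine .seq (exec_left (h' := N - l + t - 1 + 1) _ _ _ (by omega)) ?_
  refine .seq (exec_find_left (x' := N - l - 1) _ _ _ (by omega) (by omega)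
    (fun i hi hi' => ?_) ?_) ?_
  · obtain ⟨i, rfl⟩ := Nat.exists_eq_add_of_le (by omega : N - l ≤ i)
    rw [lay_bg (.inr (by omega)), hR'.backg_digit, List.length_append, List.length_singleton, ht3,
      if_pos (by omega)]
  · rw [lay_bg (.inr (by omega)), hR'.backg_mark]
  -- return to the blocks
  refine .seq (exec_fromMark (p := N - 2 * l) _ _ hfl hV (by omega) (by omega)
    (by omega) (fun x hx hx' => hR'.backg_eq hx hx')) ?_
  have := exec_upd (N := N) (O := O)
    (fun s : Store A => { s with a := match op s.a with | .app _ a => a | _ => s.a })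
    (.mk' c.a b) ⟨lay pre V G (backg N pre l (y ++ [b'])), pre + 1, y ++ [b']⟩
  have e1 : c.step V O op = ⟨a', c.cont, c.pos, y ++ [b'], l⟩ := by
    simp only [Conf.step, hop]; rfl
  have e2 : (match op (Store.mk' c.a b).a with
      | .app _ a => a
      | _ => (Store.mk' c.a b).a) = a' := by
    rw [show (Store.mk' c.a b).a = c.a from rfl, hop]
  rw [e1]
  rw [e2] at this
  exact this

end

/-! ### Queries of the virtual machine -/

section

open Prog

variable {A : Type} {N : ℕ} {O : Oracle}

/-- Is this the left end marker? -/
def isLeftEnd : Cell → Bool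
  | .leftEnd => true
  | _ => false

/-- Is this the right end marker? -/
def isRightEnd : Cell → Bool
  | .rightEnd => true
  | _ => false

theorem look_succ_ne_left (tp : ℕ → Bool) (i : ℕ) : isLeftEnd (look N tp (i + 1)) = false := by
  simp only [look]; split <;> rfl

theorem isRightEnd_look (tp : ℕ → Bool) {i : ℕ} (hi : i ≤ N) :
    isRightEnd (look N tp i) = false := by
  cases i with
  | zero => rfl
  | succ i => simp [look, Nat.lt_of_succ_le hi, isRightEnd]

theorem isRightEnd_look_end (tp : ℕ → Bool) : isRightEnd (look N tp (N + 1)) = true := by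
  simp [look, isRightEnd]

/-- Ask the pending query and erase it and its specification. While the query is being asked, the
additional mark in the specification is absent. -/
def askProg (op : A → Op A) : Prog (Store A) :=
  .seq toMark (.seq (write fun _ => false)
    (.seq (.ask fun s r => { s with a := match op s.a with | .ask k => k r | _ => s.a })
    (.seq (write fun _ => true) (.seq (moves .right 1) (.seq (scan isRightEnd (some false) .right)
    (.seq (moves .left 1) (.seq (scan isOne none .left) (.seq fromMark (.seq (moves .left 1)
    (.seq (scan isLeftEnd (some false) .left) (.seq (moves .right 2) (.seq (write fun _ => true)
    (.seq (moves .right 1) (.seq (scan isOne none .right) clear))))))))))))))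

/-- The query can be asked if the number of digits in its specification is the one that the length
of the tape requires. -/
theorem exec_ask {op : A → Op A} {pre V : ℕ} (c : Conf A) (T : ℕ → Bool) (b : Bool)
    (hR : Room N pre V c.l c.y) (hl : c.l = Nat.clog 2 N) {k} (hop : op c.a = .ask k) :
    Exec N O (askProg op) (.mk' c.a b) (c.env N pre V T)
      (.mk' (c.step V O op).a b) ((c.step V O op).env N pre V T) := by
  have hN := hR.right
  have h2 := hR.two_le
  have hV := hR.pos
  have hyl := hR.left
  set y := c.y with hy
  set l := c.l with hl0
  set bg := backg N pre l y with hbg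
  simp only [Conf.env, ← hy, ← hl0, ← hbg]
  set G := c.blocks V T with hG
  have hfl : Flags V G := c.flags V T
  refine .seq (exec_toMark (p := N - 2 * l) (q := N - l - 1) _ _ hfl hV (by omega) (by omega)
    (by omega) (fun x hx hx' => hR.backg_eq hx hx') hR.backg_mark) ?_
  refine .seq (exec_write _ _ _ _ (by omega)) ?_
  rw [update_lay _ (.inr (by omega))]
  -- without the additional mark, the tape specifies the pending query
  set bg1 := Function.update bg (N - l - 1) false with hbg1
  have hbg1' : ∀ x, x ≠ N - l - 1 → lay pre V G bg1 x = lay pre V G bg x := by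
    intro x hx
    simp only [lay, hbg1]
    rw [Function.update_of_ne hx]
  refine .seq (Exec.ask _ _ _ ?_) ?_
  · refine queryWord_eq hl (by omega) (by omega) hR.len (by dsimp only; omega) (fun i hi => ?_)
      (fun i hi => ?_)
      (fun i hi => ?_)
    · dsimp only
      by_cases hi' : N - 2 * l + i = N - l - 1
      · rw [lay_bg (.inr (by omega)), hbg1, hi', Function.update_self, decide_eq_false]
        omega
      · rw [hbg1' _ hi', lay_bg (.inr (by omega)), hbg, hR.backg_eq (by omega) (by omega)]
        exact decide_eq_decide.2 (by omega)
    · dsimp only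
      rw [hbg1' _ (by omega), lay_bg (.inr (by omega)), hbg, hR.backg_digit]
    · have hi' : i < y.length := hi
      dsimp only
      rw [hbg1' _ (by omega), lay_bg (.inl (by omega)), hbg, backg, if_pos (by omega), add_comm 1 i]
      simp only [rawBit]
      rw [List.getElem?_append_left hi', List.getElem?_eq_getElem hi']
      rfl
  have hk : (match op (Store.mk' c.a b).a with
      | .ask k => k (O y) | _ => (Store.mk' c.a b).a) = k (O y) := by
    rw [show (Store.mk' c.a b).a = c.a from rfl, hop]
  dsimp only
  rw [show (Store.mk' (Store.mk' c.a b).a (Store.mk' c.a b).saved) = Store.mk' c.a b from rfl, hk]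
  refine .seq (exec_write _ _ _ _ (by omega)) ?_
  rw [update_lay _ (.inr (by omega))]
  -- the mark is restored
  have hbg2 : Function.update bg1 (N - l - 1) true = bg := by
    rw [hbg1, Function.update_idem, ← hR.backg_mark, Function.update_eq_self]
  rw [hbg2]
  refine .seq (exec_right (h' := N - l + 1) _ _ _ (by omega) (by omega)) ?_
  refine .seq (exec_scan_right (h' := N + 1) _ _ _ (by omega) le_rfl
    (fun i hi hi' => isRightEnd_look _ (by omega)) (isRightEnd_look_end _) rfl) ?_
  rw [fill_lay _ (.inr (by omega))]
  -- the length of the query is erased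
  set bg3 := fill (some false) bg (N - l + 1) (N + 1) with hbg3
  have h3 : ∀ x, x < N - l → bg3 x = bg x := by
    intro x hx; rw [hbg3, fill, if_neg (by omega)]
  refine .seq (exec_left (h' := N - 1 + 1) _ _ _ (by omega)) ?_
  refine .seq (exec_find_left (x' := N - l - 1) _ _ _ (by omega) (by omega)
    (fun i hi hi' => ?_) ?_) ?_
  · rw [lay_bg (.inr (by omega)), hbg3, fill, if_pos (by omega)]; rfl
  · rw [lay_bg (.inr (by omega)), h3 _ (by omega)]; exact hR.backg_mark
  refine .seq (exec_fromMark (p := N - 2 * l) _ _ hfl hV (by omega) (by omega)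
    (by omega) (fun x hx hx' => ?_)) ?_
  · rw [h3 _ (by omega)]; exact hR.backg_eq hx hx'
  refine .seq (exec_left (h' := pre) _ _ _ (by omega)) ?_
  refine .seq (exec_scan_left (h' := 0) _ _ _ (by omega) (by omega)
    (fun i hi hi' => ?_) rfl rfl) ?_
  · obtain ⟨i, rfl⟩ := Nat.exists_eq_add_of_le' hi; exact look_succ_ne_left _ _
  rw [fill_lay _ (.inl (by omega))]
  refine .seq (exec_right (h' := 1 + 1) _ _ _ (by omega) (by omega)) ?_
  refine .seq (exec_write _ _ _ _ (by omega)) ?_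
  rw [update_lay _ (.inl (by omega))]
  -- the query is erased, up to a final 1 in cell 1
  set bg4 := Function.update (fill (some false) bg3 (0 + 1) (pre + 1)) 1 true with hbg4
  have hfin : bg4 = backg N pre l [] := by
    funext x
    rw [hbg4, Function.update_apply, fill, backg]
    by_cases hx : x < pre
    · rw [if_pos hx]
      by_cases h1 : x = 1
      · subst h1; simp [rawBit]
      · rw [if_neg h1]
        rcases x with _ | _ | x
        · rw [if_pos (by omega)]; rfl
        · exact absurd rfl h1
        · rw [if_pos (by omega)]; simp [rawBit]
    · rw [if_neg hx, if_neg (by omega), if_neg (by omega), hbg3, fill]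
      by_cases hx' : N - l ≤ x
      · rw [specBit, decide_eq_false (by omega : ¬ x + 2 * l = N),
          decide_eq_false (by omega : ¬ x + l + 1 = N)]
        simp only [List.length_nil, Nat.zero_testBit, Bool.and_false, Bool.or_false]
        by_cases hxN : x < N
        · rw [if_pos (by omega)]; rfl
        · rw [if_neg (by omega)]
          obtain ⟨i, rfl⟩ := Nat.exists_eq_add_of_le hx'
          rw [hbg, hR.backg_digit]
          exact Nat.testBit_lt_two_pow (hR.len.trans_le
            (Nat.pow_le_pow_right (by omega) (by omega)))
      · rw [if_neg (by omega), hbg, backg, if_neg hx, specBit, specBit,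
          decide_eq_false (by omega : ¬ N ≤ x + l)]
        simp
  rw [hfin]
  refine .seq (exec_right (h' := 2 + 1) _ _ _ (by omega) (by omega)) ?_
  refine .seq (exec_find_right (x' := pre) _ _ _ (by omega) (by omega)
    (fun i hi hi' => ?_) ?_) ?_
  · rw [lay_bg (.inl (by omega)), backg, if_pos (by omega), rawBit_gt _ (by simp; omega)]
  · have := lay_cell (pre := pre) (G := G) (bg := backg N pre l []) (i := 0) (k := 0) hV (by omega)
    simp only [Nat.mul_zero, Nat.add_zero] at this
    rw [this, show fldAt 0 = .first from rfl, (hfl 0).1]; rfl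
  have e1 : c.step V O op = ⟨k (O y), c.cont, c.pos, [], l⟩ := by
    simp only [Conf.step, hop]; rfl
  rw [e1]
  exact exec_clear _ _

/-- Lengthen the specification by a digit, for the empty query: the two ones move to the left by two
cells and by one cell. -/
def growProg (op : A → Op A) : Prog (Store A) :=
  .seq (walk (fun _ b => b .last) .right) (.seq (moves .right 18) (.seq (scan isOne none .right)
    (.seq (write fun _ => false) (.seq (moves .left 2) (.seq (write fun _ => true)
    (.seq (moves .right 1) (.seq (scan isOne none .right) (.seq (write fun _ => false)
    (.seq (moves .left 1) (.seq (write fun _ => true) (.seq fromMark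
    (upd fun s => { s with a := match op s.a with | .grow a => a | _ => s.a }))))))))))))

theorem exec_grow {op : A → Op A} {pre V : ℕ} (c : Conf A) (T : ℕ → Bool) (b : Bool)
    (hR : Room N pre V c.l c.y) (hl : pre + 18 * V + 2 * (c.l + 1) ≤ N) (hy0 : c.y = []) {a'}
    (hop : op c.a = .grow a') :
    Exec N O (growProg op) (.mk' c.a b) (c.env N pre V T)
      (.mk' (c.step V O op).a b) ((c.step V O op).env N pre V T) := by
  have hN := hR.right
  have h2 := hR.two_le
  have hV := hR.pos
  have hyl := hR.left
  rw [hy0] at hR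
  set l := c.l with hl0
  set bg := backg N pre l [] with hbg
  simp only [Conf.env, hy0, ← hl0, ← hbg]
  set G := c.blocks V T with hG
  have hfl : Flags V G := c.flags V T
  refine .seq (exec_walk_right (i := 0) (i' := V - 1) _ _ (by omega) (by omega) (by omega)
    (fun k _ hk => by simp [(hfl k).2]; omega) (by simp [(hfl _).2]; omega)) ?_
  refine .seq (exec_right (h' := pre + 18 * V + 1) _ _ _ (by omega) (by omega)) ?_
  refine .seq (exec_find_right (x' := N - 2 * l) _ _ _ (by omega) (by omega)
    (fun i hi hi' => ?_) ?_) ?_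
  · rw [lay_bg (.inr hi), hbg, hR.backg_eq hi (by omega)]; simp; omega
  · rw [lay_bg (.inr (by omega)), hbg, hR.backg_eq (by omega) (by omega)]; simp
  refine .seq (exec_write _ _ _ _ (by omega)) ?_
  rw [update_lay _ (.inr (by omega))]
  refine .seq (exec_left (h' := N - 2 * l - 2 + 1) _ _ _ (by omega)) ?_
  refine .seq (exec_write _ _ _ _ (by omega)) ?_
  rw [update_lay _ (.inr (by omega))]
  refine .seq (exec_right (h' := N - 2 * l - 1 + 1) _ _ _ (by omega) (by omega)) ?_
  refine .seq (exec_find_right (x' := N - l - 1) _ _ _ (by omega) (by omega)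
    (fun i hi hi' => ?_) ?_) ?_
  · rw [lay_bg (.inr (by omega)), Function.update_of_ne (by omega), Function.update_apply]
    split_ifs
    · rfl
    · rw [hbg, hR.backg_eq (by omega) (by omega)]; simp; omega
  · rw [lay_bg (.inr (by omega)), Function.update_of_ne (by omega),
      Function.update_of_ne (by omega)]
    exact hR.backg_mark
  refine .seq (exec_write _ _ _ _ (by omega)) ?_
  rw [update_lay _ (.inr (by omega))]
  refine .seq (exec_left (h' := N - l - 2 + 1) _ _ _ (by omega)) ?_
  refine .seq (exec_write _ _ _ _ (by omega)) ?_
  rw [update_lay _ (.inr (by omega))]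
  have hfin : Function.update (Function.update
    (Function.update (Function.update bg (N - 2 * l) false)
      (N - 2 * l - 2) true) (N - l - 1) false) (N - l - 2) true = backg N pre (l + 1) [] := by
    funext x
    simp only [Function.update_apply, hbg, backg, specBit, List.length_nil, Nat.zero_testBit,
      Bool.and_false, Bool.or_false]
    by_cases hx : x < pre
    · rw [if_neg (by omega), if_neg (by omega), if_neg (by omega), if_neg (by omega), if_pos hx,
        if_pos hx]
    · rw [if_neg hx, if_neg hx, ← Bool.decide_or, ← Bool.decide_or]
      split_ifs <;> first
        | exact (decide_eq_true (by omega)).symm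
        | exact (decide_eq_false (by omega)).symm
        | exact decide_eq_decide.2 (by omega)
  have hR' : Room N pre V (l + 1) [] := ⟨hV, by omega, by omega, by simp; omega, by simp⟩
  rw [hfin]
  refine .seq (exec_fromMark (p := N - 2 * (l + 1)) _ _ hfl hV (by omega) (by omega)
    (by omega) (fun x hx hx' => hR'.backg_eq hx (by omega))) ?_
  have := exec_upd (N := N) (O := O)
    (fun s : Store A => { s with a := match op s.a with | .grow a => a | _ => s.a })
    (.mk' c.a b) ⟨lay pre V G (backg N pre (l + 1) []), pre + 1, []⟩
  have e1 : c.step V O op = ⟨a', c.cont, c.pos, [], l + 1⟩ := by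
    simp only [Conf.step, hop, hy0]; rfl
  have e2 : (match op (Store.mk' c.a b).a with | .grow a => a | _ => (Store.mk' c.a b).a) = a' := by
    rw [show (Store.mk' c.a b).a = c.a from rfl, hop]
  rw [e1]
  rw [e2] at this
  exact this

/-- One step of a machine with five virtual tapes. -/
def microProg (op : A → Op A) : Prog (Store A) :=
  .ite (fun s => match op s.a with | .tape _ _ => true | _ => false) (accessProg op)
    (.ite (fun s => match op s.a with | .app _ _ => true | _ => false) (appProg op)
    (.ite (fun s => match op s.a with | .ask _ => true | _ => false) (askProg op) (growProg op)))

/-- The conditions under which a step can be carried out. -/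
structure Conf.Ready (N pre V : ℕ) (op : A → Op A) (c : Conf A) : Prop where
  room : Room N pre V c.l c.y
  pos : ∀ j, c.pos j < V
  app : ∀ b a, op c.a = .app b a → c.y.length + 3 ≤ pre ∧ c.y.length + 1 < 2 ^ c.l
  ask : ∀ k, op c.a = .ask k → c.l = Nat.clog 2 N
  grow : ∀ a, op c.a = .grow a → pre + 18 * V + 2 * (c.l + 1) ≤ N ∧ c.y = []

/-- Every step of a machine with five virtual tapes can be carried out on the tape. -/
theorem exec_micro {op : A → Op A} {pre V : ℕ} (c : Conf A) (T : ℕ → Bool) (b : Bool)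
    (hc : c.Ready N pre V op) :
    Exec N O (microProg op) (.mk' c.a b) (c.env N pre V T)
      (.mk' (c.step V O op).a b) ((c.step V O op).env N pre V T) := by
  have hN := hc.room.right
  have ha : (Store.mk' c.a b).a = c.a := rfl
  cases h : op c.a with
  | tape j f => exact .iteT (by rw [ha, h]) (exec_access c T b (by omega) hc.pos h)
  | app b' a => exact .iteF (by rw [ha, h]) (.iteT (by rw [ha, h])
      (exec_app c T b hc.room (hc.app _ _ h).1 (hc.app _ _ h).2 h))
  | ask k => exact .iteF (by rw [ha, h]) (.iteF (by rw [ha, h]) (.iteT (by rw [ha, h])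
      (exec_ask c T b hc.room (hc.ask _ h) h)))
  | grow a => exact .iteF (by rw [ha, h]) (.iteF (by rw [ha, h]) (.iteF (by rw [ha, h])
      (exec_grow c T b hc.room (hc.grow _ h).1 (hc.grow _ h).2 h)))

end

/-! ### The clock -/

section

open Prog

variable {A : Type} {N : ℕ} {O : Oracle}

/-- One step of the carry in the clock, whose digits are spread over the blocks; when the last digit
overflows, the state becomes `ovf`. -/
def carry (ovf : A → A) (s : Store A) : Store A :=
  if s.buf .clock then
    if s.buf .last then
      { s with a := ovf s.a, buf := Function.update s.buf .clock false, fl := true, dir := .stay }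
    else { s with buf := Function.update s.buf .clock false, fl := false, dir := .right }
  else { s with buf := Function.update s.buf .clock true, fl := true, dir := .stay }

/-- Increment the clock. -/
def tick (ovf : A → A) : Prog (Store A) :=
  .seq (upd fun s => { s with fl := false })
    (.seq (.loop (fun s => !s.fl) (visit (carry ovf))) home)

theorem Conf.update_clock (V : ℕ) (c : Conf A) (T : ℕ → Bool) (i : ℕ) (b : Bool) :
    Function.update (c.blocks V T) i (Function.update (c.blocks V T i) .clock b) =
      c.blocks V (Function.update T i b) := by
  funext k F
  by_cases hk : k = i
  · subst hk
    rw [Function.update_self]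
    cases F <;> simp [Conf.blocks]
  · rw [Function.update_of_ne hk]
    cases F <;> simp [Conf.blocks, hk]

/-- A carry that runs from digit `i` to digit `t`, where it meets a 0 or the end of the clock. -/
theorem exec_carry {ovf : A → A} {pre V : ℕ} (c : Conf A) (T : ℕ → Bool) {i t : ℕ} (bg : ℕ → Bool)
    (y : List Bool) (hN : pre + 18 * V ≤ N) (hi : i ≤ t) (ht : t < V)
    (hT : ∀ k, i ≤ k → k < t → T k = true) (hTt : T t = false ∨ t + 1 = V) (s : Store A)
    (hs : s.fl = false) :
    ∃ s' : Store A, s'.a = (if T t then ovf s.a else s.a) ∧ s'.saved = s.saved ∧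
      Exec N O (.loop (fun s => !s.fl) (visit (carry ovf))) s
        ⟨lay pre V (c.blocks V T) bg, pre + 18 * i + 1, y⟩ s'
        ⟨lay pre V (c.blocks V fun k =>
          if i ≤ k ∧ k < t then false else if k = t then !(T t) else T k) bg,
          pre + 18 * t + 1, y⟩ := by
  obtain ⟨d, rfl⟩ := Nat.exists_eq_add_of_le hi
  induction d generalizing i s T with
  | zero =>
    have hf : (fun k => if i ≤ k ∧ k < i + 0 then false else if k = i + 0 then !(T (i + 0))
      else T k)
        = Function.update T i (!(T i)) := by
      funext k; rw [if_neg (by omega), Function.update_apply]; rfl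
    rw [hf, ← Conf.update_clock]
    simp only [Nat.add_zero] at hTt ⊢ ht
    cases hTi : T i with
    | true =>
      have hl : i + 1 = V := by simpa [hTi] using hTt
      refine ⟨{ s with
        a := ovf s.a, buf := Function.update (c.blocks V T i) .clock false, fl := true,
        dir := .stay },
        by simp, rfl, .loopT (by simp [hs]) (exec_visit _ _ _ ht hN ?_ (by simp) rfl) (.loopF rfl)⟩
      simp [carry, Conf.blocks, hTi, hl]
    | false =>
      refine ⟨{ s with
        buf := Function.update (c.blocks V T i) .clock true, fl := true, dir := .stay },
        by simp, rfl, .loopT (by simp [hs]) (exec_visit _ _ _ ht hN ?_ (by simp) rfl) (.loopF rfl)⟩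
      simp [carry, Conf.blocks, hTi]
  | succ d ih =>
    have hTi := hT i le_rfl (by omega)
    obtain ⟨s', h1, h2, h3⟩ := ih (Function.update T i false) (i := i + 1)
      { s with
        buf := Function.update (c.blocks V T i) .clock false, fl := false, dir := .right } rfl
      (by omega) (by omega)
      (fun k hk hk' => by rw [Function.update_of_ne (by omega)]; exact hT k (by omega) (by omega))
      (by
        rw [Function.update_of_ne (by omega), show i + 1 + d = i + (d + 1) by omega]; exact hTt)
    have e : i + 1 + d = i + (d + 1) := by omega
    rw [e] at h1 h3
    rw [Function.update_of_ne (by omega)] at h1 h3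
    refine ⟨s', h1, h2, .loopT (by simp [hs]) (exec_visit _ _ _ (by omega) hN (s' := { s with
      buf := Function.update (c.blocks V T i) .clock false, fl := false, dir := .right })
      ?_ (by simp) rfl) ?_⟩
    · simp [carry, Conf.blocks, hTi]; omega
    · rw [Conf.update_clock]
      have hf : (fun k => if i ≤ k ∧ k < i + (d + 1) then false else
          if k = i + (d + 1) then !(T (i + (d + 1))) else T k) = fun k =>
          if i + 1 ≤ k ∧ k < i + (d + 1) then false else
            if k = i + (d + 1) then !(T (i + (d + 1))) else Function.update T i false k := by
        funext k
        by_cases hk : k = i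
        · subst hk; simp
        · rw [Function.update_of_ne hk]
          split_ifs <;> first | rfl | omega
      rw [hf]
      exact h3

/-- The configuration with another state. -/
def Conf.setState (c : Conf A) (a : A) : Conf A := { c with a := a }

theorem exec_tick {ovf : A → A} {pre V : ℕ} (c : Conf A) (k : ℕ) (b : Bool)
    (hN : pre + 18 * V ≤ N) (hk : k + 1 < 2 ^ V) :
    Exec N O (tick ovf) (.mk' c.a b) (c.env N pre V k.testBit) (.mk' c.a b)
      (c.env N pre V (k + 1).testBit) := by
  obtain ⟨t, ht1, ht2, ht3⟩ := testBit_succ_spec k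
  have htl : t < V := by
    by_contra h
    have h1 : (k + 1).testBit t = true := by rw [ht3]; simp
    have h2 : k + 1 < 2 ^ t := hk.trans_le (Nat.pow_le_pow_right (by omega) (by omega))
    rw [Nat.testBit_lt_two_pow h2] at h1; cases h1
  obtain ⟨s', h1, h2, h3⟩ := exec_carry (N := N) (O := O) (ovf := ovf) (pre := pre) c k.testBit
    (i := 0)
    (backg N pre c.l c.y) c.y hN (Nat.zero_le _) htl (fun i _ hi => ht1 i hi) (.inl ht2)
    { Store.mk' c.a b with fl := false } rfl
  refine .seq (exec_upd _ _ _) (.seq h3 ?_)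
  have : (fun i => if 0 ≤ i ∧ i < t then false else if i = t then !(k.testBit t) else k.testBit i) =
      (k + 1).testBit := by
    funext i
    rw [ht3, ht2]
    simp
  rw [this]
  have := exec_home (N := N) (O := O) (bg := backg N pre c.l c.y) s' c.y
    (c.flags V (k + 1).testBit) hN htl
  rw [h1, h2, ht2] at this
  exact this

theorem exec_tick_over {ovf : A → A} {pre V : ℕ} (c : Conf A) (k : ℕ) (b : Bool)
    (hN : pre + 18 * V ≤ N) (hV : 0 < V) (hk : k + 1 = 2 ^ V) :
    Exec N O (tick ovf) (.mk' c.a b) (c.env N pre V k.testBit) (.mk' (ovf c.a) b)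
      ((c.setState (ovf c.a)).env N pre V fun _ => false) := by
  -- all digits of `2 ^ V - 1` are 1, so the carry runs through the whole clock
  have hbit : ∀ i, k.testBit i = decide (i < V) := by
    intro i
    rw [show k = 2 ^ V - 1 by omega, Nat.testBit_two_pow_sub_one]
  obtain ⟨s', h1, h2, h3⟩ := exec_carry (N := N) (O := O) (ovf := ovf) (pre := pre) c k.testBit
    (i := 0)
    (t := V - 1) (backg N pre c.l c.y) c.y hN (Nat.zero_le _) (by omega)
    (fun i _ hi => by rw [hbit]; simp; omega) (.inr (by omega))
    { Store.mk' c.a b with fl := false } rfl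
  refine .seq (exec_upd _ _ _) (.seq h3 ?_)
  have : (fun i => if 0 ≤ i ∧ i < V - 1 then false else
      if i = V - 1 then !(k.testBit (V - 1)) else k.testBit i) = fun _ => false := by
    funext i
    simp only [hbit]
    split_ifs
    · rfl
    · simp; omega
    · simp; omega
  rw [this]
  have := exec_home (N := N) (O := O) (bg := backg N pre c.l c.y) s' c.y
    (c.flags V fun _ => false) hN (by omega : V - 1 < V)
  rw [h1, h2, hbit, decide_eq_true (by omega : V - 1 < V), if_pos rfl] at this
  exact this

/-- Run a machine until it is done, without a clock. -/
def runProg (op : A → Op A) (done : A → Bool) : Prog (Store A) :=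
  .loop (fun s => !done s.a) (microProg op)

/-- Run a machine until it is done or the clock overflows. -/
def clockedProg (op : A → Op A) (done : A → Bool) (ovf : A → A) : Prog (Store A) :=
  .loop (fun s => !done s.a) (.seq (tick ovf) (.ite (fun s => !done s.a) (microProg op) skip))

/-- A machine that is done after `n` steps can be run without a clock. -/
theorem exec_run {op : A → Op A} {done : A → Bool} {pre V : ℕ} (c : Conf A) (T : ℕ → Bool)
    (b : Bool) (n : ℕ)
    (h : ∀ k < n, ((Conf.step V O op)^[k] c).Ready N pre V op ∧
      done ((Conf.step V O op)^[k] c).a = false)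
    (hn : done ((Conf.step V O op)^[n] c).a = true) :
    Exec N O (runProg op done) (.mk' c.a b) (c.env N pre V T)
      (.mk' ((Conf.step V O op)^[n] c).a b) (((Conf.step V O op)^[n] c).env N pre V T) := by
  induction n generalizing c with
  | zero => exact .loopF (by simpa [Store.mk'] using hn)
  | succ n ih =>
    have h0 := h 0 (by omega)
    simp only [Function.iterate_zero, id] at h0
    refine .loopT (by simp [Store.mk', h0.2]) (exec_micro c T b h0.1) ?_
    exact ih (c.step V O op) (fun k hk => h (k + 1) (by omega)) hn

/-- The configuration in which a machine stops if the clock admits `n` more steps. When the clock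
overflows before the machine is done, its state is changed by `ovf`. -/
def Conf.clocked (V : ℕ) (O : Oracle) (op : A → Op A) (done : A → Bool) (ovf : A → A) :
    ℕ → Conf A → Conf A
  | 0, c => if done c.a then c else c.setState (ovf c.a)
  | n + 1, c => if done c.a then c else (c.step V O op).clocked V O op done ovf n

/-- A clocked machine always halts, whether or not the machine itself does. -/
theorem exec_clocked {op : A → Op A} {done : A → Bool} {ovf : A → A} {pre V : ℕ}
    (I : Conf A → Prop) (hI : ∀ c, I c → done c.a = false → c.Ready N pre V op ∧ I (c.step V O op))
    (hovf : ∀ a, done (ovf a) = true) (hN : pre + 18 * V ≤ N) (hV : 0 < V) (b : Bool)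
    (n : ℕ) (c : Conf A) (hc : I c) {k : ℕ} (hk : k + 1 + n = 2 ^ V) :
    ∃ T, Exec N O (clockedProg op done ovf) (.mk' c.a b) (c.env N pre V k.testBit)
      (.mk' (c.clocked V O op done ovf n).a b)
      ((c.clocked V O op done ovf n).env N pre V T) := by
  induction n generalizing c k with
  | zero =>
    cases hd : done c.a with
    | true =>
      rw [Conf.clocked, if_pos hd]
      exact ⟨_, .loopF (by simp [Store.mk', hd])⟩
    | false =>
      rw [Conf.clocked, if_neg (by simp [hd])]
      exact ⟨_, .loopT (by simp [Store.mk', hd]) (.seq (exec_tick_over c k b hN hV hk)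
        (.iteF (by simp [Store.mk', hovf]) (exec_skip _ _)))
        (.loopF (by simp [Store.mk', hovf]))⟩
  | succ n ih =>
    cases hd : done c.a with
    | true =>
      rw [Conf.clocked, if_pos hd]
      exact ⟨_, .loopF (by simp [Store.mk', hd])⟩
    | false =>
      rw [Conf.clocked, if_neg (by simp [hd])]
      obtain ⟨h1, h2⟩ := hI c hc hd
      obtain ⟨T, hT⟩ := ih _ h2 (k := k + 1) (by omega)
      exact ⟨T, .loopT (by simp [Store.mk', hd]) (.seq (exec_tick c k b hN (by omega))
        (.iteT (by simp [Store.mk', hd]) (exec_micro c _ b h1))) hT⟩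

/-- If the machine is done before the clock overflows, then the clock does not matter. -/
theorem Conf.clocked_eq {V : ℕ} {op : A → Op A} {done : A → Bool} {ovf : A → A} {n m : ℕ}
    (hm : m ≤ n)
    {c : Conf A} (hd : done ((Conf.step V O op)^[m] c).a = true)
    (h : ∀ k < m, done ((Conf.step V O op)^[k] c).a = false) :
    c.clocked V O op done ovf n = (Conf.step V O op)^[m] c := by
  induction m generalizing n c with
  | zero =>
    simp only [Function.iterate_zero, id] at hd ⊢
    cases n <;> simp [Conf.clocked, hd]
  | succ m ih =>
    obtain ⟨n, rfl⟩ := Nat.exists_eq_add_of_le' (by omega : 1 ≤ n)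
    have h0 := h 0 (by omega)
    simp only [Function.iterate_zero, id] at h0
    rw [Conf.clocked, if_neg (by simp [h0]), Function.iterate_succ_apply]
    exact ih (by omega) hd (fun k hk => h (k + 1) (by omega))

end

/-! ### Preparing the tape -/

section

open Prog

variable {A : Type} {N : ℕ} {O : Oracle}

/-- The tape with ones in the cells `a`, `b`, `c`. -/
def ones (a b c : ℕ) : ℕ → Bool := fun x => decide (x = a ∨ x = b ∨ x = c)

/-- On a blank tape, write ones in the cells 4, 22 and 64, unless the tape has at most 64 cells,
which the flag then says. -/
def startProg : Prog (Store A) :=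
  .seq (moves .right 65) (.seq (test isRightEnd) (.ite (fun s => s.fl) skip
    (.seq (write fun _ => true) (.seq (moves .left 42) (.seq (write fun _ => true)
    (.seq (moves .left 18) (.seq (write fun _ => true) (.seq (scan isLeftEnd none .left)
    (upd fun s => { s with fl := false })))))))))

/-- Move the ones from the cells `4 j, 22 j, 64 j` to the cells `4 (j + 1), 22 (j + 1), 64 (j + 1)`,
unless the tape is too short, which the flag then says. Repeated, this divides the tape in the
proportion 4 : 18 : 42. -/
def spreadProg : Prog (Store A) :=
  .seq (moves .right 1) (.seq (scan isOne none .right) (.seq (moves .right 1)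
  (.seq (scan isOne none .right) (.seq (moves .right 1) (.seq (scan isOne none .right)
  (.seq (moves .right 64) (.seq (test isRightEnd) (.ite (fun s => s.fl) skip
    (.seq (write fun _ => true) (.seq (moves .left 64) (.seq (write fun _ => false)
    (.seq (scan isOne none .left) (.seq (write fun _ => false) (.seq (moves .right 22)
    (.seq (write fun _ => true) (.seq (moves .left 1) (.seq (scan isOne none .left)
    (.seq (write fun _ => false) (.seq (moves .right 4) (.seq (write fun _ => true)
    (.seq (scan isLeftEnd none .left) (upd fun s => { s with fl := false }))))))))))))))))))))))

/-- Turn ones in the cells `4 V, 22 V, 64 V` into `V` empty blocks that start at cell `4 V`, an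
empty query, and a specification with 6 digits. The one in cell `4 V` becomes the flag of the first
block, that in cell `22 V` moves left to become the flag of the last block. -/
def formatProg : Prog (Store A) :=
  .seq (moves .left 1) (.seq (scan isOne none .left) (.seq (write fun _ => false)
  (.seq (scan isRightEnd none .right) (.seq (moves .left 7) (.seq (write fun _ => true)
  (.seq (moves .left 5) (.seq (write fun _ => true) (.seq (moves .left 1)
  (.seq (scan isOne none .left) (.seq (write fun _ => false) (.seq (moves .left 1)
  (.seq (write fun _ => true) (.seq (moves .left 1) (.seq (scan isOne none .left)
  (.seq (scan isLeftEnd none .left) (.seq (moves .right 2) (.seq (write fun _ => true)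
  (.seq (moves .right 1) (.seq (scan isOne none .right)
  (.seq (visit fun s => { s with
    buf := fun F => match F with | .head _ => true | F => s.buf F
    dir := .stay }) clear))))))))))))))))))))

/-- Erase the tape. -/
def eraseProg : Prog (Store A) :=
  .seq (scan isRightEnd none .right) (.seq (moves .left 1) (scan isLeftEnd (some false) .left))

theorem exec_to_right_end (s : Store A) (tp : ℕ → Bool) {h : ℕ} (y : List Bool) (hh : h ≤ N + 1) :
    Exec N O (scan isRightEnd none .right) s ⟨tp, h, y⟩ { s with fl := true } ⟨tp, N + 1, y⟩ :=
  exec_scan_right none s y hh le_rfl (fun _ _ hi => isRightEnd_look _ (by omega))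
    (isRightEnd_look_end _) (fill_none _ _ _).symm

theorem exec_to_left_end (s : Store A) (tp : ℕ → Bool) {h : ℕ} (y : List Bool) (hh : h ≤ N) :
    Exec N O (scan isLeftEnd none .left) s ⟨tp, h, y⟩ { s with fl := true } ⟨tp, 0, y⟩ := by
  refine exec_scan_left none s y (Nat.zero_le _) hh (fun i hi _ => ?_) rfl (fill_none _ _ _).symm
  obtain ⟨i, rfl⟩ := Nat.exists_eq_add_of_le' hi; exact look_succ_ne_left _ _

theorem exec_erase (s : Store A) (tp : ℕ → Bool) {h : ℕ} (y : List Bool) (hh : h ≤ N + 1) :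
    ∃ tp', (∀ x < N, tp' x = false) ∧
      Exec N O eraseProg s ⟨tp, h, y⟩ { s with fl := true } ⟨tp', 0, y⟩ := by
  refine ⟨_, fun x hx => ?_, .seq (exec_to_right_end _ _ _ hh)
    (.seq (exec_left (h' := N) _ _ _ (by omega)) (exec_scan_left (h' := 0) (some false) _ _
      (Nat.zero_le _) le_rfl (fun i hi _ => ?_) rfl rfl))⟩
  · rw [fill, if_pos (by omega)]; rfl
  · obtain ⟨i, rfl⟩ := Nat.exists_eq_add_of_le' hi; exact look_succ_ne_left _ _

theorem exec_start_short (s : Store A) (hN : N ≤ 64) :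
    Exec N O startProg s ⟨fun _ => false, 0, []⟩ { s with fl := true }
      ⟨fun _ => false, N + 1, []⟩ := by
  have h1 := exec_moves_right (N := N) (O := O) 65 s (fun _ => false) 0 [] (by omega)
  rw [show min (0 + 65) (N + 1) = N + 1 by omega] at h1
  have h2 := exec_test (N := N) (O := O) isRightEnd s ⟨fun _ => false, N + 1, []⟩
  simp only [isRightEnd_look_end] at h2
  exact .seq h1 (.seq h2 (.iteT rfl (exec_skip _ _)))

theorem exec_start (s : Store A) (hN : 64 < N) :
    Exec N O startProg s ⟨fun _ => false, 0, []⟩ { s with fl := false } ⟨ones 4 22 64, 0, []⟩ := by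
  have h2 := exec_test (N := N) (O := O) isRightEnd s ⟨fun _ => false, 64 + 1, []⟩
  simp only [isRightEnd_look _ (show 64 + 1 ≤ N by omega)] at h2
  refine .seq (exec_right (h' := 64 + 1) _ _ _ (by omega) (by omega)) (.seq h2 (.iteF rfl ?_))
  refine .seq (exec_write _ _ _ _ (by omega)) (.seq (exec_left (h' := 22 + 1) _ _ _ (by omega)) ?_)
  refine .seq (exec_write _ _ _ _ (by omega)) (.seq (exec_left (h' := 4 + 1) _ _ _ (by omega)) ?_)
  refine .seq (exec_write _ _ _ _ (by omega)) (.seq (exec_to_left_end _ _ _ (by omega)) ?_)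
  have : Function.update (Function.update (Function.update (fun _ => false) 64 true) 22 true) 4 true
      = ones 4 22 64 := by
    funext x
    simp only [Function.update_apply, ones]
    split_ifs <;> simp [*]
  rw [this]
  exact exec_upd _ _ _

/-- Finding the one in cell `64 j`, which is the beginning of `spreadProg`. -/
theorem exec_spread_find (s : Store A) {j : ℕ} (hj : 0 < j) (hN : 64 * j < N) {s' : Store A}
    {e' : Env} {p : Prog (Store A)}
    (h : Exec N O p { s with fl := true } ⟨ones (4 * j) (22 * j) (64 * j), 64 * j + 1, []⟩ s' e') :
    Exec N O (.seq (moves .right 1) (.seq (scan isOne none .right) (.seq (moves .right 1)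
      (.seq (scan isOne none .right) (.seq (moves .right 1) (.seq (scan isOne none .right) p)))))) s
      ⟨ones (4 * j) (22 * j) (64 * j), 0, []⟩ s' e' := by
  refine .seq (exec_right (h' := 0 + 1) _ _ _ (by omega) (by omega)) ?_
  refine .seq (exec_find_right (x' := 4 * j) _ _ _ (by omega) (by omega)
    (fun i hi hi' => by simp [ones]; omega) (by simp [ones])) ?_
  refine .seq (exec_right (h' := 4 * j + 1 + 1) _ _ _ (by omega) (by omega)) ?_
  refine .seq (exec_find_right (x' := 22 * j) _ _ _ (by omega) (by omega)
    (fun i hi hi' => by simp [ones]; omega) (by simp [ones])) ?_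
  refine .seq (exec_right (h' := 22 * j + 1 + 1) _ _ _ (by omega) (by omega)) ?_
  exact .seq (exec_find_right (x' := 64 * j) _ _ _ (by omega) (by omega)
    (fun i hi hi' => by simp [ones]; omega) (by simp [ones])) h

theorem exec_spread_last (s : Store A) {j : ℕ} (hj : 0 < j) (hN : 64 * j < N)
    (hN' : N ≤ 64 * (j + 1)) :
    Exec N O spreadProg s ⟨ones (4 * j) (22 * j) (64 * j), 0, []⟩ { s with fl := true }
      ⟨ones (4 * j) (22 * j) (64 * j), N + 1, []⟩ := by
  refine exec_spread_find s hj hN ?_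
  have h1 := exec_moves_right (N := N) (O := O) 64 { s with fl := true }
    (ones (4 * j) (22 * j) (64 * j)) (64 * j + 1) [] (by omega)
  rw [show min (64 * j + 1 + 64) (N + 1) = N + 1 by omega] at h1
  have h2 := exec_test (N := N) (O := O) isRightEnd { s with fl := true }
    ⟨ones (4 * j) (22 * j) (64 * j), N + 1, []⟩
  simp only [isRightEnd_look_end] at h2
  exact .seq h1 (.seq h2 (.iteT rfl (exec_skip _ _)))

theorem exec_spread (s : Store A) {j : ℕ} (hj : 0 < j) (hN : 64 * (j + 1) < N) :
    Exec N O spreadProg s ⟨ones (4 * j) (22 * j) (64 * j), 0, []⟩ { s with fl := false }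
      ⟨ones (4 * (j + 1)) (22 * (j + 1)) (64 * (j + 1)), 0, []⟩ := by
  refine exec_spread_find s hj (by omega) ?_
  have h2 := exec_test (N := N) (O := O) isRightEnd { s with fl := true }
    ⟨ones (4 * j) (22 * j) (64 * j), 64 * (j + 1) + 1, []⟩
  simp only [isRightEnd_look _ (show 64 * (j + 1) + 1 ≤ N by omega)] at h2
  refine .seq (exec_right (h' := 64 * (j + 1) + 1) _ _ _ (by omega) (by omega))
    (.seq h2 (.iteF rfl ?_))
  refine .seq (exec_write _ _ _ _ (by omega)) ?_
  refine .seq (exec_left (h' := 64 * j + 1) _ _ _ (by omega)) ?_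
  refine .seq (exec_write _ _ _ _ (by omega)) ?_
  refine .seq (exec_find_left (x' := 22 * j) _ _ _ (by omega) (by omega)
    (fun i hi hi' => ?_) ?_) ?_
  · grind [ones, Function.update_apply]
  · grind [ones, Function.update_apply]
  refine .seq (exec_write _ _ _ _ (by omega)) ?_
  refine .seq (exec_right (h' := 22 * (j + 1) + 1) _ _ _ (by omega) (by omega)) ?_
  refine .seq (exec_write _ _ _ _ (by omega)) ?_
  refine .seq (exec_left (h' := 22 * j + 21 + 1) _ _ _ (by omega)) ?_
  refine .seq (exec_find_left (x' := 4 * j) _ _ _ (by omega) (by omega)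
    (fun i hi hi' => ?_) ?_) ?_
  · grind [ones, Function.update_apply]
  · grind [ones, Function.update_apply]
  refine .seq (exec_write _ _ _ _ (by omega)) ?_
  refine .seq (exec_right (h' := 4 * (j + 1) + 1) _ _ _ (by omega) (by omega)) ?_
  refine .seq (exec_write _ _ _ _ (by omega)) ?_
  refine .seq (exec_to_left_end _ _ _ (by omega)) ?_
  have : Function.update (Function.update (Function.update (Function.update (Function.update
      (Function.update (ones (4 * j) (22 * j) (64 * j)) (64 * (j + 1)) true) (64 * j) false)
      (22 * j) false) (22 * (j + 1)) true) (4 * j) false) (4 * (j + 1)) true =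
      ones (4 * (j + 1)) (22 * (j + 1)) (64 * (j + 1)) := by
    funext x
    grind [ones, Function.update_apply]
  rw [this]
  exact exec_upd _ _ _

/-- Repeat `spreadProg` as long as there is room. -/
def spreadLoop : Prog (Store A) := .loop (fun s => !s.fl) spreadProg

theorem exec_spreadLoop (s : Store A) (hs : s.fl = false) {j V : ℕ} (hj : 0 < j) (hjV : j ≤ V)
    (hN : 64 * V < N) (hN' : N ≤ 64 * (V + 1)) :
    Exec N O spreadLoop s ⟨ones (4 * j) (22 * j) (64 * j), 0, []⟩ { s with fl := true }
      ⟨ones (4 * V) (22 * V) (64 * V), N + 1, []⟩ := by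
  obtain ⟨d, rfl⟩ := Nat.exists_eq_add_of_le hjV
  induction d generalizing j with
  | zero => exact .loopT (by simp [hs]) (exec_spread_last s hj hN hN') (.loopF rfl)
  | succ d ih =>
    refine .loopT (by simp [hs]) (exec_spread s hj (by omega)) ?_
    have h1 : ({ s with fl := false } : Store A) = s := by rw [← hs]
    rw [h1]
    have := ih (j := j + 1) (by omega) (by omega) (by omega) (by omega)
    rwa [show j + 1 + d = j + (d + 1) by omega] at this

/-- The configuration in which a machine is started: empty tapes, the heads on the first cells, no
query, and a specification with 6 digits, which is the number of digits required for `V = 0`. -/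
def Conf.initial (a : A) : Conf A := ⟨a, fun _ _ => (false, false), fun _ => 0, [], 6⟩

theorem exec_format (s : Store A) {V : ℕ} (hV : 0 < V) (hN : 64 * V < N) :
    Exec N O formatProg s ⟨ones (4 * V) (22 * V) (64 * V), N + 1, []⟩ (.mk' s.a s.saved)
      ((Conf.initial s.a).env N (4 * V) V fun _ => false) := by
  refine .seq (exec_left (h' := N - 1 + 1) _ _ _ (by omega)) ?_
  refine .seq (exec_find_left (x' := 64 * V) _ _ _ (by omega) (by omega)
    (fun i hi hi' => by simp [ones]; omega) (by simp [ones])) ?_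
  refine .seq (exec_write _ _ _ _ (by omega)) ?_
  refine .seq (exec_to_right_end _ _ _ (by omega)) ?_
  refine .seq (exec_left (h' := N - 7 + 1) _ _ _ (by omega)) ?_
  refine .seq (exec_write _ _ _ _ (by omega)) ?_
  refine .seq (exec_left (h' := N - 12 + 1) _ _ _ (by omega)) ?_
  refine .seq (exec_write _ _ _ _ (by omega)) ?_
  refine .seq (exec_left (h' := N - 13 + 1) _ _ _ (by omega)) ?_
  refine .seq (exec_find_left (x' := 22 * V) _ _ _ (by omega) (by omega)
    (fun i hi hi' => ?_) ?_) ?_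
  · grind [ones, Function.update_apply]
  · grind [ones, Function.update_apply]
  refine .seq (exec_write _ _ _ _ (by omega)) ?_
  refine .seq (exec_left (h' := 22 * V - 1 + 1) _ _ _ (by omega)) ?_
  refine .seq (exec_write _ _ _ _ (by omega)) ?_
  refine .seq (exec_left (h' := 22 * V - 2 + 1) _ _ _ (by omega)) ?_
  refine .seq (exec_find_left (x' := 4 * V) _ _ _ (by omega) (by omega)
    (fun i hi hi' => ?_) ?_) ?_
  · grind [ones, Function.update_apply]
  · grind [ones, Function.update_apply]
  refine .seq (exec_to_left_end _ _ _ (by omega)) ?_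
  refine .seq (exec_right (h' := 1 + 1) _ _ _ (by omega) (by omega)) ?_
  refine .seq (exec_write _ _ _ _ (by omega)) ?_
  refine .seq (exec_right (h' := 2 + 1) _ _ _ (by omega) (by omega)) ?_
  refine .seq (exec_find_right (x' := 4 * V) _ _ _ (by omega) (by omega)
    (fun i hi hi' => ?_) ?_) ?_
  · grind [ones, Function.update_apply]
  · grind [ones, Function.update_apply]
  set G : ℕ → Fld → Bool := fun i F => match F with
    | .first => decide (i = 0)
    | .last => decide (i + 1 = V)
    | _ => false with hG
  have htp : Function.update (Function.update (Function.update (Function.update (Function.update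
      (Function.update (ones (4 * V) (22 * V) (64 * V)) (64 * V) false) (N - 7) true) (N - 12) true)
      (22 * V) false) (22 * V - 1) true) 1 true = lay (4 * V) V G (backg N (4 * V) 6 []) := by
    funext x
    by_cases hx : 4 * V ≤ x ∧ x < 4 * V + 18 * V
    · obtain ⟨i, k, hi, hk, rfl⟩ : ∃ i k, i < V ∧ k < 18 ∧ x = 4 * V + 18 * i + k :=
        ⟨(x - 4 * V) / 18, (x - 4 * V) % 18, by omega, by omega, by omega⟩
      rw [lay_cell hi hk]
      simp only [Function.update_apply, ones]
      rw [if_neg (by omega), if_neg (by omega : ¬ 4 * V + 18 * i + k = 22 * V),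
        if_neg (by omega : ¬ 4 * V + 18 * i + k = N - 12),
        if_neg (by omega : ¬ 4 * V + 18 * i + k = N - 7),
        if_neg (by omega : ¬ 4 * V + 18 * i + k = 64 * V)]
      rcases Nat.eq_zero_or_pos k with rfl | hk0
      · rw [if_neg (by omega), show fldAt 0 = .first from rfl]
        exact decide_eq_decide.2 (by omega)
      · by_cases hk17 : k = 17
        · subst hk17
          rw [show fldAt 17 = .last from rfl]
          simp only [hG]
          grind
        · rw [if_neg (by omega), decide_eq_false (by omega)]
          have : fldAt k ≠ .first ∧ fldAt k ≠ .last := by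
            constructor <;> intro h <;> have := congrArg Fld.idx h <;>
              rw [idx_fldAt k hk] at this <;> simp [Fld.idx] at this <;> omega
          simp only [hG]
          split <;> simp_all
    · rw [lay_bg (by omega), backg]
      simp only [Function.update_apply, ones]
      by_cases hx' : x < 4 * V
      · rw [if_pos hx']
        by_cases h1 : x = 1
        · subst h1; simp [rawBit]
        · rw [if_neg h1]
          have : rawBit [] x = false := by
            rcases x with _ | _ | x
            · rfl
            · exact absurd rfl h1
            · simp [rawBit]
          rw [this]
          grind
      · rw [if_neg hx', specBit]
        simp only [List.length_nil, Nat.zero_testBit, Bool.and_false, Bool.or_false,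
          ← Bool.decide_or]
        grind
  rw [htp]
  have hvis := exec_visit (N := N) (O := O) (pre := 4 * V) (G := G) (bg := backg N (4 * V) 6 [])
    (i := 0)
    (fun s : Store A => { s with
      buf := fun F => match F with | .head _ => true | F => s.buf F
      dir := .stay }) { s with fl := true } [] hV (by omega) rfl (by simp) rfl
  refine .seq hvis ?_
  have hfin : Function.update G 0 (fun F => match F with | .head _ => true | F => G 0 F) =
      (Conf.initial s.a).blocks V fun _ => false := by
    funext i F
    by_cases hi : i = 0
    · subst hi
      rw [Function.update_self]
      cases F <;> simp [Conf.blocks, Conf.initial, hG]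
    · rw [Function.update_of_ne hi]
      cases F <;> simp [Conf.blocks, Conf.initial, hG, Ne.symm hi]
  dsimp only
  rw [hfin]
  exact exec_clear _ _

end

/-! ### The diagonal machine -/

section

open Prog

/-- The phases of the diagonal machine. The first five count the cells of a virtual tape in binary,
the next ones simulate a step of a transducer, the last one is final. To find the record of the
program that applies, the machine adds the number of the scanned symbols (`addX`) to the number of
the current state, and skips as many records (`skipX`, `skipHeader`, `skipUnary`); it then loads the
header of the record (`load`), changes the simulated tapes accordingly (`doW`, `doI`, `doY`,
`appY`), copies the unary number in the record to tape 1 (`unary`, `unaryX`), and possibly asks a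
query (`askY`, `rewY`). -/
inductive Phase where
  | incP | growSpec | countRewP | countX | countRewX
  | readI | readW | addX | rewP | skipX | skipHeader | skipUnary | load | doW | doI | doY | appY
  | unary | unaryX | askY | rewY
  | halted

/-- The states of the diagonal machine. -/
structure Diag where
  ph : Phase
  /-- a counter -/
  k : Fin 18
  /-- the position of the simulated input head in its group of cells -/
  r : Fin 67
  /-- the header of a record of the simulated program -/
  reg : Fin 18 → Bool
  /-- the oracle output bit of the simulated transducer -/
  ans : Bool
  /-- the last output bit of the simulated transducer -/
  out : Bool

instance : Finite Phase := Finite.of_injective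
  (fun p => (⟨p.ctorIdx, by cases p <;> decide⟩ : Fin 22)) fun p p' h => by
    have h := Fin.mk.inj_iff.1 h
    cases p <;> cases p' <;> first | rfl | cases h

instance : Finite Diag := Finite.of_injective
  (fun a => (a.ph, a.k, a.r, a.reg, a.ans, a.out)) fun a a' h => by
    cases a; cases a'; simp_all

/-- A move encoded in two bits. -/
def decodeMove : Bool → Bool → Move
  | false, false => .stay
  | false, true => .left
  | true, _ => .right

/-- The effect of a move of the input head. The input `0^{64 V + 1}` has `64 V + 3` head positions.
The head of tape 2 is on the cell that stands for a group of 64 of them (or of 67, if this is the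
last cell), and `r` is the position in the group. -/
def moveInput (fi la : Bool) (r : Fin 67) : Move → Fin 67 × Move
  | .stay => (r, .stay)
  | .left => if r.1 = 0 then (if fi then (r, .stay) else (63, .left))
    else (Fin.ofNat 67 (r.1 - 1), .stay)
  | .right => if la then (Fin.ofNat 67 (min (r.1 + 1) 66), .stay) else
      if r.1 = 63 then (0, .right) else (Fin.ofNat 67 (r.1 + 1), .stay)

/-- The number of the symbol that the simulated input head sees; all cells of the input contain 0,
so there are just the three symbols left end, 0 and right end. -/
def inputSym (fi la : Bool) (r : Fin 67) : ℕ :=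
  if fi && decide (r.1 = 0) then 0 else if la && decide (r.1 = 66) then 2 else 1

/-- The number of the symbol that the simulated work head sees. The first cell of tape 3 stands for
the left end marker. -/
def workSym (fi d : Bool) : ℕ := if fi then 0 else if d then 2 else 1

/-- The transition function of the diagonal machine. Tape 0 holds the number `V` in binary, which is
read as the program of a transducer; tape 1 counts cells, later records; tape 2 is for the input
head of the transducer; tape 3 holds its work tape; the head position of tape 4 is the length of its
query, and ensures that the query does not become too long. Only the last bit of the output is
remembered. -/
def diagOp (a : Diag) : Op Diag :=
  match a.ph with
  | .incP => .tape 0 fun _ _ d =>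
      if d.1 then (a, (false, true), .right)
      else ({ a with ph := if d.2 then .countRewP else .growSpec }, (true, true), .stay)
  | .growSpec => .grow { a with ph := .countRewP }
  | .countRewP => .tape 0 fun fi _ d =>
      if fi then ({ a with ph := .countX }, d, .stay) else (a, d, .left)
  | .countX => .tape 1 fun _ la d =>
      if la then ({ a with ph := .countRewX }, d, .stay) else ({ a with ph := .incP }, d, .right)
  | .countRewX => .tape 1 fun fi _ d =>
      if fi then ({ a with ph := .readI }, d, .stay) else (a, d, .left)
  | .readI => .tape 2 fun fi la d =>
      ({ a with ph := .readW, k := Fin.ofNat 18 (inputSym fi la a.r) }, d, .stay)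
  | .readW => .tape 3 fun fi _ d =>
      ({ a with ph := .addX, k := Fin.ofNat 18 (6 * a.k + 2 * workSym fi d.1 + a.ans.toNat) }, d,
        .stay)
  | .addX => .tape 1 fun _ _ d =>
      if a.k.1 = 0 then ({ a with ph := .rewP }, d, .stay)
      else ({ a with k := Fin.ofNat 18 (a.k - 1) }, d, .right)
  | .rewP => .tape 0 fun fi _ d =>
      if fi then ({ a with ph := .skipX }, d, .stay) else (a, d, .left)
  | .skipX => .tape 1 fun fi _ d =>
      if fi then ({ a with ph := .load, k := 0 }, d, .stay)
      else ({ a with ph := .skipHeader, k := 11 }, d, .left)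
  | .skipHeader => .tape 0 fun _ _ d =>
      if a.k.1 = 0 then ({ a with ph := .skipUnary }, d, .stay)
      else ({ a with k := Fin.ofNat 18 (a.k - 1) }, d, .right)
  | .skipUnary => .tape 0 fun _ _ d =>
      if d.1 then (a, d, .right) else ({ a with ph := .skipX }, d, .right)
  | .load => .tape 0 fun _ _ d =>
      ({ a with
          reg := Function.update a.reg a.k d.1
          ph := if a.k.1 = 10 then .doW else .load
          k := Fin.ofNat 18 (a.k + 1) }, d, .right)
  | .doW => .tape 3 fun fi _ d =>
      if a.reg 0 then ({ a with ph := .halted }, d, .stay)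
      else ({ a with ph := .doI, out := if a.reg 8 then a.reg 9 else a.out },
        (if fi then d.1 else a.reg 1, d.2), decodeMove (a.reg 4) (a.reg 5))
  | .doI => .tape 2 fun fi la d =>
      ({ a with ph := .doY, r := (moveInput fi la a.r (decodeMove (a.reg 2) (a.reg 3))).1 }, d,
        (moveInput fi la a.r (decodeMove (a.reg 2) (a.reg 3))).2)
  | .doY => .tape 4 fun _ la d =>
      if a.reg 6 && !la then ({ a with ph := .appY }, d, .right)
      else ({ a with ph := .unary }, d, .stay)
  | .appY => .app (a.reg 7) { a with ph := .unary }
  | .unary => .tape 0 fun _ _ d =>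
      if d.1 then ({ a with ph := .unaryX }, d, .right)
      else ({ a with ph := if a.reg 10 then .askY else .readI }, d, .stay)
  | .unaryX => .tape 1 fun _ _ d => ({ a with ph := .unary }, d, .right)
  | .askY => .ask fun b => { a with ans := b, ph := .rewY }
  | .rewY => .tape 4 fun fi _ d =>
      if fi then ({ a with ph := .readI }, d, .stay) else (a, d, .left)
  | .halted => .tape 0 fun _ _ d => (a, d, .stay)

/-- The initial state of the diagonal machine. -/
def Diag.start : Diag := ⟨.incP, 0, 0, fun _ => false, false, false⟩

/-- The counting phases are over. -/
def Diag.counted (a : Diag) : Bool := match a.ph with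
  | .incP | .growSpec | .countRewP | .countX | .countRewX => false
  | _ => true

/-- The machine has halted. -/
def Diag.done (a : Diag) : Bool := match a.ph with
  | .halted => true
  | _ => false

/-- The effect of an overflow of the clock: the machine halts, with output bit 1, which means that
it rejects. -/
def Diag.overflow (a : Diag) : Diag := { a with ph := .halted, out := true }

/-- The values of a function on the five tapes. -/
def five {α : Type} (p x i w y : α) : Fin 5 → α
  | 0 => p
  | 1 => x
  | 2 => i
  | 3 => w
  | 4 => y

/-- Changing one of the five values. -/
theorem update_five {α : Type} (p x i w y v : α) :
    Function.update (five p x i w y) 0 v = five v x i w y ∧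
    Function.update (five p x i w y) 1 v = five p v i w y ∧
    Function.update (five p x i w y) 2 v = five p x v w y ∧
    Function.update (five p x i w y) 3 v = five p x i v y ∧
    Function.update (five p x i w y) 4 v = five p x i w v := by
  refine ⟨?_, ?_, ?_, ?_, ?_⟩ <;> funext j <;> fin_cases j <;> rfl

/-- The empty content of a virtual tape. -/
def blank : ℕ → Bool × Bool := fun _ => (false, false)

/-- The content of tape 0 that represents a number; the second bit of a symbol marks the digits in
use, so that the machine notices when the number gets longer. -/
def number (k : ℕ) : ℕ → Bool × Bool := fun i => (k.testBit i, decide (i < k.size))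

/-- A configuration of the diagonal machine, with blank contents of the tapes 1, 2 and 4. -/
def diagConf (a : Diag) (P W : ℕ → Bool × Bool) (p x i w h : ℕ) (y : List Bool) (l : ℕ) :
    Conf Diag :=
  ⟨a, five P blank blank W blank, five p x i w h, y, l⟩

variable {N V : ℕ} {O : Oracle}

theorem Conf.step_tape {A : Type} {op : A → Op A} {c : Conf A} {j f} (hop : op c.a = .tape j f) {r}
    (hr : f (decide (c.pos j = 0)) (decide (c.pos j + 1 = V)) (c.cont j (c.pos j)) = r) :
    c.step V O op = ⟨r.1, Function.update c.cont j (Function.update (c.cont j) (c.pos j) r.2.1),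
      Function.update c.pos j (moveClamped V r.2.2 (c.pos j)), c.y, c.l⟩ := by
  subst hr
  simp only [Conf.step, hop]

section
variable (a : Diag) (P W : ℕ → Bool × Bool) (p x i w h : ℕ) (y : List Bool) (l : ℕ)

theorem step_tape_zero {f} (hop : diagOp a = .tape 0 f) {r}
    (hr : f (decide (p = 0)) (decide (p + 1 = V)) (P p) = r) :
    (diagConf a P W p x i w h y l).step V O diagOp =
      diagConf r.1 (Function.update P p r.2.1) W (moveClamped V r.2.2 p) x i w h y l :=
  (Conf.step_tape (c := diagConf a P W p x i w h y l) hop hr).trans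
    (by simp only [diagConf, five, update_five])

theorem step_tape_one {f} (hop : diagOp a = .tape 1 f) {a' m}
    (hr : f (decide (x = 0)) (decide (x + 1 = V)) (blank x) = (a', blank x, m)) :
    (diagConf a P W p x i w h y l).step V O diagOp =
      diagConf a' P W p (moveClamped V m x) i w h y l :=
  (Conf.step_tape (c := diagConf a P W p x i w h y l) hop hr).trans
    (by simp only [diagConf, five, update_five, Function.update_eq_self])

theorem step_tape_two {f} (hop : diagOp a = .tape 2 f) {a' m}
    (hr : f (decide (i = 0)) (decide (i + 1 = V)) (blank i) = (a', blank i, m)) :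
    (diagConf a P W p x i w h y l).step V O diagOp =
      diagConf a' P W p x (moveClamped V m i) w h y l :=
  (Conf.step_tape (c := diagConf a P W p x i w h y l) hop hr).trans
    (by simp only [diagConf, five, update_five, Function.update_eq_self])

theorem step_tape_three {f} (hop : diagOp a = .tape 3 f) {r}
    (hr : f (decide (w = 0)) (decide (w + 1 = V)) (W w) = r) :
    (diagConf a P W p x i w h y l).step V O diagOp =
      diagConf r.1 P (Function.update W w r.2.1) p x i (moveClamped V r.2.2 w) h y l :=
  (Conf.step_tape (c := diagConf a P W p x i w h y l) hop hr).trans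
    (by simp only [diagConf, five, update_five])

theorem step_tape_four {f} (hop : diagOp a = .tape 4 f) {a' m}
    (hr : f (decide (h = 0)) (decide (h + 1 = V)) (blank h) = (a', blank h, m)) :
    (diagConf a P W p x i w h y l).step V O diagOp =
      diagConf a' P W p x i w (moveClamped V m h) y l :=
  (Conf.step_tape (c := diagConf a P W p x i w h y l) hop hr).trans
    (by simp only [diagConf, five, update_five, Function.update_eq_self])

end

/-! ### Runs -/

/-- `n` steps lead from `c` to `c'`, through configurations that satisfy `R`. -/
def Conf.Run {A : Type} (V : ℕ) (O : Oracle) (op : A → Op A) (R : Conf A → Prop) (n : ℕ)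
    (c c' : Conf A) : Prop :=
  (Conf.step V O op)^[n] c = c' ∧ ∀ k < n, R ((Conf.step V O op)^[k] c)

section
variable {A : Type} {op : A → Op A} {R : Conf A → Prop}

theorem Conf.Run.refl (c : Conf A) : Conf.Run V O op R 0 c c := ⟨rfl, by simp⟩

theorem Conf.Run.head {c c' c'' : Conf A} {n : ℕ} (hR : R c) (h : c.step V O op = c')
    (h' : Conf.Run V O op R n c' c'') : Conf.Run V O op R (n + 1) c c'' := by
  subst h
  refine ⟨h'.1, fun k hk => ?_⟩
  cases k with
  | zero => exact hR
  | succ k => exact h'.2 k (by omega)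

theorem Conf.Run.trans {c c' c'' : Conf A} {n m : ℕ} (h : Conf.Run V O op R n c c')
    (h' : Conf.Run V O op R m c' c'') : Conf.Run V O op R (n + m) c c'' := by
  obtain ⟨rfl, h⟩ := h
  refine ⟨by rw [Nat.add_comm, Function.iterate_add_apply]; exact h'.1, fun k hk => ?_⟩
  by_cases hkn : k < n
  · exact h k hkn
  · have := h'.2 (k - n) (by omega)
    rwa [← Function.iterate_add_apply, Nat.sub_add_cancel (by omega)] at this

end

end

/-! ### Counting the cells of a virtual tape -/

section

open Prog

variable {N V : ℕ} {O : Oracle}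

/-- The counting phases are not over, and a step can be carried out. -/
def Counting (N V : ℕ) (c : Conf Diag) : Prop :=
  c.Ready N (4 * V) V diagOp ∧ c.a.counted = false

/-- In the counting phases, steps can be carried out, as the specification of the query, of at most
`6 + V` digits, fits into the `42 V` cells to the right of the blocks. -/
theorem counting_of (hN : 64 * V < N) {a : Diag} (ha : a.counted = false) {P W} {p x l : ℕ}
    (hp : p < V) (hx : x < V) (hl : 2 ≤ l) (hl' : l ≤ 6 + V) :
    Counting N V (diagConf a P W p x 0 0 0 [] l) := by
  refine ⟨⟨⟨by omega, hl, ?_, ?_, by simp [diagConf]⟩, fun j => ?_, fun b a' h => ?_, fun k h => ?_,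
    fun a' _ => ⟨?_, rfl⟩⟩, ha⟩
  · simp only [diagConf]; omega
  · simp only [diagConf, List.length_nil]; omega
  · simp only [diagConf]; fin_cases j <;> simp only [five] <;> omega
  · simp only [diagConf, diagOp] at h
    cases hph : a.ph <;> simp_all [Diag.counted]
  · simp only [diagConf, diagOp] at h
    cases hph : a.ph <;> simp_all [Diag.counted]
  · simp only [diagConf]; omega

/-- The carry in an increment of the number on tape 0. -/
theorem number_succ (k : ℕ) : ∃ t, (∀ i < t, number k i = (true, true)) ∧
    (number k t).1 = false ∧ 2 ^ t ≤ k + 1 ∧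
    (k + 1).size = (if (number k t).2 then k.size else k.size + 1) ∧
    number (k + 1) = fun i => if i < t then (false, true) else if i = t then (true, true)
      else number k i := by
  obtain ⟨t, h1, h2, h3⟩ := testBit_succ_spec k
  have ht : (k + 1).testBit t = true := by rw [h3]; simp
  have hpow : 2 ^ t ≤ k + 1 := Nat.ge_two_pow_of_testBit ht
  have hsz : ∀ i, i < (k + 1).size ↔ i = t ∨ i < k.size := by
    intro i
    rw [Nat.lt_size, Nat.lt_size]
    constructor
    · intro h
      rcases Nat.lt_or_ge k (2 ^ i) with hk | hk
      · left
        have he : k + 1 = 2 ^ i := by omega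
        rw [he, Nat.testBit_two_pow] at ht
        simpa using ht
      · exact .inr hk
    · rintro (rfl | h) <;> omega
  have hlow : ∀ i < t, i < k.size := fun i hi => by
    rw [Nat.lt_size]; exact Nat.ge_two_pow_of_testBit (h1 i hi)
  refine ⟨t, fun i hi => by simp [number, h1 i hi, hlow i hi], h2, hpow, ?_, ?_⟩
  · have e1 := hsz t
    have e2 := hsz k.size
    have e3 := hsz (k + 1).size
    have e4 := hsz ((k + 1).size - 1)
    have e5 := hsz (k.size - 1)
    have e6 := hsz (k.size + 1)
    simp only [number, decide_eq_true_eq]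
    split_ifs <;> omega
  · funext i
    simp only [number, h3, hsz]
    by_cases hi : i < t
    · simp [hi, hlow i hi]
    · by_cases hi' : i = t <;> simp [hi, hi']

section
variable (W : ℕ → Bool × Bool) (x l : ℕ)

theorem run_rewP_count (hN : 64 * V < N) (a : Diag) (P : ℕ → Bool × Bool) {p : ℕ} (hp : p < V)
    (hx : x < V) (hl : 2 ≤ l) (hl' : l ≤ 6 + V) :
    ∃ n, Conf.Run V O diagOp (Counting N V) n
      (diagConf { a with ph := .countRewP } P W p x 0 0 0 [] l)
      (diagConf { a with ph := .countX } P W 0 x 0 0 0 [] l) := by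
  induction p with
  | zero =>
    refine ⟨_, .head (counting_of hN rfl hp hx hl hl') ?_ (.refl _)⟩
    rw [step_tape_zero (f := _) (hop := rfl) (hr := rfl)]
    simp [moveClamped]
  | succ p ih =>
    obtain ⟨n, h⟩ := ih (by omega)
    refine ⟨_, .head (counting_of hN rfl hp hx hl hl') ?_ h⟩
    rw [step_tape_zero (f := _) (hop := rfl) (hr := rfl)]
    simp [moveClamped]

theorem run_rewX_count (hN : 64 * V < N) (a : Diag) (P : ℕ → Bool × Bool) (hV : 0 < V)
    (hx : x < V) (hl : 2 ≤ l) (hl' : l ≤ 6 + V) :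
    ∃ n, Conf.Run V O diagOp (Counting N V) n
      (diagConf { a with ph := .countRewX } P W 0 x 0 0 0 [] l)
      (diagConf { a with ph := .readI } P W 0 0 0 0 0 [] l) := by
  induction x with
  | zero =>
    refine ⟨_, .head (counting_of hN rfl hV hx hl hl') ?_ (.refl _)⟩
    rw [step_tape_one (f := _) (hop := rfl) (hr := rfl)]
    simp [moveClamped]
  | succ x ih =>
    obtain ⟨n, h⟩ := ih (by omega)
    refine ⟨_, .head (counting_of hN rfl hV hx hl hl') ?_ h⟩
    rw [step_tape_one (f := _) (hop := rfl) (hr := rfl)]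
    simp [moveClamped]

/-- The machine increments the number on tape 0, and lengthens the specification of the query if the
number gets longer. -/
theorem run_inc (hN : 64 * V < N) (a : Diag) {k : ℕ} (hk : k < V) (hx : x < V) :
    ∃ n, Conf.Run V O diagOp (Counting N V) n
      (diagConf { a with ph := .incP } (number k) W 0 x 0 0 0 [] (6 + k.size))
      (diagConf { a with ph := .countX } (number (k + 1)) W 0 x 0 0 0 [] (6 + (k + 1).size)) := by
  obtain ⟨t, h1, h2, h3, h4, h5⟩ := number_succ k
  have htV : t < V := by
    by_contra h
    have := Nat.lt_two_pow_self (n := V)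
    have := Nat.pow_le_pow_right (show 0 < 2 by omega) (not_lt.1 h)
    omega
  have hsz : ∀ j, j ≤ V → j.size ≤ V := fun j hj => Nat.size_le.2 (hj.trans_lt Nat.lt_two_pow_self)
  have hsz0 := hsz k hk.le
  have hsz1 := hsz (k + 1) hk
  -- the carry has reached cell `i`
  suffices H : ∀ d i, i + d = t → ∃ n, Conf.Run V O diagOp (Counting N V) n
      (diagConf { a with ph := .incP } (fun j => if j < i then (false, true) else number k j) W i x
        0 0 0 [] (6 + k.size))
      (diagConf { a with ph := .countX } (number (k + 1)) W 0 x 0 0 0 [] (6 + (k + 1).size)) by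
    simpa using H t 0 (by omega)
  intro d
  induction d with
  | zero =>
    rintro i hi
    obtain rfl : i = t := hi
    have hP : Function.update (fun j => if j < i then (false, true) else number k j)
      i (true, true) =
        number (k + 1) := by
      rw [h5]
      funext j
      by_cases hj : j = i
      · subst hj; simp
      · rw [Function.update_of_ne hj]; simp [hj]
    obtain ⟨n, hn⟩ := run_rewP_count (O := O) W x (6 + (k + 1).size) hN a (number (k + 1)) htV hx
      (by omega) (by omega)
    cases hd : (number k i).2 with
    | true =>
      rw [hd, if_pos rfl] at h4
      refine ⟨_, .head (counting_of hN rfl htV hx (by omega) (by omega)) ?_ hn⟩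
      rw [step_tape_zero (f := _) (hop := rfl) (hr := rfl), h4, ← hP]
      simp only [lt_irrefl, if_false]
      rw [h2, hd]
      simp [moveClamped]
    | false =>
      rw [hd, if_neg (by simp)] at h4
      refine ⟨_, .head (counting_of hN rfl htV hx (by omega) (by omega)) ?_
        (.head (counting_of (p := i) (P := number (k + 1)) (W := W) (l := 6 + k.size)
          (a := { a with ph := .growSpec }) hN rfl htV hx (by omega) (by omega)) ?_ hn)⟩
      · rw [step_tape_zero (f := _) (hop := rfl) (hr := rfl), ← hP]
        simp only [lt_irrefl, if_false]
        rw [h2, hd]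
        simp [moveClamped]
      · rw [h4]; rfl
  | succ d ih =>
    intro i hi
    obtain ⟨n, hn⟩ := ih (i + 1) (by omega)
    refine ⟨_, .head (counting_of hN rfl (by omega) hx (by omega) (by omega)) ?_ hn⟩
    rw [step_tape_zero (f := _) (hop := rfl) (hr := rfl)]
    simp only [lt_irrefl, if_false, h1 i (by omega), if_true]
    have hP : Function.update (fun j => if j < i then (false, true) else number k j)
      i (false, true) =
        fun j => if j < i + 1 then (false, true) else number k j := by
      funext j
      by_cases hj : j = i
      · subst hj; simp
      · rw [Function.update_of_ne hj]
        simp only [show j < i + 1 ↔ j < i by omega]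
    rw [hP, moveClamped, if_pos (by omega)]

/-- The counting phases write the number `V` on tape 0, and give the specification of the query `6 +
V.size` digits. -/
theorem run_count (hN : 64 * V < N) (a : Diag) {k : ℕ} (hk : k < V) :
    ∃ n, Conf.Run V O diagOp (Counting N V) n
      (diagConf { a with ph := .incP } (number k) W 0 k 0 0 0 [] (6 + k.size))
      (diagConf { a with ph := .readI } (number V) W 0 0 0 0 0 [] (6 + V.size)) := by
  obtain ⟨d, rfl⟩ : ∃ d, V = k + 1 + d := Nat.exists_eq_add_of_le hk
  have hsz : ∀ j, j ≤ k + 1 + d → j.size ≤ k + 1 + d :=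
    fun j hj => Nat.size_le.2 (hj.trans_lt Nat.lt_two_pow_self)
  generalize hV : k + 1 + d = V at *
  induction d generalizing k with
  | zero =>
    obtain ⟨n₁, h₁⟩ := run_inc (O := O) W k hN a hk hk
    obtain rfl : k + 1 = V := hV
    have hs := hsz (k + 1) le_rfl
    obtain ⟨n₂, h₂⟩ := run_rewX_count (O := O) W k (6 + (k + 1).size) hN a (number (k + 1))
      (by omega) hk (by omega) (by omega)
    refine ⟨_, h₁.trans (.head (counting_of hN rfl (by omega) hk (by omega) (by omega)) ?_ h₂)⟩
    rw [step_tape_one (hop := rfl) (hr := if_pos (decide_eq_true rfl)), moveClamped]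
  | succ d ih =>
    obtain ⟨n₁, h₁⟩ := run_inc (O := O) W k hN a hk hk
    obtain ⟨n₂, h₂⟩ := ih (k := k + 1) (by omega) (by omega)
    have hs := hsz (k + 1) (by omega)
    refine ⟨_, h₁.trans (.head (counting_of hN rfl (by omega) hk (by omega) (by omega)) ?_ h₂)⟩
    rw [step_tape_one (hop := rfl) (hr := if_neg (by simp; omega)), moveClamped, if_pos (by omega)]

end

end

/-! ### The decision procedure on the zero tape -/

section

open Prog

variable {N V : ℕ} {O : Oracle}

/-- The configuration of the diagonal machine in which the simulation starts. -/
def simStart (V : ℕ) : Conf Diag :=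
  diagConf { Diag.start with ph := .readI } (number V) blank 0 0 0 0 0 [] (6 + V.size)

/-- The diagonal machine accepts the number `N`: it halts on the tape with `N` cells, and the last
output bit of the simulated transducer is not 1. If the clock overflows, it rejects. Tapes with at
most 64 cells have no blocks, and are rejected. -/
def accepts (O : Oracle) (N : ℕ) : Bool :=
  if N ≤ 64 then false
  else !((simStart ((N - 1) / 64)).clocked ((N - 1) / 64) O diagOp Diag.done Diag.overflow
    (2 ^ ((N - 1) / 64) - 1)).a.out

/-- This is why the tape is divided by 64: the number of digits in the specification of a query,
`⌈log₂ N⌉`, can be read off the size of `V`. -/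
theorem clog_eq_of_blocks (hV : 0 < V) (hN : 64 * V < N) (hN' : N ≤ 64 * (V + 1)) :
    Nat.clog 2 N = 6 + V.size := by
  obtain ⟨s, hs⟩ : ∃ s, V.size = s + 1 := ⟨V.size - 1, by have := Nat.size_pos.2 hV; omega⟩
  have h1 : 2 ^ s ≤ V := Nat.lt_size.1 (by omega)
  have h2 : V < 2 ^ (s + 1) := Nat.size_le.1 hs.le
  rw [hs]
  refine le_antisymm (Nat.clog_le_of_le_pow ?_) ((Nat.lt_clog_iff_pow_lt (by omega)).2 ?_)
  · rw [pow_add]; omega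
  · rw [Nat.add_eq, pow_add]; omega

/-- The invariant of the simulation: the head of tape 4 measures the length of the query, which is
thus less than `V`. -/
structure SimInv (V l : ℕ) (c : Conf Diag) : Prop where
  pos : ∀ j, c.pos j < V
  len : c.y.length ≤ c.pos 4
  app : c.a.ph = .appY → c.y.length < c.pos 4
  rew : c.a.ph = .rewY → c.y = []
  l_eq : c.l = l
  counted : c.a.counted = true

theorem SimInv.ready {l : ℕ} (hl : l = Nat.clog 2 N) (hV : 0 < V) (hN : 64 * V < N)
    (hN' : N ≤ 64 * (V + 1)) {c : Conf Diag} (h : SimInv V l c) :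
    c.Ready N (4 * V) V diagOp := by
  have hsz : V.size ≤ V := Nat.size_le.2 Nat.lt_two_pow_self
  have hl' := clog_eq_of_blocks hV hN hN'
  have hc := h.l_eq
  have h4 := h.pos 4
  have hlen := h.len
  have hp : V < 2 ^ c.l := by
    rw [hc, hl, hl', add_comm, pow_add]
    have : V < 2 ^ V.size := Nat.size_le.1 le_rfl
    omega
  refine ⟨⟨hV, by omega, by omega, by omega, by omega⟩, h.pos, fun b a ha => by omega,
    fun k _ => by omega, fun a ha => ?_⟩
  have := h.counted
  simp only [diagOp] at ha
  cases hph : c.a.ph <;> simp_all [Diag.counted]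

/-- The invariant is preserved whatever number `V` is on tape 0, even if it is no reasonable
program. -/
theorem SimInv.step {l : ℕ} {c : Conf Diag} (h : SimInv V l c) (hd : c.a.done = false) :
    SimInv V l (c.step V O diagOp) := by
  obtain ⟨hpos, hlen, happ, hrew, hl, hc⟩ := h
  have htape : ∀ j r, j ≠ 4 → diagOp c.a = .tape j r → (∀ x y z, (r x y z).1.ph ≠ .appY ∧
      (r x y z).1.ph ≠ .rewY ∧ (r x y z).1.counted = true) → SimInv V l (c.step V O diagOp) := by
    intro j f hj hop hr
    rw [Conf.step_tape hop rfl]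
    refine ⟨fun j' => ?_, ?_, fun h => ((hr _ _ _).1 h).elim, fun h => ((hr _ _ _).2.1 h).elim, hl,
      (hr _ _ _).2.2⟩
    · simp only [Function.update_apply]
      split_ifs with e
      · exact moveClamped_lt _ (hpos j)
      · exact hpos j'
    · simp only [Function.update_of_ne hj.symm]; exact hlen
  have hmove : ∀ m j', Function.update c.pos 4 (moveClamped V m (c.pos 4)) j' < V := by
    intro m j'
    simp only [Function.update_apply]
    split_ifs
    · exact moveClamped_lt _ (hpos 4)
    · exact hpos j'
  cases hph : c.a.ph <;> simp only [Diag.counted, Diag.done, hph] at hc hd <;>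
    try contradiction
  case readI =>
    exact htape 2 _ (by decide) (by simp only [diagOp, hph]; rfl)
      (by simp [Diag.counted])
  case readW =>
    exact htape 3 _ (by decide) (by simp only [diagOp, hph]; rfl)
      (by simp [Diag.counted])
  case addX =>
    refine htape 1 _ (by decide) (by simp only [diagOp, hph]; rfl) fun x y z => ?_
    split_ifs <;> simp [Diag.counted]
  case rewP =>
    refine htape 0 _ (by decide) (by simp only [diagOp, hph]; rfl) fun x y z => ?_
    split_ifs <;> simp [Diag.counted, hph]
  case skipX =>
    refine htape 1 _ (by decide) (by simp only [diagOp, hph]; rfl) fun x y z => ?_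
    split_ifs <;> simp [Diag.counted]
  case skipHeader =>
    refine htape 0 _ (by decide) (by simp only [diagOp, hph]; rfl) fun x y z => ?_
    split_ifs <;> simp [Diag.counted]
  case skipUnary =>
    refine htape 0 _ (by decide) (by simp only [diagOp, hph]; rfl) fun x y z => ?_
    split_ifs <;> simp [Diag.counted, hph]
  case load =>
    refine htape 0 _ (by decide) (by simp only [diagOp, hph]; rfl) fun x y z => ?_
    dsimp only
    split_ifs <;> simp [Diag.counted]
  case doW =>
    refine htape 3 _ (by decide) (by simp only [diagOp, hph]; rfl) fun x y z => ?_
    split_ifs <;> simp [Diag.counted]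
  case doI => exact htape 2 _ (by decide) (by simp only [diagOp, hph]; rfl) (by simp [Diag.counted])
  case unary =>
    refine htape 0 _ (by decide) (by simp only [diagOp, hph]; rfl) fun x y z => ?_
    split_ifs <;> simp [Diag.counted]
  case unaryX =>
    exact htape 1 _ (by decide) (by simp only [diagOp, hph]; rfl)
      (by simp [Diag.counted])
  case doY =>
    rw [Conf.step_tape (by simp only [diagOp, hph]; rfl) rfl]
    refine ⟨hmove _, ?_, ?_, ?_, hl, ?_⟩ <;> dsimp only <;> split_ifs with h <;>
      simp [Diag.counted, moveClamped]
    all_goals simp at h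
    all_goals have := hpos 4
    all_goals first | (rw [if_pos (by omega)]; omega) | omega
  case rewY =>
    rw [Conf.step_tape (by simp only [diagOp, hph]; rfl) rfl]
    refine ⟨hmove _, ?_, ?_, fun _ => hrew hph, hl, ?_⟩
    · simp [hrew hph]
    · dsimp only
      split_ifs <;> simp [hph]
    · dsimp only
      split_ifs <;> simp [Diag.counted, hph]
  case appY =>
    rw [show c.step V O diagOp = ⟨{ c.a with ph := .unary }, c.cont, c.pos,
      c.y ++ [c.a.reg 7], c.l⟩ by
      simp only [Conf.step, diagOp, hph]]
    exact ⟨hpos, by have := happ hph; simp; omega, by simp, by simp, hl, rfl⟩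
  case askY =>
    rw [show c.step V O diagOp = ⟨{ c.a with ans := O c.y, ph := .rewY }, c.cont, c.pos, [], c.l⟩ by
      simp only [Conf.step, diagOp, hph]]
    exact ⟨hpos, by simp, by simp, by simp, hl, rfl⟩

/-- Decide whether the length of the tape is accepted, if the tape contains zeros only. The tape is
erased in the end. -/
def decideProg : Prog (Store Diag) :=
  .seq startProg (.seq (.ite (fun s => s.fl) (upd fun s => { s with a := { s.a with out := true } })
    (.seq spreadLoop (.seq formatProg (.seq (runProg diagOp Diag.counted)
      (clockedProg diagOp Diag.done Diag.overflow))))) eraseProg)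

/-- The decision procedure works on every tape of zeros, and keeps the saved bit. -/
theorem exec_decide (N : ℕ) (b : Bool) : ∃ s' tp', s'.saved = b ∧ (!s'.a.out) = accepts O N ∧
    (∀ x < N, tp' x = false) ∧
    ∃ y, Exec N O decideProg (.mk' .start b) ⟨fun _ => false, 0, []⟩ s' ⟨tp', 0, y⟩ := by
  by_cases hN : N ≤ 64
  · obtain ⟨tp', h1, h2⟩ := exec_erase (N := N) (O := O) (A := Diag)
      { Store.mk' { Diag.start with out := true } b with fl := true }
      (fun _ => false) (h := N + 1) [] le_rfl
    exact ⟨_, tp', by rfl, by rw [accepts, if_pos hN]; rfl, h1, _, .seq (exec_start_short _ hN)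
      (.seq (.iteT rfl (exec_upd _ _ _)) h2)⟩
  obtain ⟨V, hVe, hV, hN1, hN2⟩ : ∃ V, (N - 1) / 64 = V ∧ 0 < V ∧ 64 * V < N ∧ N ≤ 64 * (V + 1) :=
    ⟨(N - 1) / 64, rfl, by omega, by omega, by omega⟩
  have hl := clog_eq_of_blocks hV hN1 hN2
  -- counting needs no clock; only the simulation might not terminate
  obtain ⟨n, hn⟩ := run_count (O := O) blank hN1 Diag.start hV
  have hinit : Conf.initial Diag.start =
      diagConf { Diag.start with ph := .incP } (number 0) blank 0 0 0 0 0 []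
        (6 + (0 : ℕ).size) := by
    have e : number 0 = blank := by funext i; simp [number, blank]
    simp only [Conf.initial, diagConf, Conf.mk.injEq]
    refine ⟨by trivial, ?_, ?_, by trivial, by simp⟩ <;> funext j <;> fin_cases j <;>
      simp [five, e] <;> rfl
  have hcount : Exec N O (runProg diagOp Diag.counted) (.mk' Diag.start b)
      ((Conf.initial Diag.start).env N (4 * V) V fun _ => false)
      (.mk' (simStart V).a b) ((simStart V).env N (4 * V) V fun _ => false) := by
    rw [hinit]
    have := exec_run (done := Diag.counted)
      (c := diagConf { Diag.start with ph := .incP } (number 0)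
      blank 0 0 0 0 0 [] (6 + (0 : ℕ).size)) (fun _ => false) b n hn.2 (by rw [hn.1]; rfl)
    rw [hn.1] at this
    exact this
  have hinv : SimInv V (6 + V.size) (simStart V) :=
    ⟨fun j => by simp only [simStart, diagConf]; fin_cases j <;> exact hV,
      by simp [simStart, diagConf],
      by simp [simStart, diagConf], by simp [simStart, diagConf], rfl, rfl⟩
  obtain ⟨T, hT⟩ := exec_clocked (N := N) (O := O) (pre := 4 * V) (V := V) (op := diagOp)
    (done := Diag.done) (ovf := Diag.overflow)
    (SimInv V (6 + V.size)) (fun c hc hd => ⟨hc.ready hl.symm hV hN1 hN2, hc.step hd⟩)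
    (fun _ => rfl) (by omega) hV b (2 ^ V - 1) (simStart V) hinv (k := 0)
    (by have := Nat.one_le_two_pow (n := V); omega)
  have hz : (0 : ℕ).testBit = fun _ => false := by funext i; simp
  rw [hz] at hT
  set c' := (simStart V).clocked V O diagOp Diag.done Diag.overflow (2 ^ V - 1) with hc'
  obtain ⟨tp', h1, h2⟩ := exec_erase (N := N) (O := O) (.mk' c'.a b)
    (c'.env N (4 * V) V T).tp (h := 4 * V + 1) (c'.env N (4 * V) V T).y (by omega)
  refine ⟨_, tp', by rfl, ?_, h1, _, .seq (exec_start _ (by omega)) (.seq (.iteF rfl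
    (.seq (exec_spreadLoop _ rfl (j := 1) (by omega) hV hN1 hN2)
    (.seq (exec_format _ hV hN1) (.seq hcount hT)))) h2)⟩
  rw [accepts, if_neg hN, hVe, hc']
  rfl

end

/-! ### The permutation and the language -/

section

open Prog

variable {N V : ℕ} {O : Oracle}

/-- The unary language of the numbers accepted by the diagonal machine. -/
def diagLang (O : Oracle) : Set (List Bool) := {x | ∃ n, x = zeros n ∧ accepts O n = true}

open Classical in
/-- Flip the last bit of `0^{n-1} b` if `n` is accepted. -/
noncomputable def diagFlip (O : Oracle) (x : List Bool) : List Bool :=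
  if ∃ m b, x = zeros m ++ [b] then zeros (x.length - 1) ++ [x.getLastD false ^^ accepts O x.length]
  else x

theorem zeros_mem_diagLang (n : ℕ) : zeros n ∈ diagLang O ↔ accepts O n = true := by
  constructor
  · rintro ⟨m, hm, h⟩
    have := congrArg List.length hm
    simp only [zeros, List.length_replicate] at this
    rwa [this]
  · exact fun h => ⟨n, rfl, h⟩

theorem diagFlip_zeros (m : ℕ) (b : Bool) :
    diagFlip O (zeros m ++ [b]) = zeros m ++ [b ^^ accepts O (m + 1)] := by
  rw [diagFlip, if_pos ⟨m, b, rfl⟩]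
  simp [zeros]

theorem diagFlip_other {x : List Bool} (hx : ¬ ∃ m b, x = zeros m ++ [b]) : diagFlip O x = x :=
  if_neg hx

theorem diagFlip_flips : FlipsLastBitBy (diagFlip O) (diagLang O) := by
  refine ⟨fun x => diagFlip_other, fun m b h => ?_, fun m b h => ?_⟩ <;>
    rw [zeros_mem_diagLang] at h <;> rw [diagFlip_zeros] <;> simp_all

/-- Flipping the last bit leaves the length unchanged, so a second application undoes the first. -/
theorem diagFlip_involutive : Function.Involutive (diagFlip O) := by
  intro x
  by_cases hx : ∃ m b, x = zeros m ++ [b]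
  · obtain ⟨m, b, rfl⟩ := hx
    simp [diagFlip_zeros]
  · rw [diagFlip_other hx, diagFlip_other hx]

theorem length_diagFlip (x : List Bool) : (diagFlip O x).length = x.length := by
  by_cases hx : ∃ m b, x = zeros m ++ [b]
  · obtain ⟨m, b, rfl⟩ := hx
    simp [diagFlip_zeros]
  · rw [diagFlip_other hx]

/-- The permutation that flips the last bit of `0^{n-1} b` if `n` is accepted. -/
noncomputable def diagPerm (O : Oracle) : FunFamily := ⟨id, diagFlip O, length_diagFlip⟩

/-- The decision procedure as a transducer, which uses `n` work cells. -/
theorem diagLang_mem_SPACERel : diagLang O ∈ SPACERel O fun n => n := by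
  refine ⟨_, Exec.transducer_computes decideProg (.mk' .start false) (fun s => !s.a.out) (accepts O)
    (fun N => ?_) (fun n => ?_) fun x hx => ?_⟩
  · obtain ⟨s', tp', -, h, -, y, h'⟩ := exec_decide (O := O) N false
    exact ⟨s', _, h', h⟩
  · simp [indicator, zeros_mem_diagLang]
  · have : x ∉ diagLang O := fun ⟨n, h, _⟩ => hx n h
    simp [indicator, this]

/-- Flip the last bit of the tape contents `0^{n-1} b` if `n` is accepted. The last bit is saved in
the store and replaced by 0, so that the whole tape is free for the decision procedure. -/
def flipProg : Prog (Store Diag) :=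
  .seq (scan isRightEnd none .right) (.seq (moves .left 1) (.seq (test isLeftEnd)
  (.ite (fun s => s.fl) skip
    (.seq (.act fun s c => ({ s with saved := isOne c }, none, .stay)) (.seq (moves .left 1)
    (.seq (scan (fun c => isLeftEnd c || isOne c) none .left) (.seq (test isLeftEnd)
    (.ite (fun s => s.fl)
      (.seq (scan isRightEnd none .right) (.seq (moves .left 1) (.seq (write fun _ => false)
      (.seq (scan isLeftEnd none .left) (.seq (upd fun s => .mk' .start s.saved) (.seq decideProg
      (.seq (scan isRightEnd none .right) (.seq (moves .left 1)
      (write fun s => s.saved ^^ !s.a.out)))))))))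
    skip))))))))

theorem word_getD (x : List Bool) : word x.length (fun i => x.getD i false) = x := by
  apply List.ext_getElem <;> simp +contextual [word]

/-- The program for the permutation works on all tapes; those that contain a 1 before the last bit
are left alone. -/
theorem exec_flip (x : List Bool) : ∃ s' e', word x.length e'.tp = diagFlip O x ∧
    Exec x.length O flipProg (.mk' .start false) ⟨fun i => x.getD i false, 0, []⟩ s' e' := by
  rcases List.eq_nil_or_concat x with rfl | ⟨x', b, rfl⟩
  · refine ⟨_, _, ?_, .seq (exec_to_right_end _ _ _ (by omega))
      (.seq (exec_left (h' := 0) _ _ _ rfl)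
      (.seq (exec_test _ _ _) (.iteT rfl (exec_skip _ _))))⟩
    rw [diagFlip_other]
    · rfl
    · simp
  rw [List.concat_eq_append]
  have hlen : (x' ++ [b]).length = x'.length + 1 := by simp
  set tp : ℕ → Bool := fun i => (x' ++ [b]).getD i false with htp
  have hword : word (x'.length + 1) tp = x' ++ [b] := by rw [← hlen]; exact word_getD _
  rw [hlen]
  generalize hm : x'.length = m at *
  have hb : tp m = b := by simp [htp, ← hm]
  have h1 := exec_test (N := m + 1) (O := O) isLeftEnd
    { Store.mk' Diag.start false with fl := true } ⟨tp, m + 1, []⟩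
  simp only [look_succ_ne_left] at h1
  have h2 := Exec.act (N := m + 1) (O := O)
    (fun (s : Store Diag) c => ({ s with saved := isOne c }, none, .stay))
    { Store.mk' Diag.start false with fl := false } ⟨tp, m + 1, []⟩
  simp only [isOne_look _ (Nat.lt_succ_self m), put, moveBounded, hb] at h2
  suffices H : ∃ s' e', word (m + 1) e'.tp = diagFlip O (x' ++ [b]) ∧
      Exec (m + 1) O (.seq (scan (fun c => isLeftEnd c || isOne c) none .left)
        (.seq (test isLeftEnd)
    (.ite (fun s => s.fl)
      (.seq (scan isRightEnd none .right) (.seq (moves .left 1) (.seq (write fun _ => false)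
      (.seq (scan isLeftEnd none .left) (.seq (upd fun s => .mk' .start s.saved) (.seq decideProg
      (.seq (scan isRightEnd none .right) (.seq (moves .left 1)
      (write fun s => s.saved ^^ !s.a.out)))))))))
    skip))) { Store.mk' Diag.start b with fl := false } ⟨tp, m, []⟩ s' e' by
    obtain ⟨s', e', h, h'⟩ := H
    exact ⟨s', e', h, .seq (exec_to_right_end _ _ _ (by omega)) (.seq (exec_left (h' := m + 1) _ _ _
      (by omega)) (.seq h1 (.iteF rfl (.seq h2 (.seq (exec_left (h' := m) _ _ _ (by omega)) h')))))⟩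
  have htest : ∀ i < m + 1,
      (isLeftEnd (look (m + 1) tp (i + 1)) || isOne (look (m + 1) tp (i + 1))) = tp i :=
    fun i hi => by rw [look_succ_ne_left, isOne_look _ hi, Bool.false_or]
  by_cases hex : ∃ d, d < m ∧ tp (m - 1 - d) = true
  · -- there is a one before the last bit
    have hd := Nat.find_spec hex
    have hmin := fun j => Nat.find_min hex (m := j)
    generalize Nat.find hex = d at hd hmin
    have h3 := exec_test (N := m + 1) (O := O) isLeftEnd { Store.mk' Diag.start b with fl := true }
      ⟨tp, m - 1 - d + 1, []⟩
    simp only [look_succ_ne_left] at h3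
    refine ⟨_, _, ?_, .seq (exec_scan_left (h' := m - 1 - d + 1) none _ _ (by omega) (by omega)
      (fun i hi hi' => ?_) ?_ (fill_none _ _ _).symm) (.seq h3 (.iteF rfl (exec_skip _ _)))⟩
    · rw [hword, diagFlip_other]
      rintro ⟨k, b', h⟩
      obtain ⟨rfl, -⟩ := List.append_inj' h rfl
      have := hd.2
      rw [htp] at this
      simp [zeros, List.getElem?_append] at this hm
      subst hm
      simp [show k - 1 - d < k by omega] at this
    · obtain ⟨j, rfl⟩ := Nat.exists_eq_add_of_le' (by omega : 1 ≤ i)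
      rw [htest j (by omega)]
      have := hmin (m - 1 - j) (by omega)
      simpa [show m - 1 - j < m by omega, show m - 1 - (m - 1 - j) = j by omega] using this
    · rw [htest _ (by omega), hd.2]
  · -- the tape contains `0^m b`
    have hz : ∀ i < m, tp i = false := by
      intro i hi
      have := not_exists.1 hex (m - 1 - i)
      simpa [show m - 1 - i < m by omega, show m - 1 - (m - 1 - i) = i by omega] using this
    have hx' : x' = zeros m := by
      refine List.eq_replicate_iff.2 ⟨hm, fun c hc => ?_⟩
      obtain ⟨i, hi, rfl⟩ := List.mem_iff_getElem.1 hc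
      rw [← hz i (by omega), htp]
      simp [List.getElem?_append, hi]
    have herase : Function.update tp m false = fun _ => false := by
      funext i
      rcases lt_trichotomy i m with h | rfl | h
      · rw [Function.update_of_ne (by omega)]; exact hz i h
      · simp
      · rw [Function.update_of_ne (by omega), htp]
        simp only [List.getD_eq_getElem?_getD]
        rw [List.getElem?_eq_none (by simp; omega)]; rfl
    obtain ⟨s', tp', h4, h5, h6, y, h7⟩ := exec_decide (O := O) (m + 1) b
    refine ⟨_, _, ?_, .seq (exec_scan_left (h' := 0) none _ _ (by omega) (by omega)
      (fun i hi hi' => ?_) rfl (fill_none _ _ _).symm) (.seq (exec_test _ _ _) (.iteT rfl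
      (.seq (exec_to_right_end (h := 0) _ _ _ (by omega))
        (.seq (exec_left (h' := m + 1) _ _ _ (by omega))
      (.seq (exec_write (i := m) _ _ _ _ (by omega))
        (.seq (exec_to_left_end (h := m + 1) _ _ _ (by omega))
      (.seq (exec_upd _ _ _) (.seq ?_ (.seq (exec_to_right_end (h := 0) s' tp' y (by omega))
      (.seq (exec_left (h' := m + 1) _ _ _ (by omega))
        (exec_write (i := m) _ _ _ _ (by omega))))))))))))⟩
    · rw [hx', diagFlip_zeros, ← h5, word, List.range_succ, List.map_append]
      congr 1
      · refine List.eq_replicate_iff.2 ⟨by simp, fun c hc => ?_⟩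
        obtain ⟨i, hi, rfl⟩ := List.mem_map.1 hc
        have := List.mem_range.1 hi
        dsimp only
        rw [Function.update_of_ne (by omega)]
        exact h6 i (by omega)
      · simp [h4]
    · obtain ⟨j, rfl⟩ := Nat.exists_eq_add_of_le' (by omega : 1 ≤ i)
      rw [htest j (by omega)]
      exact hz j (by omega)
    · dsimp only
      rw [herase]
      exact h7

theorem diagPerm_isPermutation : (diagPerm O).IsPermutation :=
  ⟨fun _ => rfl, diagFlip_involutive.bijective⟩

/-- The permutation is computed in place without any additional cells. -/
theorem diagPerm_mem_inplaceFLRel : diagPerm O ∈ inplaceFLRel O := by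
  refine ⟨0, flipProg.toInPlace (.mk' .start false), fun x => ?_⟩
  obtain ⟨s', e', h, h'⟩ := exec_flip (O := O) x
  obtain ⟨c, h1, h2, h3⟩ := Exec.inPlace_halts _ h'
  refine ⟨c, ?_, h2, ?_⟩
  · rw [word_getD] at h1
    simpa [diagPerm] using h1
  · rw [h3, h]; simp [diagPerm]

end

/-! ### Programs for the diagonal machine -/

section

variable {V : ℕ} {O : Oracle}

/-- A record of a program: a header of 11 bits, and a number in unary. Bit 0 of the header says that
the transducer halts; bit 1 is written on the work tape; bits 2, 3 and bits 4, 5 are the moves of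
the input head and of the work head; bits 6, 7 and bits 8, 9 are the symbols (if any) for the oracle
tape and for the output; bit 10 says that the next state is a query state. -/
structure Record where
  hdr : ℕ → Bool
  nxt : ℕ

/-- The word that represents a record. Its number is that of the next state; as every state owns 18
records, it is multiplied by 18, so that it becomes a number of records to be skipped. -/
def Record.word (R : Record) : List Bool :=
  (List.range 11).map R.hdr ++ (List.replicate (18 * R.nxt) true ++ [false])

/-- The word that represents the first `t` records. -/
def progWord (R : ℕ → Record) (t : ℕ) : List Bool := (List.range t).flatMap fun i => (R i).word

/-- The offset of a record. -/
def offset (R : ℕ → Record) (t : ℕ) : ℕ := (progWord R t).length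

theorem Record.length_word (R : Record) : R.word.length = 12 + 18 * R.nxt := by
  simp [Record.word]; omega

theorem progWord_succ (R : ℕ → Record) (t : ℕ) :
    progWord R (t + 1) = progWord R t ++ (R t).word := by
  simp [progWord, List.range_succ]

theorem offset_succ (R : ℕ → Record) (t : ℕ) :
    offset R (t + 1) = offset R t + 12 + 18 * (R t).nxt := by
  rw [offset, progWord_succ, List.length_append, Record.length_word, offset]; omega

theorem offset_mono (R : ℕ → Record) : Monotone (offset R) :=
  monotone_nat_of_le_succ fun t => by rw [offset_succ]; omega

theorem progWord_prefix (R : ℕ → Record) {t T : ℕ} (h : t ≤ T) : progWord R t <+: progWord R T := by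
  induction T, h using Nat.le_induction with
  | base => exact List.prefix_rfl
  | succ T _ ih => rw [progWord_succ]; exact ih.trans (List.prefix_append _ _)

/-- The tape content `P` starts with the first `T` records of a program. -/
structure Holds (V : ℕ) (P : ℕ → Bool × Bool) (R : ℕ → Record) (T : ℕ) : Prop where
  lt : offset R T < V
  hdr : ∀ t < T, ∀ i < 11, (P (offset R t + i)).1 = (R t).hdr i
  nxt : ∀ t < T, ∀ i < 18 * (R t).nxt, (P (offset R t + 11 + i)).1 = true
  fin : ∀ t < T, (P (offset R t + 11 + 18 * (R t).nxt)).1 = false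

theorem holds_of_prefix {P : ℕ → Bool × Bool} {R : ℕ → Record} {T : ℕ} (hlt : offset R T < V)
    (h : ∀ k, k < offset R T → (P k).1 = (progWord R T).getD k false) : Holds V P R T := by
  have key : ∀ t < T, ∀ i < 12 + 18 * (R t).nxt,
      (P (offset R t + i)).1 = (R t).word.getD i false := by
    intro t ht i hi
    have h1 : offset R (t + 1) ≤ offset R T := offset_mono R ht
    rw [offset_succ] at h1
    rw [h _ (by omega)]
    obtain ⟨l, hl⟩ := progWord_prefix R ht
    rw [← hl, progWord_succ]
    simp only [List.getD_eq_getElem?_getD]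
    rw [List.getElem?_append_left (by
        rw [List.length_append, Record.length_word]; simp only [offset]; omega),
      List.getElem?_append_right (by simp [offset])]
    simp [offset]
  refine ⟨hlt, fun t ht i hi => ?_, fun t ht i hi => ?_, fun t ht => ?_⟩
  · rw [key t ht i (by omega)]
    simp [Record.word, List.getElem?_append, hi]
  · rw [add_assoc, key t ht _ (by omega)]
    simp [Record.word, List.getElem?_append, hi]
  · rw [add_assoc, key t ht _ (by omega)]
    simp [Record.word]

/-- Every word is an initial segment of the binary expansions (lowest digits first) of arbitrarily
large numbers. -/
theorem exists_number (l : List Bool) (V₀ : ℕ) :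
    ∃ V ≥ V₀, ∀ k < l.length, V.testBit k = l.getD k false := by
  refine ⟨2 ^ l.length * V₀ + Nat.ofBits fun i : Fin l.length => l[i], ?_, fun k hk => ?_⟩
  · exact (Nat.le_mul_of_pos_left _ (by positivity)).trans (Nat.le_add_right _ _)
  · rw [Nat.testBit_two_pow_mul_add _ (Nat.ofBits_lt_two_pow _), if_pos hk,
      Nat.testBit_ofBits_lt _ _ hk]
    simp [hk]

/-- The diagonal machine has not halted. -/
def Active (c : Conf Diag) : Prop := c.a.done = false

section
variable (a : Diag) (P W : ℕ → Bool × Bool) (p x i w h : ℕ) (y : List Bool) (l : ℕ)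

theorem step_tape_zero' {f} (hop : diagOp a = .tape 0 f) {a' m}
    (hr : f (decide (p = 0)) (decide (p + 1 = V)) (P p) = (a', P p, m)) :
    (diagConf a P W p x i w h y l).step V O diagOp =
      diagConf a' P W (moveClamped V m p) x i w h y l := by
  rw [step_tape_zero (hop := hop) (hr := hr), Function.update_eq_self]

theorem run_addX {k : ℕ} (hk : k < 18) (hx : x + k < V) :
    Conf.Run V O diagOp Active (k + 1)
      (diagConf { a with ph := .addX, k := Fin.ofNat 18 k } P W p x i w h y l)
      (diagConf { a with ph := .rewP, k := 0 } P W p (x + k) i w h y l) := by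
  induction k generalizing x with
  | zero =>
    refine .head rfl ?_ (.refl _)
    rw [step_tape_one (hop := rfl) (hr := if_pos rfl)]; rfl
  | succ k ih =>
    have := ih (x + 1) (by omega) (by omega)
    rw [show x + 1 + k = x + (k + 1) by omega] at this
    refine .head rfl ?_ this
    have h1 : (Fin.ofNat 18 (k + 1)).1 = k + 1 := by simp; omega
    rw [step_tape_one (hop := rfl) (hr := if_neg (by simp only [h1]; omega)), moveClamped,
      if_pos (by omega)]
    simp only [h1, Nat.add_sub_cancel]

theorem run_rewP (hp : p < V) :
    Conf.Run V O diagOp Active (p + 1) (diagConf { a with ph := .rewP } P W p x i w h y l)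
      (diagConf { a with ph := .skipX } P W 0 x i w h y l) := by
  induction p with
  | zero =>
    refine .head rfl ?_ (.refl _)
    rw [step_tape_zero' (hop := rfl) (hr := if_pos (by simp))]; rfl
  | succ p ih =>
    refine .head rfl ?_ (ih (by omega))
    rw [step_tape_zero' (hop := rfl) (hr := if_neg (by simp))]; rfl

theorem run_skipHeader {k : ℕ} (hk : k < 18) (hp : p + k < V) :
    Conf.Run V O diagOp Active (k + 1)
      (diagConf { a with ph := .skipHeader, k := Fin.ofNat 18 k } P W p x i w h y l)
      (diagConf { a with ph := .skipUnary, k := 0 } P W (p + k) x i w h y l) := by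
  induction k generalizing p with
  | zero =>
    refine .head rfl ?_ (.refl _)
    rw [step_tape_zero' (hop := rfl) (hr := if_pos rfl)]; rfl
  | succ k ih =>
    have := ih (p + 1) (by omega) (by omega)
    rw [show p + 1 + k = p + (k + 1) by omega] at this
    refine .head rfl ?_ this
    have h1 : (Fin.ofNat 18 (k + 1)).1 = k + 1 := by simp; omega
    rw [step_tape_zero' (hop := rfl) (hr := if_neg (by simp only [h1]; omega)), moveClamped,
      if_pos (by omega)]
    simp only [h1, Nat.add_sub_cancel]

theorem run_skipUnary {u : ℕ} (hu : ∀ j < u, (P (p + j)).1 = true) (hu' : (P (p + u)).1 = false)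
    (hp : p + u + 1 < V) :
    Conf.Run V O diagOp Active (u + 1)
      (diagConf { a with ph := .skipUnary } P W p x i w h y l)
      (diagConf { a with ph := .skipX } P W (p + u + 1) x i w h y l) := by
  induction u generalizing p with
  | zero =>
    refine .head rfl ?_ (.refl _)
    rw [step_tape_zero' (hop := rfl) (hr := if_neg (by simpa using hu')), moveClamped,
      if_pos (by omega)]
  | succ u ih =>
    have := ih (p + 1) (fun j hj => by
      have := hu (j + 1) (by omega); rwa [show p + (j + 1) = p + 1 + j by omega] at this)
      (by rwa [show p + (u + 1) = p + 1 + u by omega] at hu') (by omega)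
    rw [show p + 1 + u + 1 = p + (u + 1) + 1 by omega] at this
    refine .head rfl ?_ this
    rw [step_tape_zero' (hop := rfl) (hr := if_pos (hu 0 (by omega))), moveClamped,
      if_pos (by omega)]

/-- Skipping `n` records. -/
theorem run_skip {R : ℕ → Record} {T : ℕ} (hP : Holds V P R T) {t n : ℕ} (ht : t + n < T)
    (hn : n < V) :
    ∃ m ≤ offset R (t + n) - offset R t + 2 * n + 1, Conf.Run V O diagOp Active m
      (diagConf { a with ph := .skipX } P W (offset R t) n i w h y l)
      (diagConf { a with ph := .load, k := 0 } P W (offset R (t + n)) 0 i w h y l) := by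
  induction n generalizing t a with
  | zero =>
    refine ⟨1, by omega, .head rfl ?_ (.refl _)⟩
    rw [step_tape_one (hop := rfl) (hr := if_pos (by simp))]; rfl
  | succ n ih =>
    have h1 : offset R (t + 1) ≤ offset R T := offset_mono R (by omega)
    have h2 := hP.lt
    have h3 : offset R (t + 1) ≤ offset R (t + 1 + n) := offset_mono R (by omega)
    have h4 := offset_succ R t
    obtain ⟨m, hm, hr⟩ := ih { a with k := 0 } (t := t + 1) (by omega) (by omega)
    refine ⟨(11 + 1) + ((18 * (R t).nxt + 1) + m) + 1, ?_, .head rfl ?_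
      ((run_skipHeader a P W (offset R t) n i w h y l (k := 11) (by omega) (by omega)).trans
      ((run_skipUnary { a with k := 0 } P W (offset R t + 11) n i w h y l
        (hP.nxt t (by omega)) (hP.fin t (by omega)) (by omega)).trans ?_))⟩
    · rw [show t + (n + 1) = t + 1 + n by omega]; omega
    · rw [step_tape_one (hop := rfl) (hr := if_neg (by simp))]; rfl
    · rw [show offset R t + 11 + 18 * (R t).nxt + 1 = offset R (t + 1) by omega,
        show t + (n + 1) = t + 1 + n by omega]
      exact hr

/-- The header of a record is copied to the register. -/
theorem run_load (hdr : ℕ → Bool) (hp : ∀ j < 11, (P (p + j)).1 = hdr j) (hV : p + 11 < V) :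
    ∃ reg k, (∀ j < 11, reg (Fin.ofNat 18 j) = hdr j) ∧ Conf.Run V O diagOp Active 11
      (diagConf { a with ph := .load, k := 0 } P W p x i w h y l)
      (diagConf { a with ph := .doW, k := k, reg := reg } P W (p + 11) x i w h y l) := by
  suffices H : ∀ d k, k + d = 10 → ∀ reg : Fin 18 → Bool, (∀ j < k, reg (Fin.ofNat 18 j) = hdr j) →
      ∃ reg' k', (∀ j < 11, reg' (Fin.ofNat 18 j) = hdr j) ∧ Conf.Run V O diagOp Active (d + 1)
      (diagConf { a with ph := .load, k := Fin.ofNat 18 k, reg := reg } P W (p + k) x i w h y l)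
      (diagConf { a with ph := .doW, k := k', reg := reg' } P W (p + 11) x i w h y l) from
    H 10 0 rfl a.reg (by simp)
  intro d
  induction d with
  | zero =>
    intro k hk reg hreg
    obtain rfl : k = 10 := by omega
    refine ⟨Function.update reg 10 (P (p + 10)).1, 11, fun j hj => ?_, .head rfl ?_ (.refl _)⟩
    · rw [← hp j hj]
      by_cases hj' : j = 10
      · subst hj'; exact Function.update_self ..
      · rw [Function.update_of_ne, hreg j (by omega), hp j hj]
        intro h; exact hj' (by have := congrArg Fin.val h; simp at this; omega)
    · rw [step_tape_zero' (hop := rfl) (hr := rfl), moveClamped,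
        if_pos (show p + 10 + 1 < V by omega)]
      rfl
  | succ d ih =>
    intro k hk reg hreg
    have h1 : (Fin.ofNat 18 k).1 = k := by simp; omega
    obtain ⟨reg', k', hreg', hrun⟩ := ih (k + 1) (by omega)
      (Function.update reg (Fin.ofNat 18 k) (P (p + k)).1) (fun j hj => by
        by_cases hj' : j = k
        · subst hj'; rw [Function.update_self, hp j (by omega)]
        · rw [Function.update_of_ne, hreg j (by omega)]
          intro h; exact hj' (by have := congrArg Fin.val h; simp at this; omega))
    refine ⟨reg', k', hreg', .head rfl ?_ hrun⟩
    rw [step_tape_zero' (hop := rfl) (hr := rfl), moveClamped,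
      if_pos (show p + k + 1 < V by omega)]
    simp only [h1, if_neg (by omega : ¬ k = 10)]
    rfl

/-- The number of the next state is copied to tape 1, as a number of records. -/
theorem run_unary {u : ℕ} (hu : ∀ j < u, (P (p + j)).1 = true) (hp : p + u < V) (hx : x + u < V) :
    Conf.Run V O diagOp Active (2 * u)
      (diagConf { a with ph := .unary } P W p x i w h y l)
      (diagConf { a with ph := .unary } P W (p + u) (x + u) i w h y l) := by
  induction u generalizing p x with
  | zero => exact .refl _
  | succ u ih =>
    have := ih (p + 1) (x + 1) (fun j hj => by
      have := hu (j + 1) (by omega); rwa [show p + (j + 1) = p + 1 + j by omega] at this)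
      (by omega) (by omega)
    rw [show p + 1 + u = p + (u + 1) by omega, show x + 1 + u = x + (u + 1) by omega] at this
    refine .head (c := diagConf { a with ph := .unary } P W p x i w h y l)
      (c' := diagConf { a with ph := .unaryX } P W (p + 1) x i w h y l) rfl ?_ (.head rfl ?_ this)
    · rw [step_tape_zero' (hop := rfl) (hr := if_pos (hu 0 (by omega))), moveClamped,
        if_pos (by omega)]
    · rw [step_tape_one (hop := rfl) (hr := rfl), moveClamped, if_pos (by omega)]

theorem run_rewY :
    Conf.Run V O diagOp Active (h + 1) (diagConf { a with ph := .rewY } P W p x i w h y l)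
      (diagConf { a with ph := .readI } P W p x i w 0 y l) := by
  induction h with
  | zero =>
    refine .head rfl ?_ (.refl _)
    rw [step_tape_four (hop := rfl) (hr := if_pos (by simp))]; rfl
  | succ p ih =>
    refine .head rfl ?_ ih
    rw [step_tape_four (hop := rfl) (hr := if_neg (by simp))]; rfl

end

end

/-! ### Fetching a record -/

section

variable {V : ℕ} {O : Oracle}

theorem le_offset (R : ℕ → Record) (t : ℕ) : 12 * t ≤ offset R t := by
  induction t with
  | zero => omega
  | succ t ih => rw [offset_succ]; omega

theorem offset_zero (R : ℕ → Record) : offset R 0 = 0 := rfl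

theorem inputSym_le (fi la : Bool) (r : Fin 67) : inputSym fi la r ≤ 2 := by
  unfold inputSym; split_ifs <;> omega

theorem workSym_le (fi d : Bool) : workSym fi d ≤ 2 := by
  unfold workSym; split_ifs <;> omega

section
variable (a : Diag) (P W : ℕ → Bool × Bool) (p x i w h : ℕ) (y : List Bool) (l : ℕ)

/-- The index, among the 18 records of the current state, of the record that applies; it is
determined by the three input symbols, the three work symbols and the two values of the oracle
output bit. -/
def recordIdx (V : ℕ) (a : Diag) (W : ℕ → Bool × Bool) (i w : ℕ) : ℕ :=
  6 * inputSym (decide (i = 0)) (decide (i + 1 = V)) a.r + 2 * workSym (decide (w = 0)) (W w).1 +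
    a.ans.toNat

theorem recordIdx_lt : recordIdx V a W i w < 18 := by
  have h1 := inputSym_le (decide (i = 0)) (decide (i + 1 = V)) a.r
  have h2 := workSym_le (decide (w = 0)) (W w).1
  have h3 := Bool.toNat_lt a.ans
  unfold recordIdx; omega

/-- The machine finds the record that applies and loads its header. -/
theorem run_fetch {R : ℕ → Record} {T : ℕ} (hP : Holds V P R T) (hp : p < V)
    (ht : x + recordIdx V a W i w < T) :
    ∃ m ≤ 4 * V + 40, ∃ reg k,
      (∀ j < 11, reg (Fin.ofNat 18 j) = (R (x + recordIdx V a W i w)).hdr j) ∧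
      Conf.Run V O diagOp Active m (diagConf { a with ph := .readI } P W p x i w h y l)
        (diagConf { a with ph := .doW, k := k, reg := reg } P W
          (offset R (x + recordIdx V a W i w) + 11) 0 i w h y l) := by
  set idx := recordIdx V a W i w with hidx
  have hidx' : idx < 18 := recordIdx_lt a W i w
  have hT := le_offset R T
  have hlt := hP.lt
  have hoff := offset_succ R (x + idx)
  have hoff' : offset R (x + idx + 1) ≤ offset R T := offset_mono R ht
  obtain ⟨m, hm, h1⟩ := run_skip (O := O) { a with k := 0 } P W i w h y l hP
    (t := 0) (n := x + idx) (by omega) (by omega)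
  rw [Nat.zero_add] at h1 hm
  obtain ⟨reg, k', hreg, h2⟩ := run_load (V := V) (O := O) { a with k := 0 } P W
    (offset R (x + idx)) 0 i w h y l
    (R (x + idx)).hdr (hP.hdr _ ht) (by omega)
  have h0 := offset_zero R
  have hmod : ∀ n < 18, (Fin.ofNat 18 n).1 = n := fun n hn => by simp; omega
  have hs1 := inputSym_le (decide (i = 0)) (decide (i + 1 = V)) a.r
  have e1 : (diagConf { a with ph := .readI } P W p x i w h y l).step V O diagOp = diagConf
      { a with
          ph := .readW, k := Fin.ofNat 18 (inputSym (decide (i = 0)) (decide (i + 1 = V)) a.r) }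
      P W p x i w h y l := by
    rw [step_tape_two (hop := rfl) (hr := rfl)]; rfl
  have e2 : (diagConf
      { a with
          ph := .readW, k := Fin.ofNat 18 (inputSym (decide (i = 0)) (decide (i + 1 = V)) a.r) }
      P W p x i w h y l).step V O diagOp =
      diagConf { a with ph := .addX, k := Fin.ofNat 18 idx } P W p x i w h y l := by
    rw [step_tape_three (hop := rfl) (hr := rfl), Function.update_eq_self, hidx, recordIdx]
    dsimp only
    rw [hmod _ (by omega), moveClamped]
  have e3 := run_addX (V := V) (O := O) a P W p x i w h y l hidx' (by omega)
  have e4 := run_rewP (V := V) (O := O) { a with k := 0 } P W p (x + idx) i w h y l hp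
  exact ⟨idx + 1 + (p + 1 + (m + 11)) + 1 + 1, by omega, reg, k', hreg, .head (by rfl) e1
    (.head (by rfl) e2 (e3.trans (e4.trans (h1.trans h2))))⟩

end

end

/-! ### Transducers as programs -/

section

variable {V : ℕ} {O : Oracle}

/-- The two bits that encode a move. -/
def moveBits : Move → Bool × Bool
  | .stay => (false, false)
  | .left => (false, true)
  | .right => (true, false)

theorem decodeMove_moveBits (m : Move) : decodeMove (moveBits m).1 (moveBits m).2 = m := by
  cases m <;> rfl

/-- The input cell with a given number. -/
def inCell : ℕ → Cell
  | 0 => .leftEnd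
  | 1 => .bit false
  | _ => .rightEnd

/-- The work cell with a given number. -/
def workCell : ℕ → Cell
  | 0 => .leftEnd
  | 1 => .bit false
  | _ => .bit true

variable (M : Transducer)

/-- The record of what a transducer does in one step, for a numbering `e` of its states. The number
0 is reserved for a state before the initial one, as the diagonal machine starts with the number 0
on tape 1. -/
def Transducer.actRecord (e : M.Q → ℕ) : Option (TransducerAction M.Q) → Record
  | none => ⟨fun j => [true].getD j false, 0⟩
  | some t => ⟨fun j => [false, t.write, (moveBits t.inMove).1, (moveBits t.inMove).2,
      (moveBits t.workMove).1, (moveBits t.workMove).2, t.toOracle.isSome, t.toOracle.getD false,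
      t.toOutput.isSome, t.toOutput.getD false, M.isQuery t.next].getD j false, 1 + e t.next⟩

/-- The action before the first step, which only enters the initial state; thus the initial state,
like all others, is entered by an action that tells whether it is a query state. -/
def Transducer.startAction : TransducerAction M.Q := ⟨M.start, false, .stay, .stay, none, none⟩

/-- The configuration after an action. -/
def Transducer.apply (x : List Bool) (c : M.Cfg) (t : TransducerAction M.Q) : M.Cfg where
  state := t.next
  inHead := moveBounded x.length t.inMove c.inHead
  work := writeWork c.work t.write c.workHead
  workHead := moveUnbounded t.workMove c.workHead
  oracleTape := c.oracleTape ++ t.toOracle.toList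
  answer := c.answer
  output := c.output ++ t.toOutput.toList

variable {M}

/-- The state and the tapes of the diagonal machine represent those of a transducer, with the
exception of the position of the work head and of the query, which are given by the head position of
tape 3 and by the query of the diagonal machine itself. -/
structure Models (V : ℕ) (d : M.Cfg) (a : Diag) (W : ℕ → Bool × Bool) (i : ℕ) : Prop where
  lt : i < V
  low : i + 1 < V → a.r.1 < 64
  inHead : d.inHead = 64 * i + a.r
  work : ∀ j, (W (j + 1)).1 = d.work j
  ans : a.ans = d.answer
  out : a.out = d.output.getLastD false

theorem Models.moveInput {d : M.Cfg} {a : Diag} {W : ℕ → Bool × Bool} {i : ℕ} (h : Models V d a W i)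
    (m : Move) {r' m'} (hr : moveInput (decide (i = 0)) (decide (i + 1 = V)) a.r m = (r', m')) :
    moveClamped V m' i < V ∧ (moveClamped V m' i + 1 < V → r'.1 < 64) ∧
      moveBounded (64 * V + 1) m d.inHead = 64 * moveClamped V m' i + r' := by
  obtain ⟨h1, h2, h3, -, -, -⟩ := h
  have h67 := a.r.2
  rw [h3]
  cases m with
  | stay => cases hr; exact ⟨h1, h2, rfl⟩
  | left =>
    simp only [InPlace.moveInput] at hr
    split_ifs at hr with c1 c2 <;> cases hr
    · simp at c2; exact ⟨h1, h2, by simp [moveBounded, moveClamped]; omega⟩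
    · simp at c2; simp [moveBounded, moveClamped]; omega
    · simp [moveBounded, moveClamped]; omega
  | right =>
    simp only [InPlace.moveInput] at hr
    split_ifs at hr with c1 c2 <;> cases hr
    · simp at c1; simp [moveBounded, moveClamped]; omega
    · simp at c1; simp [moveBounded, moveClamped]; split_ifs <;> omega
    · simp at c1; simp [moveBounded, moveClamped]; omega

theorem Models.readTape {d : M.Cfg} {a : Diag} {W : ℕ → Bool × Bool} {i : ℕ}
    (h : Models V d a W i) :
    readTape (zeros (64 * V + 1)) d.inHead =
      inCell (inputSym (decide (i = 0)) (decide (i + 1 = V)) a.r) := by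
  obtain ⟨h1, h2, h3, -, -, -⟩ := h
  have h67 := a.r.2
  rw [h3, inputSym]
  split_ifs with c1 c2
  · simp at c1; rw [show 64 * i + a.r.1 = 0 by omega]; rfl
  · simp at c2
    rw [show 64 * i + a.r.1 = 64 * V + 1 + 1 by omega]
    simp [InPlace.readTape, zeros, inCell]
  · simp at c1 c2
    obtain ⟨j, hj⟩ := Nat.exists_eq_add_of_le' (show 1 ≤ 64 * i + a.r.1 by omega)
    have : j < 64 * V + 1 := by omega
    rw [hj]
    simp [InPlace.readTape, zeros, inCell, this]

theorem Models.readWork {d : M.Cfg} {a : Diag} {W : ℕ → Bool × Bool} {i : ℕ}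
    (h : Models V d a W i) :
    readWork d.work d.workHead = workCell (workSym (decide (d.workHead = 0)) (W d.workHead).1) := by
  cases d.workHead with
  | zero => rfl
  | succ w => cases hw : (W (w + 1)).1 <;> simp [InPlace.readWork, workSym, workCell, ← h.work, hw]

theorem getLastD_append_toList (l : List Bool) (o : Option Bool) :
    (l ++ o.toList).getLastD false = if o.isSome then o.getD false else l.getLastD false := by
  cases o <;> simp

theorem moveClamped_of_lt {w : ℕ} (m : Move) (hw : w + 1 < V) :
    moveClamped V m w = moveUnbounded m w := by
  cases m <;> simp [moveClamped, moveUnbounded, hw]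

/-- The diagonal machine carries out an action whose record it has loaded. The oracle is consulted
at the end of the action that enters a query state, so the resulting configuration is the one after
consultation. -/
theorem run_action {x : List Bool} (hx : x.length = 64 * V + 1) {d : M.Cfg} {a : Diag}
    {W : ℕ → Bool × Bool}
    {i : ℕ} (hd : Models V d a W i) {e : M.Q → ℕ} {t : TransducerAction M.Q}
    (hreg : ∀ j < 11, a.reg (Fin.ofNat 18 j) = (M.actRecord e (some t)).hdr j)
    {P : ℕ → Bool × Bool} {p l : ℕ} (hu : ∀ j < 18 * (1 + e t.next), (P (p + j)).1 = true)
    (hu' : (P (p + 18 * (1 + e t.next))).1 = false) (hp : p + 18 * (1 + e t.next) < V)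
    (hw : d.workHead + 1 < V) (ho : d.oracleTape.length + 1 < V) :
    ∃ m ≤ 4 * V + 40, ∃ a' W' i',
      Models V (M.consult O (M.apply x d t)) a' W' i' ∧
      Conf.Run V O diagOp Active m
        (diagConf { a with ph := .doW } P W p 0 i d.workHead d.oracleTape.length d.oracleTape l)
        (diagConf { a' with ph := .readI } P W' (p + 18 * (1 + e t.next)) (18 * (1 + e t.next)) i'
          (M.consult O (M.apply x d t)).workHead (M.consult O (M.apply x d t)).oracleTape.length
          (M.consult O (M.apply x d t)).oracleTape l) := by
  have r0 : a.reg 0 = false := hreg 0 (by omega)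
  have r1 : a.reg 1 = t.write := hreg 1 (by omega)
  have r2 : a.reg 2 = (moveBits t.inMove).1 := hreg 2 (by omega)
  have r3 : a.reg 3 = (moveBits t.inMove).2 := hreg 3 (by omega)
  have r4 : a.reg 4 = (moveBits t.workMove).1 := hreg 4 (by omega)
  have r5 : a.reg 5 = (moveBits t.workMove).2 := hreg 5 (by omega)
  have r6 : a.reg 6 = t.toOracle.isSome := hreg 6 (by omega)
  have r7 : a.reg 7 = t.toOracle.getD false := hreg 7 (by omega)
  have r8 : a.reg 8 = t.toOutput.isSome := hreg 8 (by omega)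
  have r9 : a.reg 9 = t.toOutput.getD false := hreg 9 (by omega)
  have r10 : a.reg 10 = M.isQuery t.next := hreg 10 (by omega)
  clear hreg
  generalize 18 * (1 + e t.next) = u at *
  -- the work tape is changed, and the last output bit is recorded
  set W' := Function.update W d.workHead
    (if d.workHead = 0 then (W d.workHead).1 else t.write, (W d.workHead).2) with hW'
  set out' := (d.output ++ t.toOutput.toList).getLastD false with hout'
  have s1 : (diagConf { a with ph := .doW } P W p 0 i d.workHead
      d.oracleTape.length d.oracleTape l).step V O
      diagOp = diagConf { a with ph := .doI, out := out' } P W' p 0 i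
        (moveUnbounded t.workMove d.workHead)
        d.oracleTape.length d.oracleTape l := by
    rw [step_tape_three (hop := rfl) (hr := if_neg (by simp [r0]))]
    dsimp only
    rw [r8, r9, r4, r5, r1, hd.out, ← getLastD_append_toList, decodeMove_moveBits,
      moveClamped_of_lt _ hw]
    simp only [decide_eq_true_eq]
    rfl
  -- the input head is moved, within its group of cells or to another group
  obtain ⟨⟨r', m'⟩, hr'⟩ : ∃ r, moveInput (decide (i = 0)) (decide (i + 1 = V)) a.r t.inMove = r :=
    ⟨_, rfl⟩
  obtain ⟨g1, g2, g3⟩ := hd.moveInput t.inMove hr'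
  set i' := moveClamped V m' i
  have s2 : (diagConf { a with ph := .doI, out := out' } P W' p 0 i
    (moveUnbounded t.workMove d.workHead)
      d.oracleTape.length d.oracleTape l).step V O diagOp =
      diagConf { a with ph := .doY, out := out', r := r' } P W' p 0 i'
        (moveUnbounded t.workMove d.workHead)
        d.oracleTape.length d.oracleTape l := by
    rw [step_tape_two (hop := rfl) (hr := rfl)]
    dsimp only
    rw [r2, r3, decodeMove_moveBits, hr']
  -- the query grows by at most one bit; its length is less than `V`, so it is not cut off
  set y' := d.oracleTape ++ t.toOracle.toList with hy'
  have s3 : ∃ m ≤ 2, Conf.Run V O diagOp Active m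
      (diagConf { a with ph := .doY, out := out', r := r' } P W' p 0 i'
        (moveUnbounded t.workMove d.workHead)
        d.oracleTape.length d.oracleTape l)
      (diagConf { a with ph := .unary, out := out', r := r' } P W' p 0 i'
        (moveUnbounded t.workMove d.workHead)
        y'.length y' l) := by
    cases ht : t.toOracle with
    | none =>
      refine ⟨1, by omega, .head rfl ?_ (.refl _)⟩
      rw [step_tape_four (hop := rfl) (hr := if_neg (by simp [r6, ht]))]
      simp [hy', ht, moveClamped]
    | some b =>
      refine ⟨2, le_rfl, .head rfl
        (c' := diagConf { a with ph := .appY, out := out', r := r' } P W' p 0 i'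
        (moveUnbounded t.workMove d.workHead) (d.oracleTape.length + 1) d.oracleTape l) ?_
        (.head rfl ?_ (.refl _))⟩
      · rw [step_tape_four (hop := rfl) (hr := if_pos (by simp [r6, ht]; omega)), moveClamped,
          if_pos ho]
      · simp only [Conf.step, diagConf, diagOp]
        simp [hy', ht, r7]
  obtain ⟨m, hm, s3⟩ := s3
  -- the number of the next state is copied to tape 1
  have s4 := run_unary (O := O) { a with out := out', r := r' } P W' p 0 i'
    (moveUnbounded t.workMove d.workHead) y'.length y' l hu hp (by omega)
  rw [Nat.zero_add] at s4
  have hmod : Models V (M.apply x d t) { a with out := out', r := r' } W' i' := by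
    refine ⟨g1, g2, by rw [← g3, ← hx]; rfl, fun j => ?_, hd.ans, rfl⟩
    simp only [Transducer.apply]
    cases hw0 : d.workHead with
    | zero => rw [hW', hw0, Function.update_of_ne (by omega)]; exact hd.work j
    | succ k =>
      rw [hW', hw0, writeWork]
      by_cases hj : j = k
      · subst hj; simp
      · rw [Function.update_of_ne (by omega), Function.update_of_ne hj]; exact hd.work j
  -- the oracle is consulted if the next state is a query state
  by_cases hq : M.isQuery t.next
  · have hc : M.consult O (M.apply x d t) =
      { M.apply x d t with answer := O y', oracleTape := [] } :=
      if_pos hq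
    have s5 := run_rewY (V := V) (O := O) { a with out := out', r := r', ans := O y' } P W'
      (p + u) u i'
      (moveUnbounded t.workMove d.workHead) y'.length [] l
    refine ⟨m + (2 * u + (y'.length + 1 + 1 + 1)) + 1 + 1, ?_,
      { a with out := out', r := r', ans := O y' },
      W', i', ?_, .head (by rfl) s1 (.head (by rfl) s2
        (s3.trans (s4.trans (.head (by rfl) (c' := diagConf
        { a with ph := .askY, out := out', r := r' } P W' (p + u) u i'
          (moveUnbounded t.workMove d.workHead) y'.length y' l) ?_ (.head (by rfl) (c' := diagConf
        { a with ph := .rewY, out := out', r := r', ans := O y' } P W' (p + u) u i'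
          (moveUnbounded t.workMove d.workHead) y'.length [] l) (by rfl) ?_)))))⟩
    · have : y'.length ≤ d.oracleTape.length + 1 := by
        rw [hy']; cases t.toOracle <;> simp
      omega
    · rw [hc]; exact ⟨hmod.lt, hmod.low, hmod.inHead, hmod.work, rfl, hmod.out⟩
    · rw [step_tape_zero' (hop := rfl) (hr := if_neg (by simp [hu']))]
      simp [r10, hq, moveClamped]
    · rw [hc]; exact s5
  · have hc : M.consult O (M.apply x d t) = M.apply x d t := if_neg hq
    rw [hc]
    refine ⟨m + (2 * u + 1) + 1 + 1, by omega, { a with out := out', r := r' }, W', i', hmod,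
      .head (by rfl) s1 (.head (by rfl) s2 (s3.trans (s4.trans (.head (by rfl) ?_ (.refl _)))))⟩
    rw [step_tape_zero' (hop := rfl) (hr := if_neg (by simp [hu']))]
    simp [r10, hq, moveClamped]
    rfl

end

/-! ### Simulating a transducer -/

section

variable {V : ℕ} {O : Oracle} {M : Transducer}

/-- What happens when the record with number `t` applies. As `t` determines a state, the symbols
seen and the oracle output bit, this inverts the numbering of the records. -/
def Transducer.action (M : Transducer) {m : ℕ} (e : M.Q ≃ Fin m) (t : ℕ) :
    Option (TransducerAction M.Q) :=
  if t < 18 then some M.startAction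
  else if h : t / 18 - 1 < m then
    M.δ (e.symm ⟨t / 18 - 1, h⟩) (inCell (t % 18 / 6)) (workCell (t % 18 / 2 % 3))
      (decide (t % 18 % 2 = 1))
  else none

/-- The program of a transducer. The first 18 records enter the initial state, the next ones are
those of the states, and those of a state are numbered by the symbols that the machine sees. -/
def Transducer.program (M : Transducer) {m : ℕ} (e : M.Q ≃ Fin m) (t : ℕ) : Record :=
  M.actRecord (fun q => (e q : ℕ)) (M.action e t)

theorem Transducer.action_state {m : ℕ} (e : M.Q ≃ Fin m) (q : M.Q) {i w : ℕ} (b : Bool)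
    (hi : i ≤ 2)
    (hw : w ≤ 2) : M.action e (18 * (1 + (e q : ℕ)) + (6 * i + 2 * w + b.toNat)) =
      M.δ q (inCell i) (workCell w) b := by
  have hb := Bool.toNat_lt b
  have h1 : (18 * (1 + (e q : ℕ)) + (6 * i + 2 * w + b.toNat)) / 18 - 1 = e q := by omega
  have h2 : (18 * (1 + (e q : ℕ)) + (6 * i + 2 * w + b.toNat)) % 18 =
    6 * i + 2 * w + b.toNat := by omega
  have h3 : decide ((6 * i + 2 * w + b.toNat) % 2 = 1) = b := by cases b <;> simp <;> omega
  rw [action, if_neg (by omega), dif_pos (by omega)]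
  simp only [h1, h2, h3, Fin.eta, Equiv.symm_apply_apply]
  rw [show (6 * i + 2 * w + b.toNat) / 6 = i by omega,
    show (6 * i + 2 * w + b.toNat) / 2 % 3 = w by omega]

/-- The diagonal machine is about to simulate a step of the transducer in configuration `d`, where
the oracle has already been consulted. -/
def Simulates (V : ℕ) {m : ℕ} (e : M.Q ≃ Fin m) (d : M.Cfg) (c : Conf Diag) : Prop :=
  ∃ a W i p, p < V ∧ Models V d a W i ∧
    c = diagConf { a with ph := .readI } (number V) W p (18 * (1 + (e d.state : ℕ))) i d.workHead
      d.oracleTape.length d.oracleTape (6 + V.size)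

theorem Transducer.step_eq (x : List Bool) (c : M.Cfg) :
    M.step O x c = (M.δ (M.consult O c).state (readTape x (M.consult O c).inHead)
      (readWork (M.consult O c).work (M.consult O c).workHead) (M.consult O c).answer).map
      (M.apply x (M.consult O c)) := rfl

theorem recordIdx_state {m : ℕ} (e : M.Q ≃ Fin m) (q : M.Q) (a : Diag) (W : ℕ → Bool × Bool)
    (i w : ℕ) :
    18 * (1 + (e q : ℕ)) + recordIdx V a W i w < 18 * (m + 1) := by
  have := recordIdx_lt (V := V) a W i w
  have := (e q).2
  omega

theorem action_of_models {m : ℕ} (e : M.Q ≃ Fin m) {d : M.Cfg} {a : Diag} {W : ℕ → Bool × Bool}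
    {i : ℕ} (hd : Models V d a W i) :
    M.action e (18 * (1 + (e d.state : ℕ)) + recordIdx V a W i d.workHead) =
      M.δ d.state (readTape (zeros (64 * V + 1)) d.inHead) (readWork d.work d.workHead)
        d.answer := by
  rw [recordIdx, M.action_state e d.state a.ans (inputSym_le _ _ _) (workSym_le _ _), hd.readTape,
    hd.readWork, hd.ans]

section
variable {m : ℕ} {e : M.Q ≃ Fin m} (hP : Holds V (number V) (M.program e) (18 * (m + 1)))
include hP

/-- The diagonal machine simulates the record that applies. -/
theorem run_record {d : M.Cfg} {a : Diag} {W : ℕ → Bool × Bool} {i p x : ℕ} (hp : p < V)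
    (hx : x + recordIdx V a W i d.workHead < 18 * (m + 1)) (hd : Models V d a W i)
    (hw : d.workHead + 1 < V) (ho : d.oracleTape.length + 1 < V) {t : TransducerAction M.Q}
    (ht : M.action e (x + recordIdx V a W i d.workHead) = some t) :
    ∃ n ≤ 8 * V + 80, ∃ c', Simulates V e (M.consult O (M.apply (zeros (64 * V + 1)) d t)) c' ∧
      Conf.Run V O diagOp Active n (diagConf { a with ph := .readI } (number V) W p x i d.workHead
        d.oracleTape.length d.oracleTape (6 + V.size)) c' := by
  obtain ⟨n₁, hn₁, reg, k, hreg, h₁⟩ := run_fetch (O := O) a (number V) W p x i d.workHead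
    d.oracleTape.length d.oracleTape (6 + V.size) hP hp hx
  generalize x + recordIdx V a W i d.workHead = r at *
  have hrec : M.program e r = M.actRecord (fun q => (e q : ℕ)) (some t) := by
    rw [Transducer.program, ht]
  have hnxt : (M.program e r).nxt = 1 + (e t.next : ℕ) := by rw [hrec]; rfl
  have hlt := hP.lt
  have hle : offset (M.program e) (r + 1) ≤ offset (M.program e) (18 * (m + 1)) := offset_mono _ hx
  have hoff := offset_succ (M.program e) r
  rw [hnxt] at hoff
  obtain ⟨n₂, hn₂, a', W', i', hd', h₂⟩ := run_action (O := O) (x := zeros (64 * V + 1)) (V := V)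
    (by simp [zeros]) (a := { a with k := k, reg := reg }) (W := W) (i := i)
    ⟨hd.lt, hd.low, hd.inHead, hd.work, hd.ans, hd.out⟩ (e := fun q => (e q : ℕ)) (t := t)
    (fun j hj => by rw [← hrec]; exact hreg j hj) (P := number V) (p := offset (M.program e) r + 11)
    (l := 6 + V.size)
    (fun j hj => hP.nxt r hx j (by rw [hnxt]; exact hj))
    (by have := hP.fin r hx; rwa [hnxt] at this) (by omega) hw ho
  refine ⟨n₁ + n₂, by omega, _, ⟨a', W', i',
    offset (M.program e) r + 11 + 18 * (1 + (e t.next : ℕ)),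
    by omega, hd', ?_⟩, h₁.trans h₂⟩
  have : (M.consult O (M.apply (zeros (64 * V + 1)) d t)).state = t.next := by
    unfold Transducer.consult; split_ifs <;> rfl
  rw [this]

/-- The diagonal machine enters the initial state of the transducer. -/
theorem run_start (hV : 1 < V) :
    ∃ n ≤ 8 * V + 80, ∃ c', Simulates V e (M.consult O M.init) c' ∧
      Conf.Run V O diagOp Active n (simStart V) c' := by
  have hd : Models V M.init Diag.start blank 0 :=
    ⟨by omega, fun _ => by decide, rfl, fun _ => rfl, rfl, rfl⟩
  have hidx := recordIdx_lt (V := V) Diag.start blank 0 0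
  have := run_record (O := O) hP (d := M.init) (p := 0) (x := 0) (by omega)
    (by simp only [Transducer.init]; omega) hd (by simpa [Transducer.init] using hV)
    (by simpa [Transducer.init] using hV) (t := M.startAction)
    (by simp only [Transducer.init]; rw [Transducer.action, if_pos (by omega)])
  have h : M.apply (zeros (64 * V + 1)) M.init M.startAction = M.init := by
    simp [Transducer.apply, Transducer.startAction, Transducer.init, writeWork, moveUnbounded,
      moveBounded]
  rwa [h] at this

/-- The diagonal machine simulates a step of the transducer. -/
theorem run_step {c c' : M.Cfg} (h : M.step O (zeros (64 * V + 1)) c = some c') {s : Conf Diag}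
    (hs : Simulates V e (M.consult O c) s) (hw : (M.consult O c).workHead + 1 < V)
    (ho : (M.consult O c).oracleTape.length + 1 < V) :
    ∃ n ≤ 8 * V + 80, ∃ s', Simulates V e (M.consult O c') s' ∧
      Conf.Run V O diagOp Active n s s' := by
  obtain ⟨a, W, i, p, hp, hd, rfl⟩ := hs
  rw [Transducer.step_eq, Option.map_eq_some_iff] at h
  obtain ⟨t, ht, rfl⟩ := h
  exact run_record hP hp (recordIdx_state e _ _ _ _ _) hd hw ho
    ((action_of_models e hd).trans ht)

/-- When the transducer halts, so does the diagonal machine, which then knows the last output bit.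
-/
theorem run_halt {c : M.Cfg} (h : M.step O (zeros (64 * V + 1)) c = none) {s : Conf Diag}
    (hs : Simulates V e (M.consult O c) s) :
    ∃ n ≤ 8 * V + 80, ∃ s', s'.a.done = true ∧ s'.a.out = c.output.getLastD false ∧
      Conf.Run V O diagOp Active n s s' := by
  obtain ⟨a, W, i, p, hp, hd, rfl⟩ := hs
  rw [Transducer.step_eq, Option.map_eq_none_iff] at h
  have hact := (action_of_models e hd).trans h
  have hx := recordIdx_state (V := V) e (M.consult O c).state a W i (M.consult O c).workHead
  obtain ⟨n, hn, reg, k, hreg, hr⟩ := run_fetch (O := O) a (number V) W p _ i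
    (M.consult O c).workHead
    (M.consult O c).oracleTape.length (M.consult O c).oracleTape (6 + V.size) hP hp hx
  have h0 : reg 0 = true := by
    have := hreg 0 (by omega)
    rw [Transducer.program, hact] at this
    exact this
  have hout : (M.consult O c).output = c.output := by
    unfold Transducer.consult; split_ifs <;> rfl
  refine ⟨n + (0 + 1), by omega, _, ?_, ?_, hr.trans (.head (by rfl)
    ((step_tape_three (hop := rfl) (hr := if_pos h0) ..)) (.refl _))⟩
  · rfl
  · rw [← hout, ← hd.out]; rfl

end

/-- A computation as a sequence of configurations. -/
theorem exists_trajectory {α : Type} {f : α → Option α} {a b : α}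
    (h : StateTransition.Reaches f a b) :
    ∃ (n : ℕ) (c : ℕ → α), c 0 = a ∧ c n = b ∧ ∀ k < n, f (c k) = some (c (k + 1)) := by
  induction h with
  | refl => exact ⟨0, fun _ => a, rfl, rfl, by simp⟩
  | tail _ h ih =>
    rename_i b b' _
    obtain ⟨n, c, h0, hn, hc⟩ := ih
    refine ⟨n + 1, fun k => if k ≤ n then c k else b', by simp [h0], by simp, fun k hk => ?_⟩
    by_cases hk' : k = n
    · subst hk'; simpa [hn] using h
    · dsimp only
      rw [if_pos (by omega), if_pos (by omega), hc k (by omega)]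

theorem reaches_trajectory {α : Type} {f : α → Option α} {c : ℕ → α} {n : ℕ}
    (hc : ∀ k < n, f (c k) = some (c (k + 1))) : ∀ k ≤ n, StateTransition.Reaches f (c 0)
      (c k) := by
  intro k hk
  induction k with
  | zero => exact .refl
  | succ k ih => exact (ih (by omega)).tail (hc k (by omega))

/-- If the transducer whose program is `V` halts on `0^{64 V + 1}` before the clock overflows, then
the diagonal machine gives the opposite of its last output bit. -/
theorem accepts_of_trajectory {m : ℕ} {e : M.Q ≃ Fin m}
    (hP : Holds V (number V) (M.program e) (18 * (m + 1))) (hV : 1 < V) {n : ℕ} {c : ℕ → M.Cfg}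
    (h0 : c 0 = M.init) (hc : ∀ k < n, M.step O (zeros (64 * V + 1)) (c k) = some (c (k + 1)))
    (hn : M.step O (zeros (64 * V + 1)) (c n) = none)
    (hw : ∀ k ≤ n, (c k).workHead + 1 < V ∧ (c k).oracleTape.length + 1 < V)
    (hlt : (8 * V + 80) * (n + 2) < 2 ^ V) :
    accepts O (64 * V + 1) = !(c n).output.getLastD false := by
  have hcons : ∀ d : M.Cfg, (M.consult O d).workHead = d.workHead ∧
      (M.consult O d).oracleTape.length ≤ d.oracleTape.length := by
    intro d; unfold Transducer.consult; split_ifs <;> simp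
  have H : ∀ k ≤ n, ∃ r ≤ (8 * V + 80) * (k + 1), ∃ s, Simulates V e (M.consult O (c k)) s ∧
      Conf.Run V O diagOp Active r (simStart V) s := by
    intro k hk
    induction k with
    | zero =>
      obtain ⟨r, hr, s, h⟩ := run_start (O := O) hP hV
      exact ⟨r, by omega, s, by rwa [h0]⟩
    | succ k ih =>
      obtain ⟨r, hr, s, hs, hrun⟩ := ih (by omega)
      have h1 := hw k (by omega)
      have h2 := hcons (c k)
      obtain ⟨r', hr', s', hs', hrun'⟩ := run_step hP (hc k (by omega)) hs (by omega) (by omega)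
      exact ⟨r + r', by rw [mul_add_one (8 * V + 80) (k + 1)]; omega, s', hs', hrun.trans hrun'⟩
  obtain ⟨r, hr, s, hs, hrun⟩ := H n le_rfl
  obtain ⟨r', hr', s', hd, hout, hrun'⟩ := run_halt hP hn hs
  have hfin := hrun.trans hrun'
  have hle : r + r' ≤ 2 ^ V - 1 := by
    rw [show n + 2 = n + 1 + 1 by omega, mul_add_one (8 * V + 80) (n + 1)] at hlt
    omega
  have := Conf.clocked_eq (V := V) (O := O) (op := diagOp) (done := Diag.done)
    (ovf := Diag.overflow)
    hle (c := simStart V) (by rw [hfin.1]; exact hd) hfin.2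
  rw [accepts, if_neg (by omega), show (64 * V + 1 - 1) / 64 = V by omega, this, hfin.1, hout]

end

/-! ### Counting configurations -/

section

variable {O : Oracle} {M : Transducer}

/-- A configuration without its output. -/
def Transducer.Cfg.core (c : M.Cfg) : M.Cfg := { c with output := [] }

/-- The output does not influence the computation. -/
theorem Transducer.core_step (x : List Bool) (c : M.Cfg) :
    (M.step O x c).map Cfg.core = (M.step O x c.core).map Cfg.core := by
  have h : M.consult O c.core = (M.consult O c).core := by
    by_cases hq : M.isQuery c.state <;> simp [consult, Cfg.core, hq]
  simp only [step_eq, h, Option.map_map]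
  rfl

/-- In a halting computation no configuration, disregarding its output, occurs twice. -/
theorem core_injOn {x : List Bool} {n : ℕ} {c : ℕ → M.Cfg}
    (hc : ∀ k < n, M.step O x (c k) = some (c (k + 1))) (hn : M.step O x (c n) = none) :
    ∀ i j, i < j → j ≤ n → (c i).core ≠ (c j).core := by
  intro i j hij hj h
  have hstep : ∀ a b : M.Cfg, a.core = b.core →
      (M.step O x a).map Transducer.Cfg.core = (M.step O x b).map Transducer.Cfg.core := by
    intro a b hab; rw [Transducer.core_step, hab, ← Transducer.core_step]
  have key : ∀ k, j + k ≤ n → (c (i + k)).core = (c (j + k)).core := by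
    intro k hk
    induction k with
    | zero => exact h
    | succ k ih =>
      have := hstep _ _ (ih (by omega))
      rw [hc _ (by omega), hc _ (by omega)] at this
      exact Option.some.inj this
  have := hstep _ _ (key (n - j) (by omega))
  rw [show j + (n - j) = n by omega, hn, hc _ (by omega)] at this
  simp at this

/-- A halting computation in space `s` is no longer than the number of configurations, disregarding
the output. The factors stand for the state, the input head, the contents of the work tape, the work
head, the length and the contents of the oracle tape, and the oracle output bit. -/
theorem card_trajectory_le {x : List Bool} {n s : ℕ} {c : ℕ → M.Cfg} (h0 : c 0 = M.init)
    (hc : ∀ k < n, M.step O x (c k) = some (c (k + 1))) (hn : M.step O x (c n) = none)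
    (hs : ∀ k ≤ n, (c k).workHead ≤ s ∧ (c k).oracleTape.length ≤ s) :
    n + 1 ≤ Nat.card M.Q * (x.length + 2) * (2 ^ s) * (s + 1) * (s + 1) * (2 ^ s) * 2 := by
  have := M.finite
  have := Fintype.ofFinite M.Q
  have hfield : ∀ d : M.Cfg, (M.consult O d).inHead = d.inHead ∧ (M.consult O d).work = d.work ∧
      (M.consult O d).workHead = d.workHead := by
    intro d; unfold Transducer.consult; split_ifs <;> simp
  -- work cells beyond the space bound are never changed
  have hinv : ∀ k ≤ n, (c k).inHead < x.length + 2 ∧ ∀ j ≥ s, (c k).work j = false := by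
    intro k hk
    induction k with
    | zero => rw [h0]; exact ⟨Nat.succ_pos _, fun _ _ => rfl⟩
    | succ k ih =>
      obtain ⟨h1, h2⟩ := ih (by omega)
      have h3 := hc k (by omega)
      rw [Transducer.step_eq, Option.map_eq_some_iff] at h3
      obtain ⟨t, -, h3⟩ := h3
      obtain ⟨f1, f2, f3⟩ := hfield (c k)
      rw [← h3]
      refine ⟨?_, fun j hj => ?_⟩
      · simp only [Transducer.apply, f1]
        cases t.inMove <;> simp only [moveBounded] <;> omega
      · simp only [Transducer.apply, f2, f3]
        have hs' := (hs k (by omega)).1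
        cases hw : (c k).workHead with
        | zero => exact h2 j hj
        | succ w => rw [writeWork, Function.update_of_ne (by omega)]; exact h2 j hj
  -- the data that determine a configuration, disregarding its output
  let F : Fin (n + 1) → M.Q × Fin (x.length + 2) × (Fin s → Bool) × Fin (s + 1) × Fin (s + 1) ×
      (Fin s → Bool) × Bool := fun k =>
    ((c k).state, ⟨(c k).inHead, (hinv k (by omega)).1⟩, fun j => (c k).work j,
      ⟨(c k).workHead, by have := (hs k (by omega)).1; omega⟩,
      ⟨(c k).oracleTape.length, by have := (hs k (by omega)).2; omega⟩,
      fun j => (c k).oracleTape.getD j false, (c k).answer)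
  have hF : ∀ k k', F k = F k' → (c k).core = (c k').core := by
    intro k k' h
    simp only [F, Prod.mk.injEq, Fin.mk.injEq] at h
    obtain ⟨e1, e2, e3, e4, e5, e6, e7⟩ := h
    have e3' : (c k).work = (c k').work := by
      funext j
      by_cases hj : j < s
      · exact congrFun e3 ⟨j, hj⟩
      · rw [(hinv k (by omega)).2 j (by omega), (hinv k' (by omega)).2 j (by omega)]
    have e6' : (c k).oracleTape = (c k').oracleTape := by
      refine List.ext_getElem e5 fun j hj hj' => ?_
      have := congrFun e6 ⟨j, hj.trans_le (hs k (by omega)).2⟩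
      simpa [hj, hj'] using this
    simp only [Transducer.Cfg.core, e1, e2, e3', e4, e6', e7]
  have hinj : Function.Injective F := by
    intro k k' h
    have hcore := hF k k' h
    rcases lt_trichotomy k.1 k'.1 with hlt | heq | hgt
    · exact absurd hcore (core_injOn hc hn _ _ hlt (by omega))
    · exact Fin.ext heq
    · exact absurd hcore.symm (core_injOn hc hn _ _ hgt (by omega))
  have := Fintype.card_le_of_injective F hinj
  simp only [Fintype.card_prod, Fintype.card_fin, Fintype.card_fun, Fintype.card_bool,
    ← Nat.card_eq_fintype_card (α := M.Q)] at this
  calc _ ≤ _ := this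
    _ = _ := by ring

theorem exists_mul_pow_le (C k : ℕ) : ∃ m₀, ∀ m ≥ m₀, C * m ^ k ≤ 2 ^ m := by
  have h := tendsto_pow_const_div_const_pow_of_one_lt k (show (1 : ℝ) < 2 by norm_num)
  have h' := h.const_mul (C : ℝ)
  rw [mul_zero] at h'
  obtain ⟨m₀, hm⟩ := eventually_atTop.1 (h'.eventually (gt_mem_nhds one_pos))
  refine ⟨m₀, fun m hm' => ?_⟩
  have h2 := hm m hm'
  rw [← mul_div_assoc, div_lt_one (by positivity)] at h2
  exact_mod_cast h2.le

/-- If a transducer with `q` states halts in space `s ≤ V / 8`, then its simulation takes less than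
`2 ^ V` steps of the diagonal machine, as the number of configurations is `O(V ^ 3 * 2 ^ (V / 4))`.
-/
theorem exists_clock_bound (q : ℕ) : ∃ V₀, ∀ V ≥ V₀, ∀ s n, 8 * s ≤ V →
    n + 1 ≤ q * (64 * V + 1 + 2) * 2 ^ s * (s + 1) * (s + 1) * 2 ^ s * 2 →
    (8 * V + 80) * (n + 2) < 2 ^ V := by
  obtain ⟨m₀, hm₀⟩ := exists_mul_pow_le (81 * (88 * (536 * q + 1))) 4
  refine ⟨2 * m₀ + 4, fun V hV s n hs hn => ?_⟩
  have h1 := hm₀ (V / 2) (by omega)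
  have hV3 : V ≤ 3 * (V / 2) := by omega
  have hV1 : 1 ≤ V := by omega
  have e1 : n + 2 ≤ (536 * q + 1) * V ^ 3 * (2 ^ s * 2 ^ s) := by
    have a1 : q * (64 * V + 1 + 2) * 2 ^ s * (s + 1) * (s + 1) * 2 ^ s * 2 ≤
        q * (67 * V) * 2 ^ s * (2 * V) * (2 * V) * 2 ^ s * 2 := by
      gcongr <;> omega
    have a2 : q * (67 * V) * 2 ^ s * (2 * V) * (2 * V) * 2 ^ s * 2 =
        536 * q * V ^ 3 * (2 ^ s * 2 ^ s) := by ring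
    have a3 : 1 ≤ V ^ 3 * (2 ^ s * 2 ^ s) := Nat.one_le_iff_ne_zero.2 (by positivity)
    have a4 : (536 * q + 1) * V ^ 3 * (2 ^ s * 2 ^ s) =
        536 * q * V ^ 3 * (2 ^ s * 2 ^ s) + V ^ 3 * (2 ^ s * 2 ^ s) := by ring
    omega
  have e2 : (8 * V + 80) * (n + 2) ≤ (88 * (536 * q + 1)) * V ^ 4 * (2 ^ s * 2 ^ s) := by
    calc (8 * V + 80) * (n + 2) ≤ (88 * V) * ((536 * q + 1) * V ^ 3 * (2 ^ s * 2 ^ s)) := by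
          gcongr; omega
      _ = _ := by ring
  have e3 : (88 * (536 * q + 1)) * V ^ 4 ≤ 2 ^ (V / 2) := by
    calc (88 * (536 * q + 1)) * V ^ 4 ≤ (88 * (536 * q + 1)) * (3 * (V / 2)) ^ 4 := by gcongr
      _ = 81 * (88 * (536 * q + 1)) * (V / 2) ^ 4 := by ring
      _ ≤ _ := h1
  calc (8 * V + 80) * (n + 2) ≤ 2 ^ (V / 2) * (2 ^ s * 2 ^ s) := e2.trans (by gcongr)
    _ = 2 ^ (V / 2 + s + s) := by rw [pow_add, pow_add]; ring
    _ < 2 ^ V := Nat.pow_lt_pow_right (by omega) (by omega)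

/-- A transducer that works in sublinear space does not compute the language of the diagonal machine
in the last bits of its outputs: it fails on `0^{64 V + 1}`, where `V` is a large number whose
binary expansion starts with its program. -/
theorem not_computes_of_sublinear {s : ℕ → ℕ} (hs : Sublinear s) {f : List Bool → List Bool}
    (hf : ∀ n, (f (zeros (n + 1))).getLastD false = accepts O (n + 1)) : ¬ M.Computes O s f := by
  intro hM
  have := M.finite
  let e := Finite.equivFin M.Q
  set m := Nat.card M.Q
  obtain ⟨V₁, hV₁⟩ := exists_clock_bound m
  obtain ⟨N₀, hN₀⟩ := eventually_atTop.1 (hs.bound (show (0 : ℝ) < 1 / 1024 by norm_num))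
  -- a number whose digits start with the program of the transducer
  obtain ⟨V, hV, hbit⟩ := exists_number (progWord (M.program e) (18 * (m + 1)))
    (V₁ + N₀ + 16 + offset (M.program e) (18 * (m + 1)))
  have hP : Holds V (number V) (M.program e) (18 * (m + 1)) :=
    holds_of_prefix (by omega) fun k hk => hbit k hk
  -- a transducer in space `s (n) ≤ n / 1024` uses at most `V / 8` cells for `n = 64 V + 1`
  have hsV : 8 * s (64 * V + 1) ≤ V := by
    have h := hN₀ (64 * V + 1) (by omega)
    simp only [Real.norm_natCast] at h
    have h' : ((1024 * s (64 * V + 1) : ℕ) : ℝ) ≤ ((64 * V + 1 : ℕ) : ℝ) := by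
      rw [Nat.cast_mul]; push_cast at h ⊢; linarith
    have := Nat.cast_le.1 h'
    omega
  obtain ⟨hspace, c', hreach, hhalt, hout⟩ := hM (zeros (64 * V + 1))
  have hlen : (zeros (64 * V + 1)).length = 64 * V + 1 := by simp [zeros]
  rw [hlen] at hspace
  obtain ⟨n, c, h0, rfl, hc⟩ := exists_trajectory hreach
  have hsp : ∀ k ≤ n, (c k).workHead ≤ s (64 * V + 1) ∧ (c k).oracleTape.length ≤ s (64 * V + 1) :=
    fun k hk => hspace _ (by rw [← h0]; exact reaches_trajectory hc k hk)
  have hcard := card_trajectory_le h0 hc hhalt hsp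
  rw [hlen] at hcard
  have hacc := accepts_of_trajectory hP (by omega) h0 hc hhalt
    (fun k hk => by have := hsp k hk; omega) (hV₁ V (by omega) _ n hsV hcard)
  rw [hout, hf] at hacc
  cases h : accepts O (64 * V + 1) <;> simp [h] at hacc

end

/-! ### Separations -/

section

variable {O : Oracle}

theorem sublinear_clog (k : ℕ) : Sublinear fun n => k * Nat.clog 2 n := by
  have h1 : (fun n : ℕ => Real.log n + 1) =o[atTop] (fun n : ℕ => (n : ℝ)) := by
    have h := Real.isLittleO_log_id_atTop.add (isLittleO_const_id_atTop (1 : ℝ))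
    exact h.comp_tendsto tendsto_natCast_atTop_atTop
  unfold Sublinear
  push_cast
  refine IsBigO.trans_isLittleO (IsBigO.of_bound (k * (1 / Real.log 2 + 1)) ?_) h1
  filter_upwards [eventually_ge_atTop 1] with n hn
  have hn' : (1 : ℝ) ≤ n := by exact_mod_cast hn
  have hl : 0 ≤ Real.log n := Real.log_nonneg hn'
  have h2 : (0 : ℝ) < Real.log 2 := Real.log_pos (by norm_num)
  have h3 : (Nat.clog 2 n : ℝ) ≤ Real.log n / Real.log 2 + 1 := by
    have : Nat.clog 2 n ≤ Nat.log 2 n + 1 :=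
      Nat.clog_le_of_le_pow (Nat.lt_pow_succ_log_self (by norm_num) n).le
    have h4 : (Nat.clog 2 n : ℝ) ≤ Nat.log 2 n + 1 := by exact_mod_cast this
    have h5 : (Nat.log 2 n : ℝ) ≤ Real.logb 2 n := by exact_mod_cast Real.natLog_le_logb n 2
    rw [Real.logb] at h5
    linarith
  rw [Real.norm_of_nonneg (by positivity), Real.norm_of_nonneg (by positivity), mul_assoc]
  refine mul_le_mul_of_nonneg_left (h3.trans ?_) (by positivity)
  have : 0 < 1 / Real.log 2 := by positivity
  rw [div_eq_mul_one_div]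
  nlinarith

theorem FLRel_subset : FLRel O ⊆ FSPACESublinearRel O := by
  rintro f ⟨k, hk⟩
  exact ⟨_, sublinear_clog k, hk⟩

theorem diagLang_notMem : diagLang O ∉ SPACESublinearRel O := by
  rintro ⟨s, hs, M, hM⟩
  exact not_computes_of_sublinear hs (fun n => by simp [indicator, zeros_mem_diagLang]) hM

theorem diagPerm_notMem : diagPerm O ∉ FSPACESublinearRel O := by
  rintro ⟨s, hs, M, hM⟩
  refine not_computes_of_sublinear hs (fun n => ?_) hM
  have : zeros (n + 1) = zeros n ++ [false] := List.replicate_succ'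
  rw [this]
  -- on `0^n` the last bit of the output tells whether `n` is accepted
  change (diagFlip O (zeros n ++ [false])).getLastD false = _
  rw [diagFlip_zeros]
  simp

/-! ### Machines without oracle access -/

/-- The machine that makes no queries and does not write on the oracle tape; with an oracle that is
constantly `false`, it does the same as `M`, whose oracle output bit is always `false`. -/
def Transducer.strip (M : Transducer) : Transducer where
  Q := M.Q
  finite := M.finite
  start := M.start
  isQuery := fun _ => false
  δ q c w _ := (M.δ q c w false).map fun t => { t with toOracle := none }

/-- A configuration of `M` as a configuration of `M.strip`, with an empty oracle tape. -/
def Transducer.stripCfg (M : Transducer) (c : M.Cfg) : M.strip.Cfg :=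
  ⟨c.state, c.inHead, c.work, c.workHead, [], false, c.output⟩

theorem Transducer.step_strip (M : Transducer) (x : List Bool) (c : M.Cfg) (hc : c.answer = false) :
    M.strip.step (fun _ => false) x (M.stripCfg c) =
      (M.step (fun _ => false) x c).map M.stripCfg := by
  have h : M.strip.consult (fun _ => false) (M.stripCfg c) = M.stripCfg c :=
    if_neg (by simp [strip])
  have h' : ∃ y, M.consult (fun _ => false) c = { c with answer := false, oracleTape := y } := by
    unfold consult
    split_ifs
    · exact ⟨_, rfl⟩
    · exact ⟨c.oracleTape, by rw [← hc]⟩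
  obtain ⟨y, h'⟩ := h'
  simp only [step, h, h']
  simp only [strip, stripCfg]
  cases M.δ c.state (readTape x c.inHead) (readWork c.work c.workHead) false <;> rfl

theorem Transducer.answer_step {M : Transducer} {x : List Bool} {c c' : M.Cfg}
    (hc : c.answer = false) (h : M.step (fun _ => false) x c = some c') : c'.answer = false := by
  obtain ⟨t, -, rfl⟩ := Option.map_eq_some_iff.1 h
  unfold consult; split_ifs
  · rfl
  · exact hc

/-- A map that commutes with steps, on configurations that satisfy an invariant, commutes with
reachability. -/
theorem reaches_map {α β : Type} {f : α → Option α} {g : β → Option β} {φ : α → β} {I : α → Prop}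
    (h : ∀ a, I a → g (φ a) = (f a).map φ) (hI : ∀ a b, I a → f a = some b → I b)
    {a : α} (ha : I a) :
    (∀ c, StateTransition.Reaches f a c → I c ∧ StateTransition.Reaches g (φ a) (φ c)) ∧
    ∀ d, StateTransition.Reaches g (φ a) d → ∃ c, StateTransition.Reaches f a c ∧ I c ∧
      d = φ c := by
  constructor
  · intro c hc
    induction hc with
    | refl => exact ⟨ha, .refl⟩
    | tail _ hbc ih =>
      refine ⟨hI _ _ ih.1 hbc, ih.2.tail (Option.mem_def.2 ?_)⟩
      rw [h _ ih.1, Option.mem_def.1 hbc]; rfl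
  · intro d hd
    induction hd with
    | refl => exact ⟨a, .refl, ha, rfl⟩
    | tail _ hbc ih =>
      obtain ⟨c, hc, hIc, rfl⟩ := ih
      rw [Option.mem_def, h _ hIc, Option.map_eq_some_iff] at hbc
      obtain ⟨c', hc', rfl⟩ := hbc
      exact ⟨c', hc.tail hc', hI _ _ hIc hc', rfl⟩

theorem FSPACERel_false_subset (s : ℕ → ℕ) : FSPACERel (fun _ => false) s ⊆ FSPACE s := by
  rintro f ⟨M, hM⟩
  refine ⟨M.strip, fun _ => rfl, fun x => ?_⟩
  obtain ⟨h1, c, h2, h3, h4⟩ := hM x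
  obtain ⟨r1, r2⟩ := reaches_map (φ := M.stripCfg) (I := fun c => c.answer = false)
    (M.step_strip x) (fun _ _ => Transducer.answer_step) (show M.init.answer = false from rfl)
  refine ⟨fun d hd => ?_, M.stripCfg c, (r1 c h2).2, ?_, h4⟩
  · obtain ⟨c, hc, -, rfl⟩ := r2 d hd
    exact ⟨(h1 c hc).1, Nat.zero_le _⟩
  · rw [M.step_strip x c (r1 c h2).1, h3]; rfl

theorem FSPACE_subset (s : ℕ → ℕ) : FSPACE s ⊆ FSPACERel (fun _ => false) s :=
  fun _ ⟨M, _, hM⟩ => ⟨M, hM⟩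

/-- The machine that makes no queries, and takes the oracle output bit to be `false`. -/
def InPlaceTM.strip (M : InPlaceTM) : InPlaceTM where
  Q := M.Q
  finite := M.finite
  start := M.start
  isQuery := fun _ => false
  δ q c _ := M.δ q c false

/-- A configuration of `M` as a configuration of `M.strip`. -/
def InPlaceTM.stripCfg (M : InPlaceTM) (c : M.Cfg) : M.strip.Cfg := ⟨c.state, c.tape, c.head, false⟩

theorem InPlaceTM.step_strip (M : InPlaceTM) (c : M.Cfg) (hc : c.answer = false) :
    M.strip.step (fun _ => false) (M.stripCfg c) = (M.step (fun _ => false) c).map M.stripCfg := by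
  have h : M.strip.consult (fun _ => false) (M.stripCfg c) = M.stripCfg c :=
    if_neg (by simp [strip])
  have h' : M.consult (fun _ => false) c = { c with answer := false } := by
    unfold consult
    split_ifs
    · rfl
    · rw [← hc]
  simp only [step, h, h']
  simp only [strip, stripCfg]
  cases M.δ c.state (readTape c.tape c.head) false <;> rfl

theorem InPlaceTM.answer_step {M : InPlaceTM} {c c' : M.Cfg}
    (hc : c.answer = false) (h : M.step (fun _ => false) c = some c') : c'.answer = false := by
  obtain ⟨t, -, rfl⟩ := Option.map_eq_some_iff.1 h
  unfold consult; split_ifs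
  · rfl
  · exact hc

theorem inplaceFLRel_false_subset : inplaceFLRel (fun _ => false) ⊆ inplaceFL := by
  rintro f ⟨k, M, hM⟩
  refine ⟨k, M.strip, fun _ => rfl, fun x => ?_⟩
  obtain ⟨c, h2, h3, h4⟩ := hM x
  have h := ((reaches_map (φ := M.stripCfg) (I := fun c => c.answer = false) M.step_strip
    (fun _ _ => InPlaceTM.answer_step) (by rfl)).1 c h2)
  exact ⟨M.stripCfg c, h.2, by rw [M.step_strip c h.1, h3]; rfl, h4⟩

end

end InPlace

theorem mainTheorem9 :
    ((∃ (L : Set (List Bool)) (f : InPlace.FunFamily),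
        InPlace.IsUnary L ∧
        L ∈ InPlace.SPACE (fun n => n) ∧
        L ∉ InPlace.SPACESublinear ∧
        InPlace.FlipsLastBitBy f.toFun L ∧
        f.IsPermutation ∧
        f ∈ InPlace.inplaceFL ∧
        f ∉ InPlace.FSPACESublinear ∧
        f ∉ InPlace.FL) ∧
      ¬ InPlace.inplaceFL ⊆ InPlace.FL) ∧
    ∀ O : InPlace.Oracle,
      (∃ (L : Set (List Bool)) (f : InPlace.FunFamily),
        InPlace.IsUnary L ∧
        L ∈ InPlace.SPACERel O (fun n => n) ∧
        L ∉ InPlace.SPACESublinearRel O ∧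
        InPlace.FlipsLastBitBy f.toFun L ∧
        f.IsPermutation ∧
        f ∈ InPlace.inplaceFLRel O ∧
        f ∉ InPlace.FSPACESublinearRel O ∧
        f ∉ InPlace.FLRel O) ∧
      ¬ InPlace.inplaceFLRel O ⊆ InPlace.FLRel O := by
  open InPlace in
  have hunary : ∀ O, IsUnary (diagLang O) := fun O x ⟨n, hn, _⟩ => ⟨n, hn⟩
  have hFL : ∀ O, diagPerm O ∉ FLRel O := fun O h => diagPerm_notMem (FLRel_subset h)
  -- without oracle access a machine can do as much as with the oracle that is constantly `false`
  have hFL' : diagPerm (fun _ => false) ∉ FL := fun ⟨k, h⟩ => hFL _ ⟨k, FSPACE_subset _ h⟩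
  have hin := inplaceFLRel_false_subset (diagPerm_mem_inplaceFLRel (O := fun _ => false))
  exact ⟨⟨⟨diagLang _, diagPerm _, hunary _, FSPACERel_false_subset _ diagLang_mem_SPACERel,
      fun ⟨s, hs, h⟩ => diagLang_notMem ⟨s, hs, FSPACE_subset _ h⟩, diagFlip_flips,
      diagPerm_isPermutation, hin, fun ⟨s, hs, h⟩ => diagPerm_notMem ⟨s, hs, FSPACE_subset _ h⟩,
      hFL'⟩, fun h => hFL' (h hin)⟩,
    fun O => ⟨⟨diagLang O, diagPerm O, hunary O, diagLang_mem_SPACERel, diagLang_notMem,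
      diagFlip_flips, diagPerm_isPermutation, diagPerm_mem_inplaceFLRel, diagPerm_notMem, hFL O⟩,
      fun h => hFL O (h diagPerm_mem_inplaceFLRel)⟩⟩
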